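/- Conventions. All bodies and curves are in $\mathbb R^3$; $O$ is the origin, $|\cdot|$ is Lebesgue volume, $\times$ and $\cdot$ are the vector and scalar products. For a convex body $K$ with $O\in\operatorname{int}K$ let $\mu_K(x)=\min\{\lambda\ge 0: x\in\lambda K\}$, $\rho_K(x)=1/\mu_K(x)$ for $x \ne O$, $h_K=\tfrac12\mu_K^2$, and $K^\circ=\{y: y\cdot x\le 1\text{ for all }x\in K\}$. Let $\hat{\mathcal K}$ be the set of centrally symmetric ($K=-K$) convex bodies $K$ with nonempty interior, whose boundary $\partial K$ is a $C^\infty$ hypersurface and which are strongly convex, i.e. the Hessian $D^2h_K(x)$ is positive definite for every unit vector $x$. For a piecewise smooth oriented simple closed curve $c$ on $\partial K$, let $\mathcal S_K(c)\subset\partial K$ be the closed piece of surface enclosed by $c$ with the orientation compatible with that of $c$, i.e. the closed region of $\partial K$ bounded by $c$ that lies to the left of $c$ as seen from outside $K$, and let $O*\mathcal S_K(c)=\{\lambda u: u\in\mathcal S_K(c),\ 0\le\lambda\le 1\}$. Arcs. Let $K\in\hat{\mathcal K}$. Let $A,B,C$ be the points where the positive $x$-, $y$-, $z$-axes meet $\partial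 K$, and for $P,Q\in\partial K$ with $P\ne\pm Q$ let $\mathcal C_K(P,Q)$ be the oriented curve $t\mapsto\rho_K((1-t)P+tQ)\,((1-t)P+tQ)$, $0\le t\le1$. Put $d=\mathcal C_K(B,C)$, $e=\mathcal C_K(C,-B)$, $f=\mathcal C_K(C,A)$, $g=\mathcal C_K(A,-C)$, $h=\mathcal C_K(A,B)$, $i=\mathcal C_K(B,-A)$, and $d^\circ=\Lambda\circ d,\dots,i^\circ=\Lambda\circ i$, where $\Lambda=\nabla h_K|_{\partial K}:\partial K\to\partial K^\circ$. For a curve $\gamma$ write $\overline\gamma=\int_0^1\gamma(t)\times\gamma'(t)\,dt$ for its vector area integral, $\widetilde\gamma(t)=\gamma(1-t)$ for the reversed curve, and $\cup$ for concatenation. Let $$K_1=O*\mathcal S_K(d\cup f\cup h),\quad K_2=O*\mathcal S_K(\widetilde d\cup i\cup -g),\quad K_3=O*\mathcal S_K(\widetilde e\cup\widetilde{-g}\cup -h),\quad K_4=O*\mathcal S_K(e\cup -i\cup\widetilde f),$$ and let $K_1^\circ,\dots,K_4^\circ$ be the pieces of $K^\circ$ defined in the same way, with $K^\circ,d^\circ,\dots,i^\circ$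 in place of $K,d,\dots,i$. Proposition. Let $K\in\hat{\mathcal K}$. (1) For every piecewise smooth, oriented, simple closed curve $c$ on $\partial K$ and every point $P\in K$, $$\frac16\int_c(P\times \mathbf r)\cdot d\mathbf r\le|O*\mathcal S_K(c)|.$$ (2) Put $V_1^\circ=\overline{d^\circ}+\overline{f^\circ}+\overline{h^\circ}$, $V_2^\circ=-\overline{d^\circ}+\overline{g^\circ}+\overline{i^\circ}$, $V_3^\circ=-\overline{e^\circ}-\overline{g^\circ}+\overline{h^\circ}$, $V_4^\circ=\overline{e^\circ}-\overline{f^\circ}+\overline{i^\circ}$. For $j=1,2,3,4$ we have $|K_j^\circ|>0$, $V_j^\circ\cdot P\le 6|K_j^\circ|$ for all $P\in K^\circ$, and $$\frac1{6|K_j^\circ|}V_j^\circ\in K .$$ (3) Put $V_1=\overline d+\overline f+\overline h$, $V_2=-\overline d+\overline g+\overline i$, $V_3=-\overline e-\overline g+\overline h$, $V_4=\overline e-\overline f+\overline i$. For $j=1,2,3,4$ we have $|K_j|>0$, $V_j\cdot P\le 6|K_j|$ for all $P\in K$, and $$\frac1{6|K_j|}V_j\in K^\circ .$$ -/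

import Mathlib

open MeasureTheory Set Filter Topology
open scoped ContDiff

namespace SymMahler

noncomputable section

/-- Euclidean three-space. -/
abbrev E3 : Type := EuclideanSpace ℝ (Fin 3)

/-- The vector product of `ℝ³`. -/
def cross (x y : E3) : E3 := WithLp.toLp 2 (crossProduct x.ofLp y.ofLp)

/-! ### Convex bodies -/

/-- `h_K = μ_K² / 2`, where `μ_K` is the Minkowski gauge of `K`. -/
def halfSqGauge (K : Set E3) (x : E3) : ℝ := (1 / 2) * gauge K x ^ 2

/-- The radial function `ρ_K = 1 / μ_K`. -/
def radial (K : Set E3) (x : E3) : ℝ := (gauge K x)⁻¹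

/-- The central projection `x ↦ ρ_K(x) x` of `ℝ³ \ {O}` onto `∂K`. -/
def radialProj (K : Set E3) (x : E3) : E3 := radial K x • x

/-- The gradient of `h_K`.  At a point of `∂K` it is an outward normal vector of `∂K`;
its restriction to `∂K` is the map `Λ : ∂K → ∂K°`. -/
def normalMap (K : Set E3) (x : E3) : E3 := gradient (halfSqGauge K) x

/-- The polar body with respect to the origin. -/
def polarBody (K : Set E3) : Set E3 := {y | ∀ x ∈ K, inner ℝ y x ≤ 1}

/-- `M` is a `C^∞` hypersurface of `ℝ³`: locally the zero set of a smooth function with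
nonvanishing differential. -/
def IsSmoothHypersurface (M : Set E3) : Prop :=
  ∀ x ∈ M, ∃ U : Set E3, IsOpen U ∧ x ∈ U ∧ ∃ f : E3 → ℝ,
    ContDiffOn ℝ ∞ f U ∧ (∀ y ∈ U, y ∈ M ↔ f y = 0) ∧ fderiv ℝ f x ≠ 0

/-- Centrally symmetric convex bodies in `ℝ³` with smooth boundary that are strongly convex,
i.e. the Hessian of `h_K` is positive definite at each point of the unit sphere. -/
structure IsSmoothStronglyConvexBody (K : Set E3) : Prop where
  isCompact : IsCompact K
  convex : Convex ℝ K
  interior_nonempty : (interior K).Nonempty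
  symm : ∀ x ∈ K, -x ∈ K
  smooth_boundary : IsSmoothHypersurface (frontier K)
  hessian_pos : ∀ x : E3, ‖x‖ = 1 → ∀ v : E3, v ≠ 0 →
    0 < fderiv ℝ (fderiv ℝ (halfSqGauge K)) x v v

/-! ### Curves, parametrized by `[0, 1]` -/

/-- `c` is continuous on `[0, 1]`, and `C^∞` on each closed interval of some finite subdivision. -/
def IsPiecewiseSmooth (c : ℝ → E3) : Prop :=
  ContinuousOn c (Icc 0 1) ∧ ∃ (n : ℕ) (s : Fin (n + 1) → ℝ), StrictMono s ∧ s 0 = 0 ∧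
    s (Fin.last n) = 1 ∧ ∀ k : Fin n, ContDiffOn ℝ ∞ c (Icc (s k.castSucc) (s k.succ))

/-- `c` is a piecewise smooth (oriented) simple closed curve lying on `M`. -/
structure IsSimpleClosedCurveOn (M : Set E3) (c : ℝ → E3) : Prop where
  mem : ∀ t ∈ Icc (0 : ℝ) 1, c t ∈ M
  piecewiseSmooth : IsPiecewiseSmooth c
  closed : c 0 = c 1
  simple : InjOn c (Ico 0 1)

/-- The line integral `∫_c (P × r) · dr`. -/
def signedIntegral (P : E3) (c : ℝ → E3) : ℝ :=
  ∫ t in (0 : ℝ)..1, inner ℝ (cross P (c t)) (deriv c t)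

/-- The vector area integral `∫_c r × dr`. -/
def vecInt (c : ℝ → E3) : E3 := ∫ t in (0 : ℝ)..1, cross (c t) (deriv c t)

/-- The reversed curve. -/
def rev (c : ℝ → E3) : ℝ → E3 := fun t => c (1 - t)

/-- First `c`, then `d`. -/
def concat (c d : ℝ → E3) : ℝ → E3 := fun t => if t ≤ 1 / 2 then c (2 * t) else d (2 * t - 1)

/-- The part `U` of `∂K` lies to the left of `c`, seen from outside `K`: at some regular point
of `c` the conormal direction `ν × c'` (with `ν` an outward normal), transported to `∂K` by the
central projection, leads into `U`.  If `c` is a simple closed curve and `U` is one of the two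
components of `∂K \ c`, then the choice of the regular point does not matter. -/
def LiesLeft (K : Set E3) (c : ℝ → E3) (U : Set E3) : Prop :=
  ∃ t ∈ Ioo (0 : ℝ) 1, deriv c t ≠ 0 ∧
    ∀ᶠ ε in 𝓝[>] (0 : ℝ), radialProj K (c t + ε • cross (normalMap K (c t)) (deriv c t)) ∈ U

/-- The piece `S_K(c)` of `∂K` enclosed by the closed curve `c`, with the orientation compatible
with that of `c`: the curve itself and the component of `∂K \ c` lying to the left of `c`. -/
def enclosedPiece (K : Set E3) (c : ℝ → E3) : Set E3 :=
  c '' Icc 0 1 ∪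
    {Q | Q ∈ frontier K ∧ LiesLeft K c (connectedComponentIn (frontier K \ c '' Icc 0 1) Q)}

/-- The cone `O * S`. -/
def cone (S : Set E3) : Set E3 := {x | ∃ u ∈ S, ∃ l ∈ Icc (0 : ℝ) 1, x = l • u}

/-- The volume of the cone `O * S_K(c)`. -/
def coneVol (K : Set E3) (c : ℝ → E3) : ℝ := (volume : Measure E3).real (cone (enclosedPiece K c))

/-! ### The decomposition by the coordinate planes -/

/-- The oriented segment from `P` to `Q` on `∂K`. -/
def orientedSegment (K : Set E3) (P Q : E3) : ℝ → E3 :=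
  fun t => radialProj K ((1 - t) • P + t • Q)

/-- The points of `∂K` on the three positive coordinate axes. -/
def axisPt (K : Set E3) (j : Fin 3) : E3 := radialProj K (EuclideanSpace.single j 1)

/-- Six arcs on the boundary of a body. -/
structure Arcs where
  d : ℝ → E3
  e : ℝ → E3
  f : ℝ → E3
  g : ℝ → E3
  h : ℝ → E3
  i : ℝ → E3

/-- The arcs `d, …, i` on `∂K`, in the coordinate planes. -/
def arcs (K : Set E3) : Arcs where
  d := orientedSegment K (axisPt K 1) (axisPt K 2)
  e := orientedSegment K (axisPt K 2) (-axisPt K 1)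
  f := orientedSegment K (axisPt K 2) (axisPt K 0)
  g := orientedSegment K (axisPt K 0) (-axisPt K 2)
  h := orientedSegment K (axisPt K 0) (axisPt K 1)
  i := orientedSegment K (axisPt K 1) (-axisPt K 0)

/-- The arcs `d° = Λ ∘ d, …, i° = Λ ∘ i` on `∂K°`. -/
def polarArcs (K : Set E3) : Arcs where
  d := normalMap K ∘ (arcs K).d
  e := normalMap K ∘ (arcs K).e
  f := normalMap K ∘ (arcs K).f
  g := normalMap K ∘ (arcs K).g
  h := normalMap K ∘ (arcs K).h
  i := normalMap K ∘ (arcs K).i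

/-- The closed curves bounding the first four pieces. -/
def Arcs.loop (a : Arcs) : Fin 4 → ℝ → E3 :=
  ![concat a.d (concat a.f a.h),
    concat (rev a.d) (concat a.i (-a.g)),
    concat (rev a.e) (concat (rev (-a.g)) (-a.h)),
    concat a.e (concat (-a.i) (rev a.f))]

/-- The signed sums of the vector area integrals of the arcs, one for each of the four pieces. -/
def Arcs.vec (a : Arcs) : Fin 4 → E3 :=
  ![vecInt a.d + vecInt a.f + vecInt a.h,
    -vecInt a.d + vecInt a.g + vecInt a.i,
    -vecInt a.e - vecInt a.g + vecInt a.h,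
    vecInt a.e - vecInt a.f + vecInt a.i]

/-- The volumes `|K_1|, …, |K_4|`. -/
def pieceVol (K : Set E3) (j : Fin 4) : ℝ := coneVol K ((arcs K).loop j)

/-- The volumes `|K°_1|, …, |K°_4|`. -/
def polarPieceVol (K : Set E3) (j : Fin 4) : ℝ := coneVol (polarBody K) ((polarArcs K).loop j)

end

end SymMahler

open SymMahler

/-! Let `P ≠ 0`, `p = |P|`, and let `γ` be the orthogonal projection of `c` along `P`, with values
in `ℂ` through a positively oriented frame whose last vector is `P / p`. Then `(P × r) · dr = p Im
(conj γ dγ)`, so the line integral is `2p` times the signed area enclosed by `γ`, which is the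
integral over the plane of the winding number of `γ`. The latter is
`IsPC1.integral_im_conj_mul_deriv`: integrate `γ' / (γ - z)` over `t` and over `z` in a large disc
in both orders; one order gives winding numbers, the other the Cauchy transform `π conj ζ` of the
disc. Let `S` be the piece enclosed by `c`. Two facts remain.

(a) Off the curve, the winding number is at most the indicator function of the projection of `S`
(`index_eq_one_and_exists_mem_enclosedPiece`). If it is positive at `z`, then `z` is the projection
of an interior point `q` of `K`, by separation. Stereographic projection of the directions seen from
`q`, with the downward direction as pole, turns `c` into a simple closed plane curve with the same
index about `0`. A simple closed plane curve with positive index about a point has index one there,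
and its left side belongs to the component of that point (`index_eq_one_and_left_mem`). This half of
the Jordan curve theorem rests on the jump of the index across the curve and on the fact that all
points of nonzero index lie in one component. Transported back to `∂K`, it says that the boundary
point directly above `q` belongs to `S`.

(b) The projection of `S` has area at most `(3 / p) |O * S|` (`volume_planeProj_image_le`). The map
sending `r u`, with `u ∈ S` and `0 < r ≤ 1`, to the point at height `r³` over the projection of `u`
carries the cone without its apex onto a right cylinder of height one. Its Jacobian is three times
the derivative of the gauge in the direction of `P / p`, at most `3 / p` in absolute value because
`P ∈ K`.

Together, the line integral is at most `2p · (3 / p) |O * S| = 6 |O * S|`.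

For (2) and (3), the four loops on `∂K` are central projections of boundaries of triangles with
linearly independent vertices, hence simple; their images under the injective map `Λ` are simple
closed curves on `∂K°`. The vectors `V_j` are the vector area integrals over these loops, so `V_j ·
P` is the line integral bounded above, and the volumes are positive since a nonempty open cone piece
lies to the left of each loop. Dividing by `6 |K_j|` puts the vector in the polar body; for the
loops on `∂K°` this is `K°° = K`. The argument only needs a differentiable gauge (`IsRegularBody`),
which `K°` has because `K` is strictly convex, so smoothness of `∂K°` never enters. -/

namespace SymMahler

/-! ### Continuous logarithms and the winding number -/

/-- A nonvanishing complex function on a normed space has a continuous logarithm. -/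
theorem exists_continuous_log {E : Type*} [NormedAddCommGroup E] [NormedSpace ℝ E] {g : E → ℂ}
    (hg : Continuous g) (h : ∀ x, g x ≠ 0) :
    ∃ G : E → ℂ, Continuous G ∧ ∀ x, Complex.exp (G x) = g x := by
  have := (convex_univ (𝕜 := ℝ) (E := E)).contractibleSpace univ_nonempty
  have hu : IsSimplyConnected (univ : Set E) := SimplyConnectedSpace.ofContractible _
  obtain ⟨G, hG, hGg⟩ := Complex.exists_continuousOn_eqOn_exp_comp hu isOpen_univ
    hg.continuousOn (by simpa using h)
  exact ⟨G, continuousOn_univ.1 hG, fun x => hGg (mem_univ x)⟩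

/-- The closed curve `f` in `ℂ \ {0}` winds `n` times around the origin. -/
def HasIndex (f : ℝ → ℂ) (n : ℤ) : Prop :=
  ∃ φ : ℝ → ℂ, ContinuousOn φ (Icc 0 1) ∧ (∀ t ∈ Icc (0 : ℝ) 1, Complex.exp (φ t) = f t) ∧
    φ 1 - φ 0 = 2 * Real.pi * Complex.I * n

/-- Two continuous logarithms of one function differ by a continuous function with values in the
discrete group `2πiℤ`, hence by a constant. -/
theorem log_increment_eq {a b : ℝ} (hab : a ≤ b) {φ ψ : ℝ → ℂ} (hφ : ContinuousOn φ (Icc a b))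
    (hψ : ContinuousOn ψ (Icc a b))
    (h : ∀ t ∈ Icc a b, Complex.exp (φ t) = Complex.exp (ψ t)) :
    φ b - φ a = ψ b - ψ a := by
  have hd : DiscreteTopology (AddSubgroup.zmultiples (2 * Real.pi * Complex.I : ℂ)) :=
    NormedSpace.discreteTopology_zmultiples _
  have := (isPreconnected_Icc (a := a) (b := b)).constant_of_mapsTo
    (T := (AddSubgroup.zmultiples (2 * Real.pi * Complex.I : ℂ) : Set ℂ)) hd.isDiscrete
    (hφ.sub hψ) (fun t ht => by
      obtain ⟨n, hn⟩ := Complex.exp_eq_exp_iff_exists_int.1 (h t ht)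
      exact ⟨n, by simp [hn]⟩) (left_mem_Icc.2 hab) (right_mem_Icc.2 hab)
  simp only [Pi.sub_apply] at this
  linear_combination -this

theorem two_pi_I_mul_intCast_inj {m n : ℤ}
    (h : (2 * Real.pi * Complex.I * m : ℂ) = 2 * Real.pi * Complex.I * n) : m = n := by
  exact_mod_cast mul_left_cancel₀ Complex.two_pi_I_ne_zero h

namespace HasIndex

variable {f g : ℝ → ℂ} {m n : ℤ}

theorem congr (hf : HasIndex f n) (h : ∀ t ∈ Icc (0 : ℝ) 1, f t = g t) : HasIndex g n := by
  obtain ⟨φ, h1, h2, h3⟩ := hf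
  exact ⟨φ, h1, fun t ht => (h2 t ht).trans (h t ht), h3⟩

theorem eq (hm : HasIndex f m) (hn : HasIndex f n) : m = n := by
  obtain ⟨φ, h1, h2, h3⟩ := hm
  obtain ⟨ψ, g1, g2, g3⟩ := hn
  apply two_pi_I_mul_intCast_inj
  rw [← h3, ← g3]
  exact log_increment_eq zero_le_one h1 g1 fun t ht => (h2 t ht).trans (g2 t ht).symm

theorem mul (hf : HasIndex f m) (hg : HasIndex g n) : HasIndex (fun t => f t * g t) (m + n) := by
  obtain ⟨φ, h1, h2, h3⟩ := hf
  obtain ⟨ψ, g1, g2, g3⟩ := hg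
  refine ⟨fun t => φ t + ψ t, h1.add g1, fun t ht => ?_, ?_⟩
  · rw [Complex.exp_add, h2 t ht, g2 t ht]
  · push_cast
    linear_combination h3 + g3

theorem zpow (hf : HasIndex f m) (k : ℤ) : HasIndex (fun t => f t ^ k) (k * m) := by
  obtain ⟨φ, h1, h2, h3⟩ := hf
  refine ⟨fun t => k * φ t, continuousOn_const.mul h1, fun t ht => ?_, ?_⟩
  · rw [Complex.exp_int_mul, h2 t ht]
  · push_cast
    linear_combination k * h3

theorem div (hf : HasIndex f m) (hg : HasIndex g n) : HasIndex (fun t => f t / g t) (m - n) := by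
  have := hf.mul (hg.zpow (-1))
  rw [neg_one_mul, ← sub_eq_add_neg] at this
  exact this.congr fun t _ => by rw [zpow_neg_one, div_eq_mul_inv]

theorem ne_zero (hf : HasIndex f m) {t : ℝ} (ht : t ∈ Icc (0 : ℝ) 1) : f t ≠ 0 := by
  obtain ⟨φ, -, h2, -⟩ := hf
  rw [← h2 t ht]
  exact Complex.exp_ne_zero _

/-- A closed curve in a rotated slit plane has index zero. -/
theorem of_slitPlane (hf : ContinuousOn f (Icc 0 1)) (h01 : f 0 = f 1) {b : ℂ} (hb : b ≠ 0)
    (h : ∀ t ∈ Icc (0 : ℝ) 1, f t / b ∈ Complex.slitPlane) : HasIndex f 0 := by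
  refine ⟨fun t => Complex.log (f t / b) + Complex.log b,
    ((hf.div_const b).clog h).add continuousOn_const, fun t ht => ?_, by simp [h01]⟩
  rw [Complex.exp_add, Complex.exp_log (Complex.slitPlane_ne_zero (h t ht)), Complex.exp_log hb,
    div_mul_cancel₀ _ hb]

theorem exists_of_continuousOn (hf : ContinuousOn f (Icc 0 1)) (h01 : f 0 = f 1)
    (h : ∀ t ∈ Icc (0 : ℝ) 1, f t ≠ 0) : ∃ n, HasIndex f n := by
  have h0 : (0 : ℝ) ∈ Icc (0 : ℝ) 1 := by simp
  have h1 : (1 : ℝ) ∈ Icc (0 : ℝ) 1 := by simp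
  -- Extending by the endpoint values makes the curve a continuous nonvanishing function on all of
  -- `ℝ`, where a logarithm exists.
  set F : ℝ → ℂ := IccExtend zero_le_one ((Icc (0 : ℝ) 1).domRestrict f) with hF
  have hFf : ∀ t ∈ Icc (0 : ℝ) 1, F t = f t := fun t ht => by
    rw [hF, IccExtend_of_mem _ _ ht]; rfl
  have hFc : Continuous F := (continuousOn_iff_continuous_domRestrict.1 hf).Icc_extend'
  obtain ⟨φ, hφ, hφF⟩ := exists_continuous_log hFc
    fun t => h _ (projIcc (0 : ℝ) 1 zero_le_one t).2
  have hφ' : ∀ t ∈ Icc (0 : ℝ) 1, Complex.exp (φ t) = f t := fun t ht =>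
    (hφF t).trans (hFf t ht)
  obtain ⟨n, hn⟩ := Complex.exp_eq_exp_iff_exists_int.1
    (((hφ' 1 h1).trans h01.symm).trans (hφ' 0 h0).symm)
  exact ⟨n, φ, hφ.continuousOn, hφ', by rw [hn]; ring⟩

end HasIndex

/-! ### Index and components of the complement of a plane curve -/

section Planar

variable {ζ : ℝ → ℂ}

theorem isCompact_curve {X : Type*} [TopologicalSpace X] {c : ℝ → X}
    (hc : ContinuousOn c (Icc 0 1)) : IsCompact (c '' Icc 0 1) :=
  isCompact_Icc.image_of_continuousOn hc

theorem exists_index (hc : ContinuousOn ζ (Icc 0 1)) (h01 : ζ 0 = ζ 1) {p : ℂ}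
    (hp : p ∉ ζ '' Icc 0 1) : ∃ n, HasIndex (fun t => ζ t - p) n :=
  HasIndex.exists_of_continuousOn (hc.sub continuousOn_const) (by simp [h01])
    fun t ht h => hp ⟨t, ht, sub_eq_zero.1 h⟩

theorem one_sub_mem_slitPlane {z : ℂ} (hz : ‖z‖ < 1) : 1 - z ∈ Complex.slitPlane := by
  left
  have := (Complex.abs_re_le_norm z).trans_lt hz
  rw [abs_lt] at this
  simp only [Complex.sub_re, Complex.one_re]
  linarith

/-- The quotient `(ζ - q) / (ζ - p) = 1 - (q - p) / (ζ - p)` stays in the unit disc about `1`, so it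
does not wind around the origin. -/
theorem hasIndex_of_dist_lt (hc : ContinuousOn ζ (Icc 0 1)) (h01 : ζ 0 = ζ 1) {p q : ℂ} {n : ℤ}
    (hp : HasIndex (fun t => ζ t - p) n) (h : ∀ t ∈ Icc (0 : ℝ) 1, ‖q - p‖ < ‖ζ t - p‖) :
    HasIndex (fun t => ζ t - q) n := by
  have h0 : ∀ t ∈ Icc (0 : ℝ) 1, ζ t - p ≠ 0 := fun t ht => hp.ne_zero ht
  have key : HasIndex (fun t => (ζ t - q) / (ζ t - p)) 0 := by
    refine HasIndex.of_slitPlane (b := 1) ?_ (by simp [h01]) one_ne_zero fun t ht => ?_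
    · exact (hc.sub continuousOn_const).div (hc.sub continuousOn_const) h0
    · have : (ζ t - q) / (ζ t - p) / 1 = 1 - (q - p) / (ζ t - p) := by
        field_simp [h0 t ht]; ring
      rw [this]
      apply one_sub_mem_slitPlane
      rw [norm_div, div_lt_one (norm_pos_iff.2 (h0 t ht))]
      exact h t ht
  have := key.mul hp
  rw [zero_add] at this
  exact this.congr fun t ht => div_mul_cancel₀ _ (h0 t ht)

/-- By `hasIndex_of_dist_lt` the index is locally constant off the curve. -/
theorem index_eq_of_isPreconnected (hc : ContinuousOn ζ (Icc 0 1)) (h01 : ζ 0 = ζ 1) {W : Set ℂ}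
    (hW : IsPreconnected W) (hd : W ⊆ (ζ '' Icc 0 1)ᶜ) {p q : ℂ} (hpW : p ∈ W) (hqW : q ∈ W)
    {m n : ℤ} (hp : HasIndex (fun t => ζ t - p) m) (hq : HasIndex (fun t => ζ t - q) n) :
    m = n := by
  choose! idx hidx using fun (v : ℂ) (hv : v ∈ (ζ '' Icc 0 1)ᶜ) => exists_index hc h01 hv
  have hcont : ContinuousOn idx W := by
    intro v hv
    refine ContinuousAt.continuousWithinAt ?_
    have hvΓ := hd hv
    obtain ⟨r, hr, hball⟩ := Metric.isOpen_iff.1 (isCompact_curve hc).isClosed.isOpen_compl v hvΓ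
    refine continuousAt_const.congr (f := fun _ => idx v) ?_
    filter_upwards [Metric.ball_mem_nhds v hr] with u hu
    refine (hidx u (hball hu)).eq (hasIndex_of_dist_lt hc h01 (hidx v hvΓ) fun t ht => ?_) |>.symm
    have : r ≤ ‖ζ t - v‖ := by
      by_contra hlt
      exact hball (mem_ball_iff_norm.2 (not_le.1 hlt)) ⟨t, ht, rfl⟩
    exact (mem_ball_iff_norm.1 hu).trans_le this
  have := hW.constant_of_mapsTo (T := univ)
    (inferInstance : DiscreteTopology (univ : Set ℤ)).isDiscrete hcont
    (mapsTo_univ _ _) hpW hqW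
  rw [hp.eq (hidx p (hd hpW)), hq.eq (hidx q (hd hqW)), this]

theorem index_eq_zero_of_norm_lt (hc : ContinuousOn ζ (Icc 0 1)) (h01 : ζ 0 = ζ 1) {p : ℂ}
    (h : ∀ t ∈ Icc (0 : ℝ) 1, ‖ζ t‖ < ‖p‖) : HasIndex (fun t => ζ t - p) 0 := by
  have hp : p ≠ 0 := by
    rintro rfl
    have := h 0 (by simp)
    simp only [norm_zero] at this
    exact (norm_nonneg _).not_gt this
  refine HasIndex.of_slitPlane (b := -p) (hc.sub continuousOn_const) (by simp [h01])
    (neg_ne_zero.2 hp) fun t ht => ?_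
  have : (ζ t - p) / -p = 1 - ζ t / p := by field_simp; ring
  rw [this]
  apply one_sub_mem_slitPlane
  rw [norm_div, div_lt_one (norm_pos_iff.2 hp)]
  exact h t ht

/-- Components of the open complement are open, so a limit point of one of them off `Γ` has a
neighbourhood in its own component, which must then be the same one. -/
theorem closure_connectedComponentIn_subset {Γ : Set ℂ} (hΓ : IsClosed Γ) (p : ℂ) :
    closure (connectedComponentIn Γᶜ p) ⊆ connectedComponentIn Γᶜ p ∪ Γ := by
  intro x hx
  by_cases hxΓ : x ∈ Γ
  · exact Or.inr hxΓ
  left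
  obtain ⟨y, hy1, hy2⟩ := mem_closure_iff.1 hx _ (hΓ.isOpen_compl.connectedComponentIn (x := x))
    (mem_connectedComponentIn hxΓ)
  rw [connectedComponentIn_eq hy2, ← connectedComponentIn_eq hy1]
  exact mem_connectedComponentIn hxΓ

theorem isBounded_connectedComponentIn (hc : ContinuousOn ζ (Icc 0 1)) (h01 : ζ 0 = ζ 1) {p : ℂ}
    {m : ℤ} (hp : HasIndex (fun t => ζ t - p) m) (hm : m ≠ 0) :
    Bornology.IsBounded (connectedComponentIn (ζ '' Icc 0 1)ᶜ p) := by
  have hpΓ : p ∈ (ζ '' Icc 0 1)ᶜ := by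
    rintro ⟨t, ht, rfl⟩
    exact hp.ne_zero ht (sub_self _)
  obtain ⟨R, hR⟩ := (isCompact_curve hc).isBounded.exists_norm_le
  rw [isBounded_iff_forall_norm_le]
  refine ⟨R, fun v hv => ?_⟩
  by_contra hlt
  refine hm (index_eq_of_isPreconnected hc h01 isPreconnected_connectedComponentIn
    (connectedComponentIn_subset _ _) (mem_connectedComponentIn hpΓ) hv hp
    (index_eq_zero_of_norm_lt hc h01 fun t ht => ?_))
  exact (hR _ ⟨t, ht, rfl⟩).trans_lt (not_le.1 hlt)

/-- A function on a closed interval that is compatible with a simple closed curve descends to a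
continuous function on the plane. -/
theorem exists_continuous_extension (hc : ContinuousOn ζ (Icc 0 1)) (h01 : ζ 0 = ζ 1)
    (hi : InjOn ζ (Ico 0 1)) {φ : ℝ → ℂ} (hφ : ContinuousOn φ (Icc 0 1)) (hφ01 : φ 0 = φ 1) :
    ∃ Φ : ℂ → ℂ, Continuous Φ ∧ ∀ t ∈ Icc (0 : ℝ) 1, Φ (ζ t) = φ t := by
  have hΓ := isCompact_curve hc
  have hmaps : MapsTo ζ (Icc 0 1) (ζ '' Icc 0 1) := mapsTo_image _ _
  let c : C(Icc (0 : ℝ) 1, ζ '' Icc (0 : ℝ) 1) :=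
    ⟨hmaps.restrict, hc.mapsToRestrict hmaps⟩
  have hsurj : Function.Surjective c := by
    rintro ⟨-, t, ht, rfl⟩
    exact ⟨⟨t, ht⟩, rfl⟩
  -- A continuous surjection from a compact space to a Hausdorff space is closed, hence a quotient
  -- map; a function compatible with the identification of the endpoints therefore descends to the
  -- image of the curve.
  have hq : IsQuotientMap c := (c.continuous.isClosedMap).isQuotientMap c.continuous hsurj
  have hred : ∀ t ∈ Icc (0 : ℝ) 1, ∃ s ∈ Ico (0 : ℝ) 1, ζ s = ζ t ∧ φ s = φ t := by
    intro t ht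
    rcases ht.2.lt_or_eq with h | h
    · exact ⟨t, ⟨ht.1, h⟩, rfl, rfl⟩
    · exact ⟨0, by simp, by rw [h, h01], by rw [h, hφ01]⟩
  let φ' : C(Icc (0 : ℝ) 1, ℂ) := ⟨(Icc (0 : ℝ) 1).domRestrict φ,
    continuousOn_iff_continuous_domRestrict.1 hφ⟩
  have hφ' : ∀ a b, c a = c b → φ' a = φ' b := by
    rintro ⟨t, ht⟩ ⟨s, hs⟩ hts
    have hts' : ζ t = ζ s := congrArg Subtype.val hts
    obtain ⟨t', ht', h1, h2⟩ := hred t ht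
    obtain ⟨s', hs', h3, h4⟩ := hred s hs
    have : t' = s' := hi ht' hs' (by rw [h1, h3, hts'])
    change φ t = φ s
    rw [← h2, ← h4, this]
  -- Tietze extension from the image of the curve to the plane.
  obtain ⟨Φ, hΦ⟩ := ContinuousMap.exists_restrict_eq hΓ.isClosed (hq.lift φ' hφ')
  refine ⟨Φ, Φ.continuous, fun t ht => ?_⟩
  calc Φ (ζ t) = (hq.lift φ' hφ') (c ⟨t, ht⟩) := by rw [← hΦ]; rfl
    _ = φ' ⟨t, ht⟩ := congrArg (fun k : C(Icc (0 : ℝ) 1, ℂ) => k ⟨t, ht⟩) (hq.lift_comp φ' hφ')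

theorem hasIndex_circle {R : ℝ} (hR : 0 < R) (n : ℤ) :
    HasIndex (fun t => (R * Complex.exp (2 * Real.pi * Complex.I * t)) ^ n) n := by
  refine ⟨fun t => n * (Real.log R + 2 * Real.pi * Complex.I * t), by fun_prop, fun t _ => ?_, ?_⟩
  · rw [Complex.exp_int_mul, Complex.exp_add, ← Complex.ofReal_exp, Real.exp_log hR]
  · simp; ring

/-- Two points about which a simple closed curve winds lie in the same component of its
complement. -/
theorem mem_connectedComponentIn_of_index_ne_zero (hc : ContinuousOn ζ (Icc 0 1))
    (h01 : ζ 0 = ζ 1) (hi : InjOn ζ (Ico 0 1)) {p q : ℂ} {m n : ℤ}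
    (hp : HasIndex (fun t => ζ t - p) m) (hm : m ≠ 0)
    (hq : HasIndex (fun t => ζ t - q) n) (hn : n ≠ 0) :
    q ∈ connectedComponentIn (ζ '' Icc 0 1)ᶜ p := by
  by_contra hqV
  have hΓ := (isCompact_curve hc).isClosed
  have hpΓ : p ∈ (ζ '' Icc 0 1)ᶜ := by
    rintro ⟨t, ht, rfl⟩
    exact hp.ne_zero ht (sub_self _)
  have hqΓ : q ∈ (ζ '' Icc 0 1)ᶜ := by
    rintro ⟨t, ht, rfl⟩
    exact hq.ne_zero ht (sub_self _)
  have hVb := isBounded_connectedComponentIn hc h01 hp hm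
  have hcl := closure_connectedComponentIn_subset hΓ p
  have hVo := hΓ.isOpen_compl.connectedComponentIn (x := p)
  have hpV := mem_connectedComponentIn hpΓ
  set V := connectedComponentIn (ζ '' Icc 0 1)ᶜ p
  have hfr : ∀ x ∈ closure V, x ∉ V → x ∈ ζ '' Icc 0 1 := fun x hx hxV => (hcl hx).resolve_left hxV
  have hqcl : q ∉ closure V := fun h => hqΓ (hfr q h hqV)
  -- The exponents are crossed so that `(ζ - p)ⁿ / (ζ - q)ᵐ` has index `nm - mn = 0`; its logarithm
  -- closes up along the curve.
  have hzero := (hp.zpow n).div (hq.zpow m)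
  rw [mul_comm, sub_self] at hzero
  obtain ⟨φ, hφ, hφe, hφ1⟩ := hzero
  obtain ⟨Φ, hΦ, hΦφ⟩ := exists_continuous_extension hc h01 hi hφ
    (by rw [Int.cast_zero, mul_zero, sub_eq_zero] at hφ1; exact hφ1.symm)
  classical
  -- `A` and `B` agree on the curve. Their only possible zeros or poles are `q`, outside the closure
  -- of `V`, and `p`, inside `V`. Using `A` on `V` and `B` elsewhere gives a continuous nonvanishing
  -- function on the whole plane.
  set A : ℂ → ℂ := fun x => (x - q) ^ m * Complex.exp (Φ x)
  set B : ℂ → ℂ := fun x => (x - p) ^ n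
  set g : ℂ → ℂ := V.piecewise A B
  have hAB : ∀ x ∈ closure V, g x = A x := by
    intro x hx
    by_cases hxV : x ∈ V
    · exact piecewise_eq_of_mem _ _ _ hxV
    · obtain ⟨t, ht, rfl⟩ := hfr x hx hxV
      rw [show g (ζ t) = B (ζ t) from piecewise_eq_of_notMem _ _ _ hxV]
      simp only [A, B]
      rw [hΦφ t ht, hφe t ht, mul_div_cancel₀ _ (zpow_ne_zero _ (hq.ne_zero ht))]
  have hBg : ∀ x ∈ Vᶜ, g x = B x := fun x hx => piecewise_eq_of_notMem _ _ _ hx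
  have hgc : Continuous g := by
    rw [← continuousOn_univ]
    have h1 : ContinuousOn g (closure V) := by
      refine ContinuousOn.congr (f := A) (fun x hx => ContinuousAt.continuousWithinAt ?_) hAB
      have : x - q ≠ 0 := fun h => hqcl (by rwa [← sub_eq_zero.1 h])
      exact ((continuousAt_id.sub continuousAt_const).zpow₀ m (Or.inl this)).mul
        (Complex.continuous_exp.comp hΦ).continuousAt
    have h2 : ContinuousOn g Vᶜ := by
      refine ContinuousOn.congr (f := B) (fun x hx => ContinuousAt.continuousWithinAt ?_) hBg
      have : x - p ≠ 0 := fun h => hx (by rwa [sub_eq_zero.1 h])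
      exact (continuousAt_id.sub continuousAt_const).zpow₀ n (Or.inl this)
    refine (h1.union_of_isClosed h2 isClosed_closure hVo.isClosed_compl).mono fun x _ => ?_
    by_cases hxV : x ∈ V
    · exact Or.inl (subset_closure hxV)
    · exact Or.inr hxV
  have hg0 : ∀ x, g x ≠ 0 := by
    intro x
    by_cases hxV : x ∈ V
    · rw [hAB x (subset_closure hxV)]
      have : x - q ≠ 0 := fun h => hqcl (by rw [← sub_eq_zero.1 h]; exact subset_closure hxV)
      exact mul_ne_zero (zpow_ne_zero _ this) (Complex.exp_ne_zero _)
    · rw [hBg x hxV]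
      have : x - p ≠ 0 := fun h => hxV (by rwa [sub_eq_zero.1 h])
      exact zpow_ne_zero _ this
  obtain ⟨G, hG, hGg⟩ := exists_continuous_log hgc hg0
  -- On a circle about `p` enclosing `V` the glued function is `(x - p)ⁿ`, of index `n ≠ 0`,
  -- although it has a logarithm on the whole plane.
  obtain ⟨R, hR, hVR⟩ := hVb.subset_ball_lt 0 p
  have hcirc := hasIndex_circle hR n
  refine hn (hcirc.eq ⟨fun t => G (p + R * Complex.exp (2 * Real.pi * Complex.I * t)),
    by fun_prop, fun t _ => ?_, ?_⟩)
  · have hnorm : ‖(R : ℂ) * Complex.exp (2 * Real.pi * Complex.I * t)‖ = R := by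
      rw [norm_mul, Complex.norm_real, Real.norm_of_nonneg hR.le,
        show (2 * Real.pi * Complex.I * t : ℂ) = ((2 * Real.pi * t : ℝ) : ℂ) * Complex.I by
          push_cast; ring, Complex.norm_exp_ofReal_mul_I, mul_one]
    rw [hGg, hBg]
    · simp [B]
    · intro h
      have := hVR h
      rw [mem_ball_iff_norm, add_sub_cancel_left, hnorm] at this
      exact lt_irrefl _ this
  · simp

end Planar

/-! ### Jump of the index across a simple closed curve -/

section Jump

variable {ζ : ℝ → ℂ}

/-- Both arguments lie in `(0, π)`, so their difference lies in `(-π, π)` and no correction by `2π`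
occurs. -/
theorem arg_div_of_im_pos {z w : ℂ} (hz : 0 < z.im) (hw : 0 < w.im) :
    (z / w).arg = z.arg - w.arg := by
  have hz0 : z ≠ 0 := by rintro rfl; simp at hz
  have hw0 : w ≠ 0 := by rintro rfl; simp at hw
  have h1 : w.arg ≠ Real.pi := fun h => hw.ne' (Complex.arg_eq_pi_iff.1 h).2
  have h2 : z.arg ≠ Real.pi := fun h => hz.ne' (Complex.arg_eq_pi_iff.1 h).2
  have h3 := Complex.arg_nonneg_iff.2 hz.le
  have h4 := Complex.arg_nonneg_iff.2 hw.le
  have h5 := (Complex.arg_le_pi w).lt_of_ne h1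
  have h6 := (Complex.arg_le_pi z).lt_of_ne h2
  have h7 : (w⁻¹).arg = -w.arg := by rw [Complex.arg_inv, if_neg h1]
  rw [div_eq_mul_inv, Complex.arg_mul hz0 (inv_ne_zero hw0) (by rw [h7]; constructor <;> linarith),
    h7, sub_eq_add_neg]

/-- Replacing `w` by `-w` reduces to the upper half-plane at the cost of `π`. This `π` and the `-π`
of the next lemma add up to the jump of the index. -/
theorem arg_sub_arg_of_im_pos_of_im_neg {z w : ℂ} (hz : 0 < z.im) (hw : w.im < 0) :
    z.arg - w.arg = Real.pi + (-(z / w)).arg := by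
  have h := arg_div_of_im_pos hz (w := -w) (by simpa using hw)
  rw [Complex.arg_neg_eq_arg_add_pi_of_im_neg hw, div_neg] at h
  rw [h]; ring

theorem arg_sub_arg_of_im_neg_of_im_pos {z w : ℂ} (hz : z.im < 0) (hw : 0 < w.im) :
    z.arg - w.arg = -Real.pi + (-(z / w)).arg := by
  have h := arg_div_of_im_pos (z := -z) (by simpa using hz) hw
  rw [Complex.arg_neg_eq_arg_add_pi_of_im_neg hz, neg_div] at h
  rw [h]; ring

theorem im_log_increment {a b : ℝ} (hab : a ≤ b) {φ ψ : ℝ → ℂ} (hφ : ContinuousOn φ (Icc a b))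
    (hψ : ContinuousOn ψ (Icc a b)) (h : ∀ t ∈ Icc a b, Complex.exp (φ t) = Complex.exp (ψ t)) :
    (φ b).im - (φ a).im = (ψ b).im - (ψ a).im := by
  simpa using congrArg Complex.im (log_increment_eq hab hφ hψ h)

/-- The real part has the sign of `|d|² - |e|²`. -/
theorem re_pos_of_norm_lt {d e : ℂ} (h : ‖e‖ < ‖d‖) : 0 < ((d - e) / (d + e)).re := by
  have hne : d + e ≠ 0 := by
    intro h0
    rw [eq_neg_of_add_eq_zero_left h0, norm_neg] at h
    exact lt_irrefl _ h
  have hsq : Complex.normSq e < Complex.normSq d := by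
    rw [Complex.normSq_eq_norm_sq, Complex.normSq_eq_norm_sq]
    exact pow_lt_pow_left₀ h (norm_nonneg _) two_ne_zero
  have hp : 0 < Complex.normSq (d + e) := Complex.normSq_pos.2 hne
  rw [Complex.div_re, ← add_div]
  refine div_pos ?_ hp
  simp only [Complex.normSq_apply, Complex.sub_re, Complex.add_re, Complex.sub_im,
    Complex.add_im] at hsq ⊢
  nlinarith

/-- The index jumps by one across a short two-sided segment that is transversal to the curve. -/
theorem index_eq_add_one (hc : ContinuousOn ζ (Icc 0 1)) (h01 : ζ 0 = ζ 1) {t₀ δ : ℝ}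
    (hδ : 0 < δ) (hδ0 : 0 < t₀ - δ) (hδ1 : t₀ + δ < 1) {e b : ℂ} {ε : ℝ} (hε : 0 < ε) (hb : b ≠ 0)
    (he : e = ε * b)
    (hneg : ∀ t, t₀ < t → t ≤ t₀ + δ → ((ζ t - ζ t₀) / b).im < 0)
    (hpos : ∀ t, t₀ - δ ≤ t → t < t₀ → 0 < ((ζ t - ζ t₀) / b).im)
    (hfar : ∀ t ∈ Icc (0 : ℝ) 1, t ≤ t₀ - δ ∨ t₀ + δ ≤ t → ‖e‖ < ‖ζ t - ζ t₀‖) {m n : ℤ}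
    (hm : HasIndex (fun t => ζ t - (ζ t₀ + e)) m) (hn : HasIndex (fun t => ζ t - (ζ t₀ - e)) n) :
    m = n + 1 := by
  set h : ℝ → ℂ := fun t => (ζ t - (ζ t₀ + e)) / (ζ t - (ζ t₀ - e)) with hh
  obtain ⟨φ, hφ, hφe, hφ1⟩ := hm.div hn
  change ∀ t ∈ Icc (0 : ℝ) 1, Complex.exp (φ t) = h t at hφe
  set u : ℝ → ℂ := fun t => (ζ t - ζ t₀) / b with hu
  have hdu : ∀ t, ζ t - ζ t₀ = u t * b := fun t => by rw [hu]; field_simp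
  have h2 : ∀ t, h t = -((ε - u t) / (ε + u t)) := by
    intro t
    have e1 : ζ t - (ζ t₀ + e) = b * (-(ε - u t)) := by rw [he]; linear_combination hdu t
    have e2 : ζ t - (ζ t₀ - e) = b * (ε + u t) := by rw [he]; linear_combination hdu t
    rw [hh]
    simp only
    rw [e1, e2, mul_div_mul_left _ _ hb, neg_div]
  -- Away from `t₀` the curve is farther from `ζ t₀` than the two test points are, so `h` stays in
  -- the right half-plane and its argument varies continuously.
  have hre : ∀ t ∈ Icc (0 : ℝ) 1, t ≤ t₀ - δ ∨ t₀ + δ ≤ t → h t ∈ Complex.slitPlane := by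
    intro t ht ht'
    left
    have := re_pos_of_norm_lt (hfar t ht ht')
    rwa [sub_sub, sub_add] at this
  have hhc : ContinuousOn h (Icc 0 1) :=
    (hc.sub continuousOn_const).div (hc.sub continuousOn_const) fun t ht => hn.ne_zero ht
  have huc : ContinuousOn u (Icc 0 1) := (hc.sub continuousOn_const).div_const _
  have hside : ∀ {a b : ℝ}, a ≤ b → Icc a b ⊆ Icc 0 1 →
      (∀ t ∈ Icc a b, t ≤ t₀ - δ ∨ t₀ + δ ≤ t) →
      (φ b).im - (φ a).im = (h b).arg - (h a).arg := by
    intro a b hab hsub hf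
    have := im_log_increment hab (hφ.mono hsub) (ψ := fun t => Complex.log (h t))
      ((hhc.mono hsub).clog fun t ht => hre t (hsub ht) (hf t ht)) fun t ht => by
        rw [hφe t (hsub ht), Complex.exp_log
          (Complex.slitPlane_ne_zero (hre t (hsub ht) (hf t ht)))]
    simpa only [Complex.log_im] using this
  have s1 := hside (a := 0) (b := t₀ - δ) hδ0.le
    (Icc_subset_Icc le_rfl (by linarith)) fun t ht => Or.inl ht.2
  have s3 := hside (a := t₀ + δ) (b := 1) hδ1.le
    (Icc_subset_Icc (by linarith) le_rfl) fun t ht => Or.inr ht.1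
  have hsub : Icc (t₀ - δ) (t₀ + δ) ⊆ Icc (0 : ℝ) 1 := Icc_subset_Icc hδ0.le hδ1.le
  have hslit : ∀ t ∈ Icc (t₀ - δ) (t₀ + δ),
      (ε - u t : ℂ) ∈ Complex.slitPlane ∧ (ε + u t : ℂ) ∈ Complex.slitPlane := by
    intro t ht
    rcases lt_trichotomy t t₀ with h | h | h
    · have := hpos t ht.1 h
      exact ⟨Or.inr (by simpa using this.ne'), Or.inr (by simpa using this.ne')⟩
    · have : u t = 0 := by rw [hu]; simp [h]
      rw [this]
      exact ⟨Or.inl (by simpa using hε), Or.inl (by simpa using hε)⟩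
    · have := hneg t h ht.2
      exact ⟨Or.inr (by simpa using this.ne), Or.inr (by simpa using this.ne)⟩
  -- Near `t₀` the quotient `h` may cross the negative axis, but `ε - u` and `ε + u` do not: `u`
  -- leaves the real axis except at `t₀`, where it vanishes. The term `πi` accounts for the sign in
  -- `h = -(ε - u) / (ε + u)`.
  have s2 := im_log_increment (a := t₀ - δ) (b := t₀ + δ) (by linarith) (hφ.mono hsub)
    (ψ := fun t => Complex.log (ε - u t) - Complex.log (ε + u t) + Real.pi * Complex.I)
    ((((continuousOn_const.sub (huc.mono hsub)).clog fun t ht => (hslit t ht).1).sub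
      ((continuousOn_const.add (huc.mono hsub)).clog fun t ht => (hslit t ht).2)).add
      continuousOn_const) fun t ht => by
        rw [hφe t (hsub ht), Complex.exp_add, Complex.exp_sub,
          Complex.exp_log (Complex.slitPlane_ne_zero (hslit t ht).1),
          Complex.exp_log (Complex.slitPlane_ne_zero (hslit t ht).2), Complex.exp_pi_mul_I, h2]
        ring
  simp only [Complex.add_im, Complex.sub_im, Complex.log_im] at s2
  have hu2 := hneg (t₀ + δ) (by linarith) le_rfl
  have hu1 := hpos (t₀ - δ) le_rfl (by linarith)
  have a2 := arg_sub_arg_of_im_pos_of_im_neg (z := ε - u (t₀ + δ)) (w := ε + u (t₀ + δ))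
    (by simpa [hu] using hu2) (by simpa [hu] using hu2)
  have a1 := arg_sub_arg_of_im_neg_of_im_pos (z := ε - u (t₀ - δ)) (w := ε + u (t₀ - δ))
    (by simpa [hu] using hu1) (by simpa [hu] using hu1)
  rw [← h2] at a1 a2
  have h10 : h 1 = h 0 := by simp [hh, h01]
  rw [h10] at s3
  -- The values of `arg h` at `t₀ ± δ` and at the endpoints cancel, leaving `π - (-π)`.
  have htot : (φ 1).im - (φ 0).im = 2 * Real.pi := by linarith
  have himn : (φ 1).im - (φ 0).im = 2 * Real.pi * ((m - n : ℤ) : ℝ) := by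
    have := congrArg Complex.im hφ1
    simpa using this
  have : ((m - n : ℤ) : ℝ) = 1 := by
    have h3 := Real.pi_pos
    rw [htot] at himn
    have h4 : 2 * Real.pi * (((m - n : ℤ) : ℝ) - 1) = 0 := by linarith
    rcases mul_eq_zero.1 h4 with h5 | h5
    · linarith
    · linarith
  have : m - n = 1 := by exact_mod_cast this
  omega

/-- Difference quotients of `ζ` are close to `a`, `b ε` is close to `B`, and `a / B` has negative
imaginary part. The direction depends on `ε` because the test point comes from a nonlinear chart;
`δ` has to be chosen before `ε`. -/
theorem eventually_slope_im_neg {t₀ : ℝ} {a : ℂ} (ha : HasDerivAt ζ a t₀) {b : ℝ → ℂ} {B : ℂ}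
    (hb : Tendsto b (𝓝[>] 0) (𝓝 B)) (hor : 0 < ((starRingEnd ℂ) a * B).im) :
    ∃ δ > 0, ∀ᶠ ε in 𝓝[>] (0 : ℝ), b ε ≠ 0 ∧
      (∀ t, t₀ < t → t ≤ t₀ + δ → ((ζ t - ζ t₀) / b ε).im < 0) ∧
      (∀ t, t₀ - δ ≤ t → t < t₀ → 0 < ((ζ t - ζ t₀) / b ε).im) := by
  have hB : B ≠ 0 := by rintro rfl; simp at hor
  have hneg : (a / B).im < 0 := by
    have hn : 0 < Complex.normSq B := Complex.normSq_pos.2 hB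
    rw [Complex.div_im, ← sub_div]
    refine div_neg_of_neg_of_pos ?_ hn
    simp at hor
    nlinarith
  have hcont : ContinuousAt (fun w : ℂ × ℂ => (w.1 / w.2).im) (a, B) :=
    Complex.continuous_im.continuousAt.comp (continuousAt_fst.div continuousAt_snd hB)
  have hev := hcont.eventually (gt_mem_nhds hneg)
  rw [nhds_prod_eq] at hev
  obtain ⟨pa, hpa, pb, hpb, hab⟩ := Filter.eventually_prod_iff.1 hev
  have hslope := (hasDerivAt_iff_tendsto_slope.1 ha).eventually hpa
  rw [eventually_nhdsWithin_iff, Metric.eventually_nhds_iff] at hslope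
  obtain ⟨r, hr, hsl⟩ := hslope
  refine ⟨r / 2, by positivity, ?_⟩
  filter_upwards [hb.eventually hpb, hb.eventually_ne hB] with ε h1 h2
  have key : ∀ t, t ≠ t₀ → |t - t₀| ≤ r / 2 →
      ∃ s < 0, ((ζ t - ζ t₀) / b ε).im = (t - t₀) * s := by
    intro t ht ht'
    have := hab (hsl (y := t) (by rw [Real.dist_eq]; linarith) ht) h1
    refine ⟨_, this, ?_⟩
    have h3 : (t - t₀ : ℝ) ≠ 0 := sub_ne_zero.2 ht
    have : (ζ t - ζ t₀) / b ε = ((t - t₀ : ℝ) : ℂ) * (slope ζ t₀ t / b ε) := by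
      rw [slope_def_module, Complex.real_smul, Complex.ofReal_inv, ← mul_div_assoc,
        mul_inv_cancel_left₀ (by exact_mod_cast h3)]
    rw [this, Complex.im_ofReal_mul]
  refine ⟨h2, fun t h3 h4 => ?_, fun t h3 h4 => ?_⟩
  · obtain ⟨s, hs, he⟩ := key t h3.ne' (by rw [abs_of_pos] <;> linarith)
    rw [he]; exact mul_neg_of_pos_of_neg (by linarith) hs
  · obtain ⟨s, hs, he⟩ := key t h4.ne (by rw [abs_of_neg] <;> linarith)
    rw [he]; exact mul_pos_of_neg_of_neg (by linarith) hs

theorem exists_norm_lower_bound {X : Type*} [NormedAddCommGroup X] {c : ℝ → X}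
    (hc : ContinuousOn c (Icc 0 1))
    (h01 : c 0 = c 1) (hi : InjOn c (Ico 0 1)) {t₀ : ℝ} (ht₀ : t₀ ∈ Ioo (0 : ℝ) 1) {δ : ℝ}
    (hδ : 0 < δ) :
    ∃ η > 0, ∀ t ∈ Icc (0 : ℝ) 1, t ≤ t₀ - δ ∨ t₀ + δ ≤ t → η < ‖c t - c t₀‖ := by
  have hT : IsCompact (Icc (0 : ℝ) 1 ∩ (Iic (t₀ - δ) ∪ Ici (t₀ + δ))) :=
    isCompact_Icc.inter_right (isClosed_Iic.union isClosed_Ici)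
  have hf : ContinuousOn (fun t => ‖c t - c t₀‖) (Icc (0 : ℝ) 1 ∩ (Iic (t₀ - δ) ∪ Ici (t₀ + δ))) :=
    ((hc.mono inter_subset_left).sub continuousOn_const).norm
  have hpos : ∀ t ∈ Icc (0 : ℝ) 1 ∩ (Iic (t₀ - δ) ∪ Ici (t₀ + δ)), 0 < ‖c t - c t₀‖ := by
    rintro t ⟨ht, ht'⟩
    rw [norm_pos_iff, sub_ne_zero]
    intro heq
    have hne : t ≠ t₀ := by
      rintro rfl
      rcases ht' with h | h <;> simp at h <;> linarith
    rcases ht.2.lt_or_eq with h | rfl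
    · exact hne (hi ⟨ht.1, h⟩ ⟨ht₀.1.le, ht₀.2⟩ heq)
    · rw [← h01] at heq
      exact ht₀.1.ne (hi (by simp) ⟨ht₀.1.le, ht₀.2⟩ heq)
  obtain ⟨η, hη, hb⟩ := hT.exists_forall_le' hf hpos
  exact ⟨η / 2, by positivity, fun t ht ht' => (half_lt_self hη).trans_le (hb t ⟨ht, ht'⟩)⟩

/-- For a simple closed curve, if it winds a positive number of times around `p`, then it winds
exactly once, and the points immediately to its left belong to the component of `p`. -/
theorem index_eq_one_and_left_mem (hc : ContinuousOn ζ (Icc 0 1)) (h01 : ζ 0 = ζ 1)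
    (hi : InjOn ζ (Ico 0 1)) {p : ℂ} {k : ℤ} (hp : HasIndex (fun t => ζ t - p) k) (hk : 0 < k)
    {t₀ : ℝ} (ht₀ : t₀ ∈ Ioo (0 : ℝ) 1) {a : ℂ} (ha : HasDerivAt ζ a t₀) {b : ℝ → ℂ} {B : ℂ}
    (hb : Tendsto b (𝓝[>] 0) (𝓝 B)) (hor : 0 < ((starRingEnd ℂ) a * B).im) :
    k = 1 ∧ ∀ᶠ ε : ℝ in 𝓝[>] 0,
      ζ t₀ + ε * b ε ∈ connectedComponentIn (ζ '' Icc 0 1)ᶜ p := by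
  obtain ⟨δ', hδ', hev⟩ := eventually_slope_im_neg ha hb hor
  obtain ⟨δ, hδ, hδδ', hδ0, hδ1⟩ : ∃ δ > 0, δ ≤ δ' ∧ 0 < t₀ - δ ∧ t₀ + δ < 1 := by
    have h1 := ht₀.1
    have h2 := ht₀.2
    refine ⟨min δ' (min (t₀ / 2) ((1 - t₀) / 2)), by positivity, min_le_left _ _, ?_, ?_⟩
    · have : min δ' (min (t₀ / 2) ((1 - t₀) / 2)) ≤ t₀ / 2 :=
        (min_le_right _ _).trans (min_le_left _ _)
      linarith
    · have : min δ' (min (t₀ / 2) ((1 - t₀) / 2)) ≤ (1 - t₀) / 2 :=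
        (min_le_right _ _).trans (min_le_right _ _)
      linarith
  obtain ⟨η, hη, hfar⟩ := exists_norm_lower_bound hc h01 hi ht₀ hδ
  have hsmall : ∀ᶠ ε : ℝ in 𝓝[>] 0, ‖(ε : ℂ) * b ε‖ < η := by
    have h0 : Tendsto (fun ε : ℝ => (ε : ℂ) * b ε) (𝓝[>] 0) (𝓝 ((0 : ℝ) * B)) :=
      ((Complex.continuous_ofReal.tendsto 0).mono_left nhdsWithin_le_nhds).mul hb
    rw [Complex.ofReal_zero, zero_mul] at h0
    exact h0.norm.eventually (gt_mem_nhds (by simpa using hη))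
  have main : ∀ᶠ ε : ℝ in 𝓝[>] 0, k = 1 ∧
      ζ t₀ + ε * b ε ∈ connectedComponentIn (ζ '' Icc 0 1)ᶜ p := by
    filter_upwards [hev, hsmall, self_mem_nhdsWithin] with ε ⟨hb0, hneg, hpos⟩ hsm hε
    have hε : 0 < ε := hε
    have hneg' : ∀ t, t₀ < t → t ≤ t₀ + δ → ((ζ t - ζ t₀) / b ε).im < 0 :=
      fun t h1 h2 => hneg t h1 (h2.trans (by linarith))
    have hpos' : ∀ t, t₀ - δ ≤ t → t < t₀ → 0 < ((ζ t - ζ t₀) / b ε).im :=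
      fun t h1 h2 => hpos t (by linarith) h2
    have hne : ∀ t ∈ Icc (0 : ℝ) 1, ∀ r : ℝ, |r| = ε → ζ t - ζ t₀ ≠ r * b ε := by
      intro t ht r hr heq
      have hquot : ((ζ t - ζ t₀) / b ε).im = 0 := by
        rw [heq, mul_div_cancel_right₀ _ hb0, Complex.ofReal_im]
      by_cases hfar' : t ≤ t₀ - δ ∨ t₀ + δ ≤ t
      · have h1 := hfar t ht hfar'
        rw [heq, norm_mul, Complex.norm_real, Real.norm_eq_abs, hr] at h1
        rw [norm_mul, Complex.norm_real, Real.norm_eq_abs, abs_of_pos hε] at hsm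
        exact lt_asymm h1 hsm
      · rw [not_or, not_le, not_le] at hfar'
        rcases lt_trichotomy t t₀ with h | h | h
        · exact (hpos' t hfar'.1.le h).ne' hquot
        · rw [h, sub_self] at heq
          have : (r : ℂ) ≠ 0 := by
            rw [Complex.ofReal_ne_zero]
            rintro rfl
            rw [abs_zero] at hr
            exact hε.ne hr
          exact mul_ne_zero this hb0 heq.symm
        · exact (hneg' t h hfar'.2.le).ne hquot
    have hL : ζ t₀ + ε * b ε ∉ ζ '' Icc 0 1 := by
      rintro ⟨t, ht, h⟩
      exact hne t ht ε (abs_of_pos hε) (by rw [h]; ring)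
    have hR : ζ t₀ - ε * b ε ∉ ζ '' Icc 0 1 := by
      rintro ⟨t, ht, h⟩
      exact hne t ht (-ε) (by rw [abs_neg, abs_of_pos hε]) (by rw [h]; push_cast; ring)
    obtain ⟨m, hm⟩ := exists_index hc h01 hL
    obtain ⟨n, hn⟩ := exists_index hc h01 hR
    have hmn : m = n + 1 := index_eq_add_one hc h01 hδ hδ0 hδ1 hε hb0 rfl hneg' hpos'
      (fun t ht ht' => hsm.trans (hfar t ht ht')) hm hn
    have hmem : ∀ {q : ℂ} {l : ℤ}, HasIndex (fun t => ζ t - q) l → l ≠ 0 →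
        q ∈ connectedComponentIn (ζ '' Icc 0 1)ᶜ p ∧ k = l := by
      intro q l hq hl
      have h1 := mem_connectedComponentIn_of_index_ne_zero hc h01 hi hp hk.ne' hq hl
      have hpΓ : p ∈ (ζ '' Icc 0 1)ᶜ := by
        rintro ⟨t, ht, rfl⟩
        exact hp.ne_zero ht (sub_self _)
      exact ⟨h1, index_eq_of_isPreconnected hc h01 isPreconnected_connectedComponentIn
        (connectedComponentIn_subset _ _) (mem_connectedComponentIn hpΓ) h1 hp hq⟩
    -- If the right-hand point had nonzero index, its index would be `k > 0`; then `m = n + 1` would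
    -- also be nonzero, hence equal to `k` as well.
    have hn0 : n = 0 := by
      by_contra hn0
      have h1 := (hmem hn hn0).2
      have h2 := (hmem hm (by omega)).2
      omega
    have hm1 := hmem hm (by omega)
    exact ⟨by omega, hm1.1⟩
  exact ⟨main.exists.choose_spec.1, main.mono fun _ h => h.2⟩

end Jump

/-! ### Cauchy transform of a disc -/

section DiscPotential

/-- Mean value property at the centre: the pole lies outside the circle. -/
theorem circleAverage_sub_inv_of_norm_lt {ζ : ℂ} {r : ℝ} (hr : 0 < r) (h : r < ‖ζ‖) :
    Real.circleAverage (fun z => (ζ - z)⁻¹) 0 r = ζ⁻¹ := by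
  have hne : ∀ z ∈ Metric.closedBall (0 : ℂ) |r|, ζ - z ≠ 0 := by
    intro z hz h0
    rw [mem_closedBall_zero_iff, abs_of_pos hr, ← sub_eq_zero.1 h0] at hz
    exact hz.not_gt h
  have := circleAverage_of_differentiable_on_off_countable (f := fun z => (ζ - z)⁻¹) (c := 0)
    (R := r) countable_empty ((continuousOn_const.sub continuousOn_id).inv₀ hne) fun z hz =>
      ((differentiableAt_const _).sub differentiableAt_id).inv
        (hne z (Metric.ball_subset_closedBall hz.1))
  simpa using this

/-- By partial fractions, `1 / (z (ζ - z)) = ζ⁻¹ (1 / z - 1 / (z - ζ))`, and the two residues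
cancel; for `ζ = 0` the integrand is a multiple of `z⁻²`. -/
theorem circleAverage_sub_inv_of_lt_norm {ζ : ℂ} {r : ℝ} (h : ‖ζ‖ < r) :
    Real.circleAverage (fun z => (ζ - z)⁻¹) 0 r = 0 := by
  have hr : 0 < r := (norm_nonneg _).trans_lt h
  rw [Real.circleAverage_eq_circleIntegral hr.ne']
  rcases eq_or_ne ζ 0 with rfl | hζ
  · have h1 : ∮ z in C(0, r), (z - 0)⁻¹ • (0 - z)⁻¹ =
        ∮ z in C(0, r), (-1 : ℂ) • (z - 0) ^ (-2 : ℤ) := by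
      refine circleIntegral.integral_congr hr.le fun z _ => ?_
      simp only [smul_eq_mul, zero_sub, sub_zero, zpow_neg]
      rw [show (2 : ℤ) = ((2 : ℕ) : ℤ) by rfl, zpow_natCast, pow_two, mul_inv, inv_neg]
      ring
    rw [h1, circleIntegral.integral_smul, circleIntegral.integral_sub_zpow_of_ne (by norm_num)]
    simp
  · have hmem : ζ ∈ Metric.ball (0 : ℂ) r := by simpa using h
    have h0mem : (0 : ℂ) ∈ Metric.ball (0 : ℂ) r := by simpa using hr
    have hci : ∀ w ∈ Metric.ball (0 : ℂ) r, CircleIntegrable (fun z => (z - w)⁻¹) 0 r := by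
      intro w hw
      refine ContinuousOn.circleIntegrable hr.le ((continuousOn_id.sub continuousOn_const).inv₀ ?_)
      intro z hz h0
      rw [mem_sphere_zero_iff_norm] at hz
      have h0' : z = w := sub_eq_zero.1 h0
      rw [mem_ball_zero_iff, ← h0'] at hw
      exact hw.ne hz
    have h1 : ∮ z in C(0, r), (z - 0)⁻¹ • (ζ - z)⁻¹ =
        ∮ z in C(0, r), ζ⁻¹ • ((z - 0)⁻¹ - (z - ζ)⁻¹) := by
      refine circleIntegral.integral_congr hr.le fun z hz => ?_
      rw [mem_sphere_zero_iff_norm] at hz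
      have hz0 : z ≠ 0 := by
        rintro rfl
        rw [norm_zero] at hz
        exact hr.ne hz
      have hzζ : z - ζ ≠ 0 := by
        intro h0
        rw [← sub_eq_zero.1 h0] at h
        exact h.ne hz
      have hzζ' : ζ - z ≠ 0 := by rwa [← neg_sub, neg_ne_zero]
      simp only [smul_eq_mul, sub_zero]
      field_simp
      ring
    rw [h1, circleIntegral.integral_smul, circleIntegral.integral_sub (hci 0 h0mem) (hci ζ hmem),
      circleIntegral.integral_sub_inv_of_mem_ball hmem,
      circleIntegral.integral_sub_inv_of_mem_ball h0mem]
    simp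

theorem polarCoord_symm_eq_circleMap (p : ℝ × ℝ) :
    Complex.polarCoord.symm p = circleMap 0 p.1 p.2 := by
  rw [Complex.polarCoord_symm_apply, circleMap_zero, Complex.exp_mul_I]
  push_cast
  rfl

theorem integral_angle_eq_circleAverage (f : ℂ → ℂ) (r : ℝ) :
    ∫ θ in Ioo (-Real.pi) Real.pi, f (circleMap 0 r θ) =
      2 * Real.pi * Real.circleAverage f 0 r := by
  rw [Real.circleAverage_eq_integral_add (-Real.pi), ← integral_Ioc_eq_integral_Ioo,
    ← intervalIntegral.integral_of_le (by linarith [Real.pi_pos]),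
    intervalIntegral.integral_comp_add_right (fun θ => f (circleMap 0 r θ))]
  rw [show (0 : ℝ) + -Real.pi = -Real.pi by ring, show 2 * Real.pi + -Real.pi = Real.pi by ring]
  rw [Complex.real_smul]
  push_cast
  have : (Real.pi : ℂ) ≠ 0 := by exact_mod_cast Real.pi_ne_zero
  field_simp

/-- In polar coordinates the Jacobian `r` cancels the singularity `1 / r`. -/
theorem lintegral_ball_enorm_inv_lt_top (ρ : ℝ) :
    ∫⁻ z in Metric.ball (0 : ℂ) ρ, ‖z⁻¹‖ₑ < ⊤ := by
  rw [← lintegral_indicator measurableSet_ball, ← Complex.lintegral_comp_polarCoord_symm]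
  have hle : ∀ p ∈ polarCoord.target, ENNReal.ofReal p.1 •
      (Metric.ball (0 : ℂ) ρ).indicator (fun z => ‖z⁻¹‖ₑ) (Complex.polarCoord.symm p) ≤
      (Ioo 0 ρ ×ˢ Ioo (-Real.pi) Real.pi).indicator 1 p := by
    rintro ⟨r, θ⟩ hp
    have hr : 0 < r := hp.1
    have hn : ‖Complex.polarCoord.symm (r, θ)‖ = r := by
      rw [Complex.norm_polarCoord_symm, abs_of_pos hr]
    by_cases h : r < ρ
    · rw [indicator_of_mem (by rwa [mem_ball_zero_iff, hn]),
        indicator_of_mem (show (r, θ) ∈ Ioo 0 ρ ×ˢ Ioo (-Real.pi) Real.pi from ⟨⟨hr, h⟩, hp.2⟩)]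
      rw [← ofReal_norm, norm_inv, hn, smul_eq_mul, ← ENNReal.ofReal_mul hr.le,
        mul_inv_cancel₀ hr.ne', ENNReal.ofReal_one]
      exact le_rfl
    · rw [indicator_of_notMem (by rwa [mem_ball_zero_iff, hn])]
      simp
  calc _ ≤ ∫⁻ p in polarCoord.target, (Ioo 0 ρ ×ˢ Ioo (-Real.pi) Real.pi).indicator 1 p :=
        setLIntegral_mono' polarCoord.open_target.measurableSet hle
    _ ≤ ∫⁻ p, (Ioo 0 ρ ×ˢ Ioo (-Real.pi) Real.pi).indicator 1 p := setLIntegral_le_lintegral _ _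
    _ = volume (Ioo 0 ρ ×ˢ Ioo (-Real.pi) Real.pi) :=
        lintegral_indicator_one (measurableSet_Ioo.prod measurableSet_Ioo)
    _ < ⊤ := by
        rw [Measure.volume_eq_prod, Measure.prod_prod, Real.volume_Ioo, Real.volume_Ioo]
        exact ENNReal.mul_lt_top ENNReal.ofReal_lt_top ENNReal.ofReal_lt_top

/-- Seen from `ζ`, the disc lies in a disc of radius `2R`. The bound is uniform in `ζ`, which is
what the exchange of integrals along a curve requires. -/
theorem lintegral_ball_enorm_sub_inv_le {ζ : ℂ} {R : ℝ} (h : ‖ζ‖ < R) :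
    ∫⁻ z in Metric.ball (0 : ℂ) R, ‖(ζ - z)⁻¹‖ₑ ≤
      ∫⁻ z in Metric.ball (0 : ℂ) (2 * R), ‖z⁻¹‖ₑ := by
  rw [← lintegral_indicator measurableSet_ball, ← lintegral_indicator measurableSet_ball,
    ← lintegral_sub_left_eq_self _ ζ]
  refine lintegral_mono fun z => ?_
  by_cases hz : ζ - z ∈ Metric.ball (0 : ℂ) R
  · have : z ∈ Metric.ball (0 : ℂ) (2 * R) := by
      rw [mem_ball_zero_iff] at hz ⊢
      have := norm_sub_le ζ (ζ - z)
      rw [sub_sub_cancel] at this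
      linarith
    rw [indicator_of_mem hz, indicator_of_mem this, sub_sub_cancel]
  · rw [indicator_of_notMem hz]
    exact zero_le

theorem integrableOn_ball_sub_inv {ζ : ℂ} {R : ℝ} (h : ‖ζ‖ < R) :
    IntegrableOn (fun z => (ζ - z)⁻¹) (Metric.ball (0 : ℂ) R) :=
  ⟨by fun_prop, (lintegral_ball_enorm_sub_inv_le h).trans_lt (lintegral_ball_enorm_inv_lt_top _)⟩

/-- The Cauchy transform of a disc. -/
theorem integral_ball_sub_inv {ζ : ℂ} {R : ℝ} (h : ‖ζ‖ < R) :
    ∫ z in Metric.ball (0 : ℂ) R, (ζ - z)⁻¹ = Real.pi * (starRingEnd ℂ) ζ := by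
  have hR : 0 < R := (norm_nonneg _).trans_lt h
  set f : ℂ → ℂ := (Metric.ball (0 : ℂ) R).indicator fun z => (ζ - z)⁻¹ with hf
  have hfm : Measurable f := (by fun_prop : Measurable fun z => (ζ - z)⁻¹).indicator
    measurableSet_ball
  have htarget : polarCoord.target = Ioi (0 : ℝ) ×ˢ Ioo (-Real.pi) Real.pi := rfl
  have hsymm : Measurable fun p : ℝ × ℝ => Complex.polarCoord.symm p := by
    simp only [Complex.polarCoord_symm_apply]
    fun_prop
  have hint : IntegrableOn (fun p : ℝ × ℝ => p.1 • f (Complex.polarCoord.symm p))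
      (Ioi (0 : ℝ) ×ˢ Ioo (-Real.pi) Real.pi) (volume.prod volume) := by
    refine ⟨(measurable_fst.smul (hfm.comp hsymm)).aestronglyMeasurable, ?_⟩
    have h1 : ∫⁻ p in polarCoord.target, ‖p.1 • f (Complex.polarCoord.symm p)‖ₑ =
        ∫⁻ z, ‖f z‖ₑ := by
      rw [← Complex.lintegral_comp_polarCoord_symm]
      refine setLIntegral_congr_fun polarCoord.open_target.measurableSet fun p hp => ?_
      rw [enorm_smul, Real.enorm_of_nonneg (le_of_lt hp.1), smul_eq_mul]
    rw [HasFiniteIntegral, ← htarget, ← Measure.volume_eq_prod, h1]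
    have := ((integrableOn_ball_sub_inv h).integrable_indicator measurableSet_ball).2
    exact this
  rw [← integral_indicator measurableSet_ball, ← hf, ← Complex.integral_comp_polarCoord_symm,
    htarget, Measure.volume_eq_prod, setIntegral_prod _ hint]
  have hinner : ∀ r ∈ Ioi (0 : ℝ), r ≠ ‖ζ‖ →
      ∫ θ in Ioo (-Real.pi) Real.pi, r • f (Complex.polarCoord.symm (r, θ)) =
      (Ioo 0 ‖ζ‖).indicator (fun r : ℝ => (2 * Real.pi * r * ζ⁻¹ : ℂ)) r := by
    intro r hr hrζ
    have hr : 0 < r := hr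
    rw [integral_smul]
    simp only [polarCoord_symm_eq_circleMap]
    have hn : ∀ θ, ‖circleMap 0 r θ‖ = r := fun θ => by
      rw [norm_circleMap_zero, abs_of_pos hr]
    by_cases hrR : r < R
    · have h2 : ∀ θ, f (circleMap 0 r θ) = (ζ - circleMap 0 r θ)⁻¹ := fun θ =>
        indicator_of_mem (by rwa [mem_ball_zero_iff, hn]) _
      simp only [h2]
      rw [integral_angle_eq_circleAverage (fun z => (ζ - z)⁻¹)]
      rcases lt_or_gt_of_ne hrζ with h3 | h3
      · rw [circleAverage_sub_inv_of_norm_lt hr h3, indicator_of_mem (mem_Ioo.2 ⟨hr, h3⟩),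
          Complex.real_smul]
        ring
      · rw [circleAverage_sub_inv_of_lt_norm h3,
          indicator_of_notMem fun h4 => lt_asymm h3 h4.2]
        simp
    · have h2 : ∀ θ, f (circleMap 0 r θ) = 0 := fun θ =>
        indicator_of_notMem (by rwa [mem_ball_zero_iff, hn]) _
      simp only [h2]
      rw [indicator_of_notMem fun h4 => hrR (h4.2.trans h)]
      simp
  -- The circle through the pole `ζ` is discarded as a null set of radii.
  have hae : ∀ᵐ r : ℝ, r ≠ ‖ζ‖ := by simp [ae_iff]
  rw [setIntegral_congr_ae (g := (Ioo 0 ‖ζ‖).indicator fun r : ℝ => (2 * Real.pi * r * ζ⁻¹ : ℂ))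
    measurableSet_Ioi (hae.mono fun r h1 h2 => hinner r h2 h1),
    setIntegral_indicator measurableSet_Ioo, inter_eq_right.2 Ioo_subset_Ioi_self,
    ← integral_Ioc_eq_integral_Ioo, ← intervalIntegral.integral_of_le (norm_nonneg _)]
  have h5 : ∀ r : ℝ, (2 * Real.pi * r * ζ⁻¹ : ℂ) = (2 * Real.pi * ζ⁻¹) * r := fun r => by ring
  simp only [h5]
  rw [intervalIntegral.integral_const_mul, intervalIntegral.integral_ofReal, integral_id]
  rcases eq_or_ne ζ 0 with rfl | hζ
  · simp
  · have h6 : ((‖ζ‖ ^ 2 : ℝ) : ℂ) = ζ * (starRingEnd ℂ) ζ := by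
      rw [Complex.mul_conj, Complex.normSq_eq_norm_sq]
    push_cast at h6 ⊢
    field_simp
    rw [zero_pow two_ne_zero, sub_zero, h6]

end DiscPotential

/-! ### Piecewise differentiable curves and the signed area formula -/

/-- A continuous curve on `[0, 1]` that, apart from finitely many parameters, is differentiable
with bounded derivative. -/
structure IsPC1 {E : Type*} [NormedAddCommGroup E] [NormedSpace ℝ E] (c : ℝ → E) : Prop where
  continuousOn : ContinuousOn c (Icc 0 1)
  exists_finite : ∃ F : Set ℝ, F.Finite ∧ ∃ M : ℝ, ∀ t ∈ Ioo (0 : ℝ) 1 \ F,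
    DifferentiableAt ℝ c t ∧ ‖deriv c t‖ ≤ M

namespace IsPC1

section

variable {E : Type*} [NormedAddCommGroup E] [NormedSpace ℝ E] {c : ℝ → E}

theorem exists_ae_bound (hc : IsPC1 c) :
    ∃ M : ℝ, ∀ᵐ t ∂volume.restrict (Ioc (0 : ℝ) 1), DifferentiableAt ℝ c t ∧ ‖deriv c t‖ ≤ M := by
  obtain ⟨F, hF, M, hM⟩ := hc.exists_finite
  refine ⟨M, ?_⟩
  have h1 : ∀ᵐ t : ℝ, t ∉ F ∪ {1} :=
    measure_eq_zero_iff_ae_notMem.1 ((hF.union (finite_singleton _)).measure_zero volume)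
  rw [ae_restrict_iff' measurableSet_Ioc]
  filter_upwards [h1] with t ht ht'
  rw [mem_union, not_or, mem_singleton_iff] at ht
  exact hM t ⟨⟨ht'.1, ht'.2.lt_of_ne ht.2⟩, ht.1⟩

theorem integrableOn_deriv [CompleteSpace E] [SecondCountableTopology E] (hc : IsPC1 c) :
    IntegrableOn (deriv c) (Ioc 0 1) := by
  obtain ⟨M, hM⟩ := hc.exists_ae_bound
  refine Measure.integrableOn_of_bounded (M := M) (by simp) ?_ (hM.mono fun t h => h.2)
  borelize E
  exact (stronglyMeasurable_deriv c).aestronglyMeasurable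

end

section Complex

variable {γ : ℝ → ℂ}

/-- Regarded as a function on the plane through the real part, `γ` has differential of rank at most
one, so the image of the good parameters is null by Sard's theorem; the other parameters are
finitely many. -/
theorem volume_image_eq_zero (hγ : IsPC1 γ) : volume (γ '' Icc 0 1) = 0 := by
  obtain ⟨F, hF, M, hM⟩ := hγ.exists_finite
  have hsub : γ '' Icc 0 1 ⊆ (fun z : ℂ => γ z.re) '' {z | z.re ∈ Ioo (0 : ℝ) 1 \ F} ∪
      γ '' (F ∪ {0, 1}) := by
    rintro _ ⟨t, ht, rfl⟩
    by_cases h : t ∈ F ∪ {0, 1}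
    · exact Or.inr ⟨t, h, rfl⟩
    · left
      simp only [mem_union, mem_insert_iff, mem_singleton_iff, not_or] at h
      exact ⟨t, ⟨⟨ht.1.lt_of_ne' h.2.1, ht.2.lt_of_ne h.2.2⟩, h.1⟩, rfl⟩
  refine measure_mono_null hsub (measure_union_null ?_ ?_)
  · refine addHaar_image_eq_zero_of_det_fderivWithin_eq_zero volume
      (f' := fun z => (ContinuousLinearMap.toSpanSingleton ℝ (deriv γ z.re)).comp Complex.reCLM)
      (fun z hz => ?_) fun z _ => ?_
    · exact ((hM z.re hz).1.hasDerivAt.hasFDerivAt.comp z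
        Complex.reCLM.hasFDerivAt).hasFDerivWithinAt
    · refine LinearMap.det_eq_zero_iff_ker_ne_bot.2 fun h => ?_
      have : Complex.I ∈ (⊥ : Submodule ℝ ℂ) := by
        rw [← h, LinearMap.mem_ker]
        simp
      exact Complex.I_ne_zero ((Submodule.mem_bot ℝ).1 this)
  · exact ((hF.union (by simp)).image γ).measure_zero _

/-- The index is the integral of the logarithmic derivative. -/
theorem integral_deriv_div_eq (hγ : IsPC1 γ) {z : ℂ} {n : ℤ}
    (hn : HasIndex (fun t => γ t - z) n) :
    ∫ t in (0 : ℝ)..1, deriv γ t * (γ t - z)⁻¹ = 2 * Real.pi * Complex.I * n := by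
  have hne : ∀ t ∈ Icc (0 : ℝ) 1, γ t - z ≠ 0 := fun t ht => hn.ne_zero ht
  obtain ⟨φ, hφ, hφe, hφ1⟩ := hn
  have hφe : ∀ t ∈ Icc (0 : ℝ) 1, Complex.exp (φ t) = γ t - z := hφe
  obtain ⟨F, hF, M, hM⟩ := hγ.exists_finite
  rw [← hφ1]
  refine integral_eq_of_hasDerivAt_off_countable_of_le φ _ zero_le_one hF.countable hφ
    (fun t ht => ?_) ?_
  · have htI : Icc (0 : ℝ) 1 ∈ 𝓝 t := Icc_mem_nhds ht.1.1 ht.1.2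
    have ht' : t ∈ Icc (0 : ℝ) 1 := Ioo_subset_Icc_self ht.1
    have hφt : ContinuousAt φ t := hφ.continuousAt htI
    -- Locally `φ` moves by less than `π`, so it is given by the principal logarithm of a quotient;
    -- this makes the continuous `φ` differentiable wherever `γ` is.
    have hloc : ∀ᶠ s in 𝓝 t, φ s = φ t + Complex.log ((γ s - z) / (γ t - z)) := by
      have hc : ContinuousAt (fun s => φ s - φ t) t := hφt.sub continuousAt_const
      have h1 := hc.eventually (Metric.ball_mem_nhds _ Real.pi_pos)
      filter_upwards [h1, htI] with s hs hsI
      have him : |(φ s - φ t).im| < Real.pi := by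
        rw [sub_self, dist_zero_right] at hs
        exact (Complex.abs_im_le_norm _).trans_lt hs
      rw [← hφe s hsI, ← hφe t ht', ← Complex.exp_sub, Complex.log_exp (abs_lt.1 him).1
        (abs_lt.1 him).2.le]
      ring
    have hd : HasDerivAt (fun s => (γ s - z) / (γ t - z)) (deriv γ t / (γ t - z)) t :=
      ((hM t ht).1.hasDerivAt.sub_const z).div_const _
    have hlog : HasDerivAt (fun s => φ t + Complex.log ((γ s - z) / (γ t - z)))
        (deriv γ t / (γ t - z) / ((γ t - z) / (γ t - z))) t :=
      (hd.clog_real (by rw [div_self (hne t ht')]; exact Complex.one_mem_slitPlane)).const_add _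
    rw [div_self (hne t ht'), div_one, div_eq_mul_inv] at hlog
    exact hlog.congr_of_eventuallyEq hloc
  · rw [intervalIntegrable_iff_integrableOn_Icc_of_le zero_le_one]
    exact IntegrableOn.mul_continuousOn
      (by rw [integrableOn_Icc_iff_integrableOn_Ioc]; exact hγ.integrableOn_deriv)
      ((hγ.continuousOn.sub continuousOn_const).inv₀ hne) isCompact_Icc

/-- The signed area enclosed by a closed plane curve is the integral of its index. -/
theorem integral_im_conj_mul_deriv (hγ : IsPC1 γ) {R : ℝ}
    (hR : ∀ t ∈ Icc (0 : ℝ) 1, ‖γ t‖ < R) :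
    ∃ w : ℂ → ℝ, IntegrableOn w (Metric.ball 0 R) ∧
      (∀ z n, HasIndex (fun t => γ t - z) n → w z = n) ∧
      ∫ t in (0 : ℝ)..1, ((starRingEnd ℂ) (γ t) * deriv γ t).im =
        2 * ∫ z in Metric.ball (0 : ℂ) R, w z := by
  set μ : Measure ℝ := volume.restrict (Ioc 0 1) with hμ
  set ν : Measure ℂ := volume.restrict (Metric.ball 0 R) with hν
  set f : ℝ → ℂ → ℂ := fun t z => deriv γ t * (γ t - z)⁻¹ with hf
  have hd : Integrable (deriv γ) μ := hγ.integrableOn_deriv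
  have hγm : AEMeasurable γ μ :=
    (hγ.continuousOn.mono Ioc_subset_Icc_self).aemeasurable measurableSet_Ioc
  have hγI : ∀ᵐ t ∂μ, ‖γ t‖ < R :=
    (ae_restrict_mem measurableSet_Ioc).mono fun t ht => hR t (Ioc_subset_Icc_self ht)
  have hfm : AEStronglyMeasurable (Function.uncurry f) (μ.prod ν) := by
    refine AEMeasurable.aestronglyMeasurable ?_
    exact hd.aemeasurable.comp_fst.mul ((hγm.comp_fst.sub measurable_snd.aemeasurable).inv)
  have hfi : Integrable (Function.uncurry f) (μ.prod ν) := by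
    refine ⟨hfm, ?_⟩
    rw [HasFiniteIntegral, lintegral_prod _ hfm.enorm]
    set C := ∫⁻ z in Metric.ball (0 : ℂ) (2 * R), ‖z⁻¹‖ₑ
    calc ∫⁻ t, ∫⁻ z, ‖f t z‖ₑ ∂ν ∂μ ≤ ∫⁻ t, ‖deriv γ t‖ₑ * C ∂μ := by
          refine lintegral_mono_ae (hγI.mono fun t ht => ?_)
          simp only [hf, enorm_mul]
          rw [lintegral_const_mul' _ _ enorm_ne_top]
          gcongr
          exact lintegral_ball_enorm_sub_inv_le ht
      _ = (∫⁻ t, ‖deriv γ t‖ₑ ∂μ) * C := lintegral_mul_const' _ _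
          (lintegral_ball_enorm_inv_lt_top _).ne
      _ < ⊤ := ENNReal.mul_lt_top hd.2 (lintegral_ball_enorm_inv_lt_top _)
  have hswap := integral_integral_swap hfi
  have hg : Integrable (fun z => ∫ t, f t z ∂μ) ν := hfi.integral_prod_right
  have hleft : ∫ t, ∫ z, f t z ∂ν ∂μ =
      ∫ t, Real.pi * ((starRingEnd ℂ) (γ t) * deriv γ t) ∂μ := by
    refine integral_congr_ae (hγI.mono fun t ht => ?_)
    simp only [hf]
    rw [integral_const_mul, integral_ball_sub_inv ht]
    ring
  have hcd : Integrable (fun t => (starRingEnd ℂ) (γ t) * deriv γ t) μ := by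
    refine Integrable.bdd_mul (c := R) hd ?_ (hγI.mono fun t ht => ?_)
    · exact (Complex.continuous_conj.measurable.comp_aemeasurable hγm).aestronglyMeasurable
    · rw [RCLike.norm_conj]
      exact ht.le
  -- Defining `w` by the inner integral for every `z` supplies integrability from Fubini; only off
  -- the curve is it identified with the index.
  refine ⟨fun z => (∫ t, f t z ∂μ).im / (2 * Real.pi), hg.im.div_const _, fun z n hz => ?_, ?_⟩
  · have := hγ.integral_deriv_div_eq hz
    rw [intervalIntegral.integral_of_le zero_le_one] at this
    simp only [hf, hμ, this]
    have h3 := Real.pi_pos.ne'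
    simp [h3]
  · rw [intervalIntegral.integral_of_le zero_le_one, integral_div]
    have h1 := congrArg Complex.im hswap
    rw [hleft, integral_const_mul, Complex.im_ofReal_mul] at h1
    have h2 : ∫ t, ((starRingEnd ℂ) (γ t) * deriv γ t).im ∂μ =
        (∫ t, (starRingEnd ℂ) (γ t) * deriv γ t ∂μ).im := integral_im hcd
    have h3 : ∫ z, (∫ t, f t z ∂μ).im ∂ν = (∫ z, ∫ t, f t z ∂μ ∂ν).im := integral_im hg
    rw [h2, h3, ← h1]
    have := Real.pi_pos.ne'
    field_simp

end Complex

end IsPC1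

/-! ### Vector products and orthonormal frames -/

section VectorAlgebra

theorem inner_eq_sum (x y : E3) : inner ℝ x y = x 0 * y 0 + x 1 * y 1 + x 2 * y 2 := by
  rw [PiLp.inner_apply, Fin.sum_univ_three]
  simp only [RCLike.inner_apply, conj_trivial]
  ring

theorem cross_zero_apply (x y : E3) : cross x y 0 = x 1 * y 2 - x 2 * y 1 := by
  simp [cross, crossProduct]

theorem cross_one_apply (x y : E3) : cross x y 1 = x 2 * y 0 - x 0 * y 2 := by
  simp [cross, crossProduct]

theorem cross_two_apply (x y : E3) : cross x y 2 = x 0 * y 1 - x 1 * y 0 := by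
  simp [cross, crossProduct]

theorem ext_three {x y : E3} (h0 : x 0 = y 0) (h1 : x 1 = y 1) (h2 : x 2 = y 2) : x = y := by
  ext i
  fin_cases i <;> assumption

/-- The Binet–Cauchy identity. -/
theorem inner_cross_cross (x y z w : E3) :
    inner ℝ (cross x y) (cross z w) = inner ℝ x z * inner ℝ y w - inner ℝ x w * inner ℝ y z := by
  simp only [inner_eq_sum, cross_zero_apply, cross_one_apply, cross_two_apply]
  ring

theorem inner_cross_cyclic (x y z : E3) :
    inner ℝ (cross x y) z = inner ℝ (cross y z) x := by
  simp only [inner_eq_sum, cross_zero_apply, cross_one_apply, cross_two_apply]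
  ring

theorem cross_cross_eq (x y z : E3) :
    cross x (cross y z) = inner ℝ x z • y - inner ℝ x y • z := by
  apply ext_three <;>
  simp [inner_eq_sum, cross_zero_apply, cross_one_apply, cross_two_apply] <;>
  ring

theorem inner_cross_self_left (x y : E3) : inner ℝ (cross x y) x = 0 := by
  simp only [inner_eq_sum, cross_zero_apply, cross_one_apply, cross_two_apply]
  ring

theorem inner_cross_self_right (x y : E3) : inner ℝ (cross x y) y = 0 := by
  simp only [inner_eq_sum, cross_zero_apply, cross_one_apply, cross_two_apply]
  ring

theorem cross_smul_left (r : ℝ) (x y : E3) : cross (r • x) y = r • cross x y := by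
  apply ext_three <;>
  simp [cross_zero_apply, cross_one_apply, cross_two_apply] <;>
  ring

theorem cross_smul_right (r : ℝ) (x y : E3) : cross x (r • y) = r • cross x y := by
  apply ext_three <;>
  simp [cross_zero_apply, cross_one_apply, cross_two_apply] <;>
  ring

theorem cross_swap (x y : E3) : cross x y = -cross y x := by
  apply ext_three <;>
  simp [cross_zero_apply, cross_one_apply, cross_two_apply] <;>
  ring

theorem cross_neg_neg (x y : E3) : cross (-x) (-y) = cross x y := by
  apply ext_three <;>
  simp [cross_zero_apply, cross_one_apply, cross_two_apply]

theorem continuous_cross : Continuous fun p : E3 × E3 => cross p.1 p.2 := by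
  refine (PiLp.continuous_toLp 2 _).comp (continuous_pi fun i => ?_)
  have h : ∀ i : Fin 3, Continuous fun p : E3 × E3 => p.1 i := fun i => by fun_prop
  have h' : ∀ i : Fin 3, Continuous fun p : E3 × E3 => p.2 i := fun i => by fun_prop
  fin_cases i
  all_goals simp only [crossProduct]; dsimp; fun_prop

theorem norm_cross_le (x y : E3) : ‖cross x y‖ ≤ ‖x‖ * ‖y‖ := by
  refine abs_le_of_sq_le_sq' ?_ (by positivity) |>.2
  rw [mul_pow, ← real_inner_self_eq_norm_sq, inner_cross_cross, real_inner_self_eq_norm_sq,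
    real_inner_self_eq_norm_sq, real_inner_comm x y]
  nlinarith [sq_nonneg (inner ℝ x y)]

/-- A positively oriented orthonormal frame. -/
structure IsFrame (e : Fin 3 → E3) : Prop where
  orthonormal : Orthonormal ℝ e
  cross_zero_one : cross (e 0) (e 1) = e 2
  cross_one_two : cross (e 1) (e 2) = e 0
  cross_two_zero : cross (e 2) (e 0) = e 1

theorem exists_isFrame {P : E3} (hP : ‖P‖ = 1) : ∃ e, IsFrame e ∧ e 2 = P := by
  obtain ⟨v, hv0, hv⟩ : ∃ v : E3, v ≠ 0 ∧ inner ℝ P v = 0 := by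
    by_cases h : P 0 = 0 ∧ P 1 = 0
    · refine ⟨EuclideanSpace.single 0 1, fun h0 => ?_, ?_⟩
      · simpa using congrArg (fun x : E3 => x 0) h0
      · simp [inner_eq_sum, h.1]
    · refine ⟨!₂[-P 1, P 0, 0], fun h0 => h ⟨?_, ?_⟩, ?_⟩
      · simpa using congrArg (fun x : E3 => x 1) h0
      · simpa using congrArg (fun x : E3 => x 0) h0
      · simp [inner_eq_sum]
        ring
  set a : E3 := (‖v‖⁻¹ : ℝ) • v with ha
  have ha1 : ‖a‖ = 1 := by
    rw [ha, norm_smul, norm_inv, norm_norm, inv_mul_cancel₀ (norm_ne_zero_iff.2 hv0)]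
  have hPa : inner ℝ P a = 0 := by rw [ha, inner_smul_right, hv, mul_zero]
  have haa : inner ℝ a a = 1 := by rw [real_inner_self_eq_norm_sq, ha1, one_pow]
  have hPP : inner ℝ P P = 1 := by rw [real_inner_self_eq_norm_sq, hP, one_pow]
  have hb : ‖cross P a‖ = 1 := by
    have : ‖cross P a‖ ^ 2 = 1 := by
      rw [← real_inner_self_eq_norm_sq, inner_cross_cross, hPa, haa, hPP]
      ring
    exact (pow_eq_one_iff_of_nonneg (norm_nonneg _) two_ne_zero).1 this
  refine ⟨![a, cross P a, P], ⟨⟨?_, ?_⟩, ?_, ?_, ?_⟩, rfl⟩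
  · intro i
    fin_cases i
    exacts [ha1, hb, hP]
  · have h1 := inner_cross_self_left P a
    have h2 := inner_cross_self_right P a
    have h3 := hPa
    intro i j hij
    fin_cases i <;> fin_cases j <;> first | exact absurd rfl hij | skip
    · exact (real_inner_comm _ _).trans h2
    · exact (real_inner_comm _ _).trans h3
    · exact h2
    · exact h1
    · exact h3
    · exact (real_inner_comm _ _).trans h1
  · change cross a (cross P a) = P
    rw [cross_cross_eq, haa, real_inner_comm, hPa, one_smul, zero_smul, sub_zero]
  · change cross (cross P a) P = a
    rw [cross_swap, cross_cross_eq, hPa, hPP, zero_smul, one_smul, zero_sub, neg_neg]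
  · rfl

end VectorAlgebra

/-! ### Bodies with differentiable gauge -/

/-- A symmetric convex body with the origin in its interior whose gauge is differentiable away
from the origin. -/
structure IsRegularBody (K : Set E3) : Prop where
  isCompact : IsCompact K
  convex : Convex ℝ K
  mem_nhds : K ∈ 𝓝 (0 : E3)
  symm : ∀ x ∈ K, -x ∈ K
  differentiableAt : ∀ x : E3, x ≠ 0 → DifferentiableAt ℝ (gauge K) x

namespace IsRegularBody

variable {K : Set E3}

theorem continuous_gauge (hK : IsRegularBody K) : Continuous (gauge K) :=
  _root_.continuous_gauge hK.convex hK.mem_nhds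

theorem gauge_pos (hK : IsRegularBody K) {x : E3} (hx : x ≠ 0) : 0 < gauge K x :=
  (_root_.gauge_pos (absorbent_nhds_zero hK.mem_nhds)
    (NormedSpace.isVonNBounded_of_isBounded ℝ hK.isCompact.isBounded)).2 hx

theorem gauge_eq_one_iff (hK : IsRegularBody K) {x : E3} : gauge K x = 1 ↔ x ∈ frontier K :=
  gauge_eq_one_iff_mem_frontier hK.convex hK.mem_nhds

theorem gauge_le_one_iff (hK : IsRegularBody K) {x : E3} : gauge K x ≤ 1 ↔ x ∈ K := by
  rw [gauge_le_one_iff_mem_closure hK.convex hK.mem_nhds, hK.isCompact.isClosed.closure_eq]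

theorem gauge_add_le (hK : IsRegularBody K) (x y : E3) : gauge K (x + y) ≤ gauge K x + gauge K y :=
  _root_.gauge_add_le hK.convex (absorbent_nhds_zero hK.mem_nhds) x y

theorem gauge_neg (hK : IsRegularBody K) (x : E3) : gauge K (-x) = gauge K x :=
  _root_.gauge_neg hK.symm x

theorem ne_zero (hK : IsRegularBody K) {x : E3} (hx : x ∈ frontier K) : x ≠ 0 := by
  rintro rfl
  rw [← hK.gauge_eq_one_iff, gauge_zero] at hx
  exact zero_ne_one hx

theorem radialProj_mem (hK : IsRegularBody K) {x : E3} (hx : x ≠ 0) :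
    radialProj K x ∈ frontier K := by
  rw [← hK.gauge_eq_one_iff, radialProj, radial,
    gauge_smul_of_nonneg (inv_nonneg.2 (gauge_nonneg x)), smul_eq_mul,
    inv_mul_cancel₀ (hK.gauge_pos hx).ne']

theorem radialProj_eq_self (hK : IsRegularBody K) {x : E3} (hx : x ∈ frontier K) :
    radialProj K x = x := by
  rw [radialProj, radial, hK.gauge_eq_one_iff.2 hx, inv_one, one_smul]

theorem continuousAt_radialProj (hK : IsRegularBody K) {x : E3} (hx : x ≠ 0) :
    ContinuousAt (radialProj K) x :=
  (hK.continuous_gauge.continuousAt.inv₀ (hK.gauge_pos hx).ne').smul continuousAt_id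

theorem hasDerivAt_gauge_ray (hK : IsRegularBody K) {x : E3} (hx : x ≠ 0) (v : E3) :
    HasDerivAt (fun s : ℝ => gauge K (x + s • v)) (fderiv ℝ (gauge K) x v) 0 := by
  have h1 : HasDerivAt (fun s : ℝ => x + s • v) v 0 := by
    simpa using ((hasDerivAt_id (0 : ℝ)).smul_const v).const_add x
  have h2 : HasFDerivAt (gauge K) (fderiv ℝ (gauge K) x) (x + (0 : ℝ) • v) := by
    simpa using (hK.differentiableAt x hx).hasFDerivAt
  exact h2.comp_hasDerivAt 0 h1

theorem fderiv_gauge_le (hK : IsRegularBody K) {x : E3} (hx : x ≠ 0) (v : E3) :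
    fderiv ℝ (gauge K) x v ≤ gauge K v := by
  refine le_of_tendsto ((hK.hasDerivAt_gauge_ray hx v).tendsto_slope.mono_left
    (nhdsWithin_mono 0 (t := {0}ᶜ) (s := Ioi 0) fun s hs => (ne_of_gt hs : s ≠ 0))) ?_
  filter_upwards [self_mem_nhdsWithin] with s hs
  have hs : 0 < s := hs
  rw [slope_def_field, sub_zero, div_le_iff₀ hs]
  have := hK.gauge_add_le x (s • v)
  rw [gauge_smul_of_nonneg hs.le, smul_eq_mul] at this
  simp only [zero_smul, add_zero]
  linarith

theorem abs_fderiv_gauge_le (hK : IsRegularBody K) {x : E3} (hx : x ≠ 0) (v : E3) :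
    |fderiv ℝ (gauge K) x v| ≤ gauge K v := by
  rw [abs_le']
  refine ⟨hK.fderiv_gauge_le hx v, ?_⟩
  have := hK.fderiv_gauge_le hx (-v)
  rwa [map_neg, hK.gauge_neg] at this

theorem fderiv_gauge_self (hK : IsRegularBody K) {x : E3} (hx : x ≠ 0) :
    fderiv ℝ (gauge K) x x = gauge K x := by
  refine le_antisymm (hK.fderiv_gauge_le hx x) ?_
  have h1 : HasDerivAt (fun s : ℝ => gauge K (x + s • x)) (gauge K x) 0 := by
    have h2 : HasDerivAt (fun s : ℝ => (1 + s) * gauge K x) (gauge K x) 0 := by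
      simpa using ((hasDerivAt_id (0 : ℝ)).const_add 1).mul_const (gauge K x)
    refine h2.congr_of_eventuallyEq ?_
    filter_upwards [Ioi_mem_nhds (show (-1 : ℝ) < 0 by norm_num)] with s hs
    have hs : -1 < s := hs
    rw [← smul_eq_mul, ← gauge_smul_of_nonneg (by linarith : (0 : ℝ) ≤ 1 + s), add_smul, one_smul]
  exact (h1.unique (hK.hasDerivAt_gauge_ray hx x)).le

theorem inner_normalMap (hK : IsRegularBody K) {x : E3} (hx : x ≠ 0) (v : E3) :
    inner ℝ (normalMap K x) v = gauge K x * fderiv ℝ (gauge K) x v := by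
  have h := ((hK.differentiableAt x hx).hasFDerivAt.pow 2).const_mul (1 / 2 : ℝ)
  change HasFDerivAt (halfSqGauge K) _ x at h
  rw [normalMap, gradient, InnerProductSpace.toDual_symm_apply, h.fderiv]
  simp
  ring

theorem inner_normalMap_le (hK : IsRegularBody K) {u : E3} (hu : u ∈ frontier K) (x : E3) :
    inner ℝ (normalMap K u) x ≤ gauge K x := by
  rw [hK.inner_normalMap (hK.ne_zero hu), hK.gauge_eq_one_iff.2 hu, one_mul]
  exact hK.fderiv_gauge_le (hK.ne_zero hu) x

theorem inner_normalMap_self (hK : IsRegularBody K) {u : E3} (hu : u ∈ frontier K) :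
    inner ℝ (normalMap K u) u = 1 := by
  rw [hK.inner_normalMap (hK.ne_zero hu), hK.fderiv_gauge_self (hK.ne_zero hu),
    hK.gauge_eq_one_iff.2 hu, one_mul]

/-- The outward normal is orthogonal to curves on the boundary. -/
theorem inner_normalMap_deriv (hK : IsRegularBody K) {c : ℝ → E3} {t : ℝ} {a : E3}
    (hc : HasDerivAt c a t) (hmem : ∀ᶠ s in 𝓝 t, c s ∈ frontier K) :
    inner ℝ (normalMap K (c t)) a = 0 := by
  have hu := hmem.self_of_nhds
  rw [hK.inner_normalMap (hK.ne_zero hu)]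
  have h1 := (hK.differentiableAt _ (hK.ne_zero hu)).hasFDerivAt.comp_hasDerivAt t hc
  have h2 : HasDerivAt (gauge K ∘ c) 0 t :=
    (hasDerivAt_const t (1 : ℝ)).congr_of_eventuallyEq
      (hmem.mono fun s hs => hK.gauge_eq_one_iff.2 hs)
  rw [h1.unique h2, mul_zero]

/-- The gauge is stationary in tangent directions, so the central projection does not alter the
velocity. Hence the displaced point of `LiesLeft` leaves the curve in the conormal direction itself.
-/
theorem hasDerivAt_radialProj (hK : IsRegularBody K) {u b : E3} (hu : u ∈ frontier K)
    (hb : inner ℝ (normalMap K u) b = 0) :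
    HasDerivAt (fun s : ℝ => radialProj K (u + s • b)) b 0 := by
  have hu0 := hK.ne_zero hu
  have hu1 := hK.gauge_eq_one_iff.2 hu
  rw [hK.inner_normalMap hu0, hu1, one_mul] at hb
  have h1 := hK.hasDerivAt_gauge_ray hu0 b
  rw [hb] at h1
  have h2 : HasDerivAt (fun s : ℝ => u + s • b) b 0 := by
    simpa using ((hasDerivAt_id (0 : ℝ)).smul_const b).const_add u
  have h3 := (h1.fun_inv (by simp [hu1])).fun_smul h2
  change HasDerivAt (fun s : ℝ => radialProj K (u + s • b)) _ 0 at h3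
  have h4 : (gauge K (u + (0 : ℝ) • b))⁻¹ • b + (-0 / gauge K (u + (0 : ℝ) • b) ^ 2) •
      (u + (0 : ℝ) • b) = b := by simp [hu1]
  rwa [h4] at h3

end IsRegularBody

/-! ### Stereographic charts of the boundary seen from an interior point -/

section Chart

variable {e : Fin 3 → E3}

/-- The orthogonal projection along `e 2`, with values in `ℂ`. -/
noncomputable def planeProj (e : Fin 3 → E3) : E3 →L[ℝ] ℂ :=
  (innerSL ℝ (e 0)).smulRight (1 : ℂ) + (innerSL ℝ (e 1)).smulRight Complex.I

theorem planeProj_re (x : E3) : (planeProj e x).re = inner ℝ (e 0) x := by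
  simp [planeProj]

theorem planeProj_im (x : E3) : (planeProj e x).im = inner ℝ (e 1) x := by
  simp [planeProj]

namespace IsFrame

/-- The orthonormal basis of a frame. -/
noncomputable def basis (he : IsFrame e) : OrthonormalBasis (Fin 3) ℝ E3 :=
  OrthonormalBasis.mk he.orthonormal
    (he.orthonormal.linearIndependent.span_eq_top_of_card_eq_finrank' (by simp)).ge

theorem basis_apply (he : IsFrame e) (i : Fin 3) : he.basis i = e i := by simp [basis]

theorem inner_eq (he : IsFrame e) (x y : E3) :
    inner ℝ x y = inner ℝ (e 0) x * inner ℝ (e 0) y + inner ℝ (e 1) x * inner ℝ (e 1) y +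
      inner ℝ (e 2) x * inner ℝ (e 2) y := by
  rw [← he.basis.sum_inner_mul_inner x y, Fin.sum_univ_three]
  simp only [he.basis_apply, real_inner_comm x]

theorem norm_sq_eq (he : IsFrame e) (x : E3) :
    ‖x‖ ^ 2 = inner ℝ (e 0) x ^ 2 + inner ℝ (e 1) x ^ 2 + inner ℝ (e 2) x ^ 2 := by
  rw [← real_inner_self_eq_norm_sq, he.inner_eq]
  ring

theorem eq_sum (he : IsFrame e) (x : E3) :
    inner ℝ (e 0) x • e 0 + inner ℝ (e 1) x • e 1 + inner ℝ (e 2) x • e 2 = x := by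
  conv_rhs => rw [← he.basis.sum_repr' x, Fin.sum_univ_three]
  simp only [he.basis_apply]

theorem inner_self (he : IsFrame e) (i : Fin 3) : inner ℝ (e i) (e i) = 1 := by
  rw [real_inner_self_eq_norm_sq, he.orthonormal.1 i, one_pow]

theorem inner_ne (he : IsFrame e) {i j : Fin 3} (h : i ≠ j) : inner ℝ (e i) (e j) = 0 :=
  he.orthonormal.2 h

theorem inner_two_cross (he : IsFrame e) (x y : E3) : inner ℝ (e 2) (cross x y) =
    inner ℝ (e 0) x * inner ℝ (e 1) y - inner ℝ (e 0) y * inner ℝ (e 1) x := by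
  rw [← he.cross_zero_one, inner_cross_cross]

theorem inner_zero_cross (he : IsFrame e) (x y : E3) : inner ℝ (e 0) (cross x y) =
    inner ℝ (e 1) x * inner ℝ (e 2) y - inner ℝ (e 1) y * inner ℝ (e 2) x := by
  rw [← he.cross_one_two, inner_cross_cross]

theorem inner_one_cross (he : IsFrame e) (x y : E3) : inner ℝ (e 1) (cross x y) =
    inner ℝ (e 2) x * inner ℝ (e 0) y - inner ℝ (e 2) y * inner ℝ (e 0) x := by
  rw [← he.cross_two_zero, inner_cross_cross]

end IsFrame

/-- The denominator of the stereographic chart. -/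
noncomputable def chartDenom (e : Fin 3 → E3) (y : E3) : ℝ := ‖y‖ + inner ℝ (e 2) y

/-- Stereographic projection of the directions seen from `q`, with pole `-e 2`. -/
noncomputable def chart (e : Fin 3 → E3) (q u : E3) : ℂ :=
  (chartDenom e (u - q))⁻¹ • planeProj e (u - q)

/-- The derivative of the chart. -/
noncomputable def chartDeriv (e : Fin 3 → E3) (y v : E3) : ℂ :=
  (chartDenom e y)⁻¹ • planeProj e v -
    ((inner ℝ y v / ‖y‖ + inner ℝ (e 2) v) / chartDenom e y ^ 2) • planeProj e y

/-- The direction with given stereographic coordinate. -/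
noncomputable def chartDir (e : Fin 3 → E3) (ξ : ℂ) : E3 :=
  (2 * ξ.re) • e 0 + (2 * ξ.im) • e 1 + (1 - ξ.re ^ 2 - ξ.im ^ 2) • e 2

/-- The inverse of the stereographic chart of the boundary of `K`. -/
noncomputable def chartInv (K : Set E3) (e : Fin 3 → E3) (q : E3) (ξ : ℂ) : E3 :=
  q + (gauge ((q + ·) ⁻¹' K) (chartDir e ξ))⁻¹ • chartDir e ξ

theorem hasDerivAt_norm {x : ℝ → E3} {v : E3} {t : ℝ} (hx : HasDerivAt x v t) (h0 : x t ≠ 0) :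
    HasDerivAt (fun s => ‖x s‖) (inner ℝ (x t) v / ‖x t‖) t := by
  have h1 := (hx.norm_sq).sqrt (by positivity)
  have h2 : (fun s => √(‖x s‖ ^ 2)) = fun s => ‖x s‖ := by
    ext s
    exact Real.sqrt_sq (norm_nonneg _)
  rw [h2, Real.sqrt_sq (norm_nonneg _), mul_div_mul_left _ _ two_ne_zero] at h1
  exact h1

theorem hasDerivAt_chart {q : E3} {x : ℝ → E3} {v : E3} {t : ℝ} (hx : HasDerivAt x v t)
    (hD : 0 < chartDenom e (x t - q)) :
    HasDerivAt (fun s => chart e q (x s)) (chartDeriv e (x t - q) v) t := by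
  have hy : HasDerivAt (fun s => x s - q) v t := hx.sub_const q
  have h0 : x t - q ≠ 0 := by
    intro h
    rw [h, chartDenom] at hD
    simp at hD
  have hd : HasDerivAt (fun s => chartDenom e (x s - q))
      (inner ℝ (x t - q) v / ‖x t - q‖ + inner ℝ (e 2) v) t :=
    (hasDerivAt_norm hy h0).add (((innerSL ℝ (e 2)).hasFDerivAt).comp_hasDerivAt t hy)
  have hp : HasDerivAt (fun s => planeProj e (x s - q)) (planeProj e v) t :=
    (planeProj e).hasFDerivAt.comp_hasDerivAt t hy
  have := (hd.fun_inv hD.ne').fun_smul hp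
  convert! this using 1
  rw [chartDeriv, neg_div, neg_smul, sub_eq_add_neg]

theorem chartDenom_pos (he : IsFrame e) {y : E3} (hy : planeProj e y ≠ 0) :
    0 < chartDenom e y := by
  have h1 := he.norm_sq_eq y
  have h2 : 0 < inner ℝ (e 0) y ^ 2 + inner ℝ (e 1) y ^ 2 := by
    by_contra hle
    have h3 := sq_nonneg (inner ℝ (e 0) y)
    have h4 := sq_nonneg (inner ℝ (e 1) y)
    refine hy (Complex.ext ?_ ?_)
    · rw [planeProj_re, Complex.zero_re]
      exact pow_eq_zero_iff two_ne_zero |>.1 (by linarith)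
    · rw [planeProj_im, Complex.zero_im]
      exact pow_eq_zero_iff two_ne_zero |>.1 (by linarith)
  have h3 : |inner ℝ (e 2) y| < ‖y‖ := abs_lt_of_sq_lt_sq (by linarith) (norm_nonneg _)
  have := (abs_lt.1 h3).1
  rw [chartDenom]
  linarith

/-- The chart preserves the orientation. -/
theorem im_conj_chartDeriv_mul (he : IsFrame e) {y : E3} (hD : 0 < chartDenom e y) (a b : E3) :
    ((starRingEnd ℂ) (chartDeriv e y a) * chartDeriv e y b).im =
      inner ℝ (cross a b) y / (‖y‖ * chartDenom e y ^ 2) := by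
  have h0 : ‖y‖ ≠ 0 := by
    intro h
    rw [norm_eq_zero.1 h, chartDenom] at hD
    simp at hD
  have hr := he.norm_sq_eq y
  rw [he.inner_eq (cross a b) y, he.inner_zero_cross, he.inner_one_cross, he.inner_two_cross]
  simp only [chartDeriv, Complex.mul_im, Complex.conj_re, Complex.conj_im, Complex.sub_re,
    Complex.sub_im, Complex.smul_re, Complex.smul_im, planeProj_re, planeProj_im, smul_eq_mul]
  rw [he.inner_eq y a, he.inner_eq y b]
  have hD' : chartDenom e y ≠ 0 := hD.ne'
  have hDe : chartDenom e y = ‖y‖ + inner ℝ (e 2) y := rfl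
  generalize chartDenom e y = D at *
  generalize ‖y‖ = r at *
  generalize inner ℝ (e 0) y = y0 at *
  generalize inner ℝ (e 1) y = y1 at *
  generalize inner ℝ (e 2) y = y2 at *
  generalize inner ℝ (e 0) a = a0 at *
  generalize inner ℝ (e 1) a = a1 at *
  generalize inner ℝ (e 2) a = a2 at *
  generalize inner ℝ (e 0) b = b0 at *
  generalize inner ℝ (e 1) b = b1 at *
  generalize inner ℝ (e 2) b = b2 at *
  subst hDe
  field_simp
  -- The only relation needed is `‖y‖² = y0² + y1² + y2²`.
  linear_combination (a0 * b1 - a1 * b0) * r * (r + y2) * hr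

theorem chartDir_inner_zero (he : IsFrame e) (ξ : ℂ) : inner ℝ (e 0) (chartDir e ξ) = 2 * ξ.re := by
  simp [chartDir, inner_add_right, inner_smul_right, he.orthonormal.1, he.inner_ne]

theorem chartDir_inner_one (he : IsFrame e) (ξ : ℂ) : inner ℝ (e 1) (chartDir e ξ) = 2 * ξ.im := by
  simp [chartDir, inner_add_right, inner_smul_right, he.orthonormal.1, he.inner_ne]

theorem chartDir_inner_two (he : IsFrame e) (ξ : ℂ) :
    inner ℝ (e 2) (chartDir e ξ) = 1 - ξ.re ^ 2 - ξ.im ^ 2 := by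
  simp [chartDir, inner_add_right, inner_smul_right, he.orthonormal.1, he.inner_ne]

theorem norm_chartDir (he : IsFrame e) (ξ : ℂ) : ‖chartDir e ξ‖ = 1 + ξ.re ^ 2 + ξ.im ^ 2 := by
  have h : ‖chartDir e ξ‖ ^ 2 = (1 + ξ.re ^ 2 + ξ.im ^ 2) ^ 2 := by
    rw [he.norm_sq_eq, chartDir_inner_zero he, chartDir_inner_one he, chartDir_inner_two he]
    ring
  exact (pow_left_inj₀ (norm_nonneg _) (by positivity) two_ne_zero).1 h

theorem chartDir_ne_zero (he : IsFrame e) (ξ : ℂ) : chartDir e ξ ≠ 0 := by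
  rw [← norm_pos_iff, norm_chartDir he]
  positivity

theorem planeProj_chartDir (he : IsFrame e) (ξ : ℂ) :
    planeProj e (chartDir e ξ) = (2 : ℝ) • ξ := by
  apply Complex.ext
  · rw [planeProj_re, chartDir_inner_zero he]; simp
  · rw [planeProj_im, chartDir_inner_one he]; simp

theorem chartDenom_chartDir (he : IsFrame e) (ξ : ℂ) : chartDenom e (chartDir e ξ) = 2 := by
  rw [chartDenom, norm_chartDir he, chartDir_inner_two he]
  ring

theorem chartDenom_smul {r : ℝ} (hr : 0 ≤ r) (y : E3) :
    chartDenom e (r • y) = r * chartDenom e y := by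
  rw [chartDenom, chartDenom, norm_smul, Real.norm_of_nonneg hr, inner_smul_right]
  ring

/-- Directions are recovered, up to a positive factor, from their stereographic coordinates. -/
theorem chartDir_chart (he : IsFrame e) {q u : E3} (hD : 0 < chartDenom e (u - q)) :
    chartDir e (chart e q u) = (2 / chartDenom e (u - q)) • (u - q) := by
  have hr := he.norm_sq_eq (u - q)
  have hsum := congrArg (fun v => (2 / chartDenom e (u - q)) • v) (he.eq_sum (u - q))
  refine Eq.trans ?_ hsum
  rw [chartDir, chart, smul_add, smul_add, smul_smul, smul_smul, smul_smul]
  simp only [Complex.smul_re, Complex.smul_im, planeProj_re, planeProj_im, smul_eq_mul]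
  have hDe : chartDenom e (u - q) = ‖u - q‖ + inner ℝ (e 2) (u - q) := rfl
  congr 2
  · congr 1; field_simp
  · congr 1; field_simp
  · generalize chartDenom e (u - q) = D at *
    generalize ‖u - q‖ = r at *
    have : r = D - inner ℝ (e 2) (u - q) := by linarith
    rw [this] at hr
    field_simp
    linear_combination hr

section Body

variable {K : Set E3} {q : E3}

theorem convex_translate (hK : IsRegularBody K) : Convex ℝ ((q + ·) ⁻¹' K) :=
  hK.convex.translate_preimage_right q

theorem translate_mem_nhds (hq : q ∈ interior K) : (q + ·) ⁻¹' K ∈ 𝓝 (0 : E3) := by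
  have hc : ContinuousAt (q + ·) (0 : E3) := by fun_prop
  exact hc.preimage_mem_nhds (by simpa using mem_interior_iff_mem_nhds.1 hq)

theorem isBounded_translate (hK : IsRegularBody K) : Bornology.IsBounded ((q + ·) ⁻¹' K) := by
  obtain ⟨M, hM⟩ := hK.isCompact.isBounded.exists_norm_le
  rw [isBounded_iff_forall_norm_le]
  refine ⟨M + ‖q‖, fun x hx => ?_⟩
  have := norm_sub_le (q + x) q
  rw [add_sub_cancel_left] at this
  exact this.trans (add_le_add_left (hM _ hx) _)

theorem gauge_translate_eq_one_iff (hK : IsRegularBody K) (hq : q ∈ interior K) {y : E3} :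
    gauge ((q + ·) ⁻¹' K) y = 1 ↔ q + y ∈ frontier K := by
  rw [gauge_eq_one_iff_mem_frontier (convex_translate hK) (translate_mem_nhds hq)]
  have := (Homeomorph.addLeft q).preimage_frontier K
  exact Set.ext_iff.1 this.symm y

theorem gauge_translate_pos (hK : IsRegularBody K) (hq : q ∈ interior K) {y : E3} (hy : y ≠ 0) :
    0 < gauge ((q + ·) ⁻¹' K) y :=
  (gauge_pos (absorbent_nhds_zero (translate_mem_nhds hq))
    (NormedSpace.isVonNBounded_of_isBounded ℝ (isBounded_translate hK))).2 hy

theorem chartInv_mem (hK : IsRegularBody K) (hq : q ∈ interior K) (he : IsFrame e) (ξ : ℂ) :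
    chartInv K e q ξ ∈ frontier K := by
  rw [chartInv, ← gauge_translate_eq_one_iff hK hq,
    gauge_smul_of_nonneg (inv_nonneg.2 (gauge_nonneg _)), smul_eq_mul,
    inv_mul_cancel₀ (gauge_translate_pos hK hq (chartDir_ne_zero he ξ)).ne']

theorem continuous_chartInv (hK : IsRegularBody K) (hq : q ∈ interior K) (he : IsFrame e) :
    Continuous (chartInv K e q) := by
  have h1 : Continuous (chartDir e) := by
    unfold chartDir
    have := Complex.continuous_re
    have := Complex.continuous_im
    fun_prop
  have h2 := (continuous_gauge (convex_translate hK) (translate_mem_nhds hq)).comp h1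
  exact continuous_const.add ((h2.inv₀ fun ξ =>
    (gauge_translate_pos hK hq (chartDir_ne_zero he ξ)).ne').smul h1)

theorem chart_chartInv (hK : IsRegularBody K) (hq : q ∈ interior K) (he : IsFrame e) (ξ : ℂ) :
    chart e q (chartInv K e q ξ) = ξ := by
  have hpos := gauge_translate_pos hK hq (chartDir_ne_zero he ξ)
  rw [chart, chartInv, add_sub_cancel_left, chartDenom_smul (inv_nonneg.2 hpos.le),
    chartDenom_chartDir he, map_smul, planeProj_chartDir he, smul_smul, smul_smul]
  have : ((gauge ((q + ·) ⁻¹' K) (chartDir e ξ))⁻¹ * 2)⁻¹ *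
      ((gauge ((q + ·) ⁻¹' K) (chartDir e ξ))⁻¹ * 2) = 1 := inv_mul_cancel₀ (by positivity)
  rw [mul_assoc, this, one_smul]

theorem chartInv_chart (hK : IsRegularBody K) (hq : q ∈ interior K) (he : IsFrame e) {u : E3}
    (hu : u ∈ frontier K) (hD : 0 < chartDenom e (u - q)) :
    chartInv K e q (chart e q u) = u := by
  have h1 : gauge ((q + ·) ⁻¹' K) (u - q) = 1 :=
    (gauge_translate_eq_one_iff hK hq).2 (by rwa [add_sub_cancel])
  rw [chartInv, chartDir_chart he hD, gauge_smul_of_nonneg (by positivity), h1, smul_smul,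
    smul_eq_mul, mul_one, inv_mul_cancel₀ (by positivity), one_smul, add_sub_cancel]

end Body

end Chart

/-! ### Points of positive index and the enclosed piece -/

section Enclosed

variable {e : Fin 3 → E3} {K : Set E3} {c : ℝ → E3} {q : E3}

theorem continuousAt_chartDenom (e : Fin 3 → E3) (y : E3) : ContinuousAt (chartDenom e) y := by
  unfold chartDenom
  fun_prop

/-- Along the curve the chart is a positive real multiple of the plane projection relative to `q`,
and a positive factor does not wind. -/
theorem hasIndex_chart (he : IsFrame e) (hc : ContinuousOn c (Icc 0 1)) (h01 : c 0 = c 1) {k : ℤ}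
    (hk : HasIndex (fun t => planeProj e (c t) - planeProj e q) k) :
    HasIndex (fun t => chart e q (c t) - 0) k := by
  have hD : ∀ t ∈ Icc (0 : ℝ) 1, 0 < chartDenom e (c t - q) := fun t ht =>
    chartDenom_pos he (by rw [map_sub]; exact hk.ne_zero ht)
  have hDc : ContinuousOn (fun t => chartDenom e (c t - q)) (Icc 0 1) := fun t ht =>
    (continuousAt_chartDenom e _).comp_continuousWithinAt
      ((hc t ht).sub continuousWithinAt_const)
  have h0 : HasIndex (fun t => (((chartDenom e (c t - q))⁻¹ : ℝ) : ℂ)) 0 := by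
    refine HasIndex.of_slitPlane (b := 1) ?_ (by simp [h01]) one_ne_zero fun t ht => ?_
    · exact Complex.continuous_ofReal.comp_continuousOn (hDc.inv₀ fun t ht => (hD t ht).ne')
    · rw [div_one]
      exact Complex.ofReal_mem_slitPlane.2 (inv_pos.2 (hD t ht))
  have := h0.mul hk
  rw [zero_add] at this
  refine this.congr fun t _ => ?_
  rw [sub_zero, chart, map_sub, Complex.real_smul]

theorem planeProj_chartInv_zero (he : IsFrame e) (K : Set E3) (q : E3) :
    planeProj e (chartInv K e q 0) = planeProj e q := by
  rw [chartInv, map_add, map_smul, planeProj_chartDir he, smul_zero, smul_zero, add_zero]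

theorem HasIndex.notMem_image {ζ : ℝ → ℂ} {p : ℂ} {k : ℤ} (h : HasIndex (fun t => ζ t - p) k) :
    p ∉ ζ '' Icc 0 1 := by
  rintro ⟨t, ht, rfl⟩
  exact h.ne_zero ht (sub_self _)

/-- If the projection of a simple closed curve on the boundary of `K` winds a positive number of
times around an interior point of the projection of `K`, then it winds once, and the upper of the
two points of the boundary above it is enclosed by the curve. -/
theorem index_eq_one_and_exists_mem_enclosedPiece (hK : IsRegularBody K) (he : IsFrame e)
    (hmem : ∀ t ∈ Icc (0 : ℝ) 1, c t ∈ frontier K) (hc : ContinuousOn c (Icc 0 1))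
    (h01 : c 0 = c 1) (hi : InjOn c (Ico 0 1)) {t₀ : ℝ} (ht₀ : t₀ ∈ Ioo (0 : ℝ) 1)
    (hd : DifferentiableAt ℝ c t₀) (hd0 : deriv c t₀ ≠ 0) (hq : q ∈ interior K) {k : ℤ}
    (hk : HasIndex (fun t => planeProj e (c t) - planeProj e q) k) (hk0 : 0 < k) :
    k = 1 ∧ ∃ u ∈ enclosedPiece K c, planeProj e u = planeProj e q := by
  have hD : ∀ t ∈ Icc (0 : ℝ) 1, 0 < chartDenom e (c t - q) := fun t ht =>
    chartDenom_pos he (by rw [map_sub]; exact hk.ne_zero ht)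
  have ht₀' : t₀ ∈ Icc (0 : ℝ) 1 := Ioo_subset_Icc_self ht₀
  set ζ : ℝ → ℂ := fun t => chart e q (c t) with hζ
  have hζk : HasIndex (fun t => ζ t - 0) k := hasIndex_chart he hc h01 hk
  have hinv : ∀ t ∈ Icc (0 : ℝ) 1, chartInv K e q (ζ t) = c t := fun t ht =>
    chartInv_chart hK hq he (hmem t ht) (hD t ht)
  have hζc : ContinuousOn ζ (Icc 0 1) := by
    refine ContinuousOn.smul (ContinuousOn.inv₀ (fun t ht => ?_) fun t ht => (hD t ht).ne')
      ((planeProj e).continuous.comp_continuousOn (hc.sub continuousOn_const))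
    exact (continuousAt_chartDenom e _).comp_continuousWithinAt
      ((hc t ht).sub continuousWithinAt_const)
  have hζi : InjOn ζ (Ico 0 1) := fun s hs t ht hst => hi hs ht (by
    rw [← hinv s (Ico_subset_Icc_self hs), hst, hinv t (Ico_subset_Icc_self ht)])
  have hu := hmem t₀ ht₀'
  set a := deriv c t₀ with ha
  set N := normalMap K (c t₀) with hN
  set b := cross N a with hb
  have hNa : inner ℝ N a = 0 := hK.inner_normalMap_deriv hd.hasDerivAt (by
    filter_upwards [Icc_mem_nhds ht₀.1 ht₀.2] with s hs using hmem s hs)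
  have hNb : inner ℝ N b = 0 := by rw [real_inner_comm]; exact inner_cross_self_left N a
  set X : ℝ → E3 := fun s => radialProj K (c t₀ + s • b) with hX
  have hXd : HasDerivAt X b 0 := hK.hasDerivAt_radialProj hu hNb
  have hX0 : X 0 = c t₀ := by simp only [hX, zero_smul, add_zero]; exact hK.radialProj_eq_self hu
  have hζd : HasDerivAt ζ (chartDeriv e (c t₀ - q) a) t₀ :=
    hasDerivAt_chart hd.hasDerivAt (hD t₀ ht₀')
  have hσX : HasDerivAt (fun s => chart e q (X s)) (chartDeriv e (c t₀ - q) b) 0 := by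
    have := hasDerivAt_chart (e := e) (q := q) hXd (by rw [hX0]; exact hD t₀ ht₀')
    rwa [hX0] at this
  have hslope : Tendsto (fun ε : ℝ => (ε : ℂ)⁻¹ * (chart e q (X ε) - ζ t₀)) (𝓝[>] 0)
      (𝓝 (chartDeriv e (c t₀ - q) b)) := by
    have := hσX.tendsto_slope_zero_right
    simp only [zero_add, hX0, Complex.real_smul, Complex.ofReal_inv] at this
    exact this
  -- Since `a ⊥ N`, `a × (N × a) = |a|² N`, and `N · (c t₀ - q) = 1 - N · q` is positive because `q`
  -- is interior. So the chart keeps the conormal direction on the left.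
  have hor : 0 < ((starRingEnd ℂ) (chartDeriv e (c t₀ - q) a) *
      chartDeriv e (c t₀ - q) b).im := by
    rw [im_conj_chartDeriv_mul he (hD t₀ ht₀')]
    have hne : c t₀ - q ≠ 0 := by
      intro h
      have := hD t₀ ht₀'
      rw [h, chartDenom] at this
      simp at this
    have hpos : 0 < inner ℝ (cross a b) (c t₀ - q) := by
      rw [hb, cross_cross_eq, real_inner_comm N a, hNa, zero_smul, sub_zero,
        real_inner_self_eq_norm_sq, real_inner_smul_left, inner_sub_right,
        hK.inner_normalMap_self hu]
      have h1 := hK.inner_normalMap_le hu q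
      have h2 := (gauge_lt_one_iff_mem_interior hK.convex hK.mem_nhds).2 hq
      have h3 : 0 < ‖a‖ := norm_pos_iff.2 hd0
      have h4 : 0 < 1 - inner ℝ N q := by linarith
      positivity
    have h1 := hD t₀ ht₀'
    have h2 : 0 < ‖c t₀ - q‖ := norm_pos_iff.2 hne
    positivity
  obtain ⟨hk1, hleft⟩ := index_eq_one_and_left_mem hζc (by simp [hζ, h01]) hζi hζk hk0 ht₀ hζd
    hslope hor
  -- The coordinate `0` belongs to the direction `e 2`, so the witness is the boundary point
  -- directly above `q`.
  refine ⟨hk1, chartInv K e q 0, Or.inr ⟨chartInv_mem hK hq he 0, t₀, ht₀, hd0, ?_⟩,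
    planeProj_chartInv_zero he K q⟩
  have h0Γ : (0 : ℂ) ∈ (ζ '' Icc 0 1)ᶜ := hζk.notMem_image
  have hDX : ∀ᶠ ε in 𝓝[>] (0 : ℝ), 0 < chartDenom e (X ε - q) := by
    have : ContinuousAt (fun ε => chartDenom e (X ε - q)) 0 :=
      (continuousAt_chartDenom e _).comp (hXd.continuousAt.sub continuousAt_const)
    exact (this.eventually (lt_mem_nhds (by
      change 0 < chartDenom e (X 0 - q)
      rw [hX0]
      exact hD t₀ ht₀'))).filter_mono nhdsWithin_le_nhds
  have hXmem : ∀ᶠ ε in 𝓝[>] (0 : ℝ), X ε ∈ frontier K := by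
    have : ContinuousAt (fun s : ℝ => c t₀ + s • b) 0 := by fun_prop
    have h1 := this.eventually_ne (y := 0) (by simpa using hK.ne_zero hu)
    exact (h1.mono fun s hs => hK.radialProj_mem hs).filter_mono nhdsWithin_le_nhds
  filter_upwards [hleft, hDX, hXmem, self_mem_nhdsWithin] with ε h1 h2 h3 hε
  have hε : (ε : ℂ) ≠ 0 := by exact_mod_cast (ne_of_gt hε : ε ≠ 0)
  rw [mul_inv_cancel_left₀ hε, add_sub_cancel] at h1
  -- The inverse chart carries the plane component of `0` to a connected subset of `∂K` off the
  -- curve. It contains both the point above `q` and the displaced points.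
  have himage := (isPreconnected_connectedComponentIn (x := (0 : ℂ))
    (F := (ζ '' Icc 0 1)ᶜ)).image (chartInv K e q) (continuous_chartInv hK hq he).continuousOn
  refine himage.subset_connectedComponentIn ⟨0, mem_connectedComponentIn h0Γ, rfl⟩ ?_
    ⟨_, h1, chartInv_chart hK hq he h3 h2⟩
  rintro _ ⟨ξ, hξ, rfl⟩
  refine ⟨chartInv_mem hK hq he ξ, ?_⟩
  rintro ⟨t, ht, h⟩
  refine connectedComponentIn_subset _ _ hξ ⟨t, ht, ?_⟩
  simp only [hζ]
  rw [h, chart_chartInv hK hq he]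

/-- The projection of a closed curve in `K` does not wind around points outside the projection of
the interior of `K`. -/
theorem index_eq_zero_of_notMem_interior (hK : IsRegularBody K)
    (hmem : ∀ t ∈ Icc (0 : ℝ) 1, c t ∈ K) (hc : ContinuousOn c (Icc 0 1))
    (h01 : c 0 = c 1) {L : E3 →L[ℝ] ℂ} (hL : Function.Surjective L) {z : ℂ} {k : ℤ}
    (hk : HasIndex (fun t => L (c t) - z) k) (hz : z ∉ L '' interior K) : k = 0 := by
  have hopen : IsOpen (L '' interior K) := L.isOpenMap hL _ isOpen_interior
  obtain ⟨f, hf⟩ := geometric_hahn_banach_open_point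
    (hK.convex.interior.linear_image (L : E3 →ₗ[ℝ] ℂ)) hopen hz
  have hle : ∀ x ∈ K, f (L x) ≤ f z := by
    intro x hx
    have hx' : x ∈ closure (interior K) := by
      rw [hK.convex.closure_interior_eq_closure_of_nonempty_interior
        ⟨0, mem_interior_iff_mem_nhds.2 hK.mem_nhds⟩]
      exact subset_closure hx
    exact closure_minimal (t := {x | f (L x) ≤ f z}) (fun y hy => (hf _ ⟨y, hy, rfl⟩).le)
      (isClosed_le (by fun_prop) continuous_const) hx'
  -- `-w` represents the separating functional `f`, so `(L x - z) / w` has nonnegative real part for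
  -- `x ∈ K`; on the curve it is moreover nonzero, hence in the slit plane.
  set w : ℂ := -(f 1 + f Complex.I * Complex.I) with hw
  have hfz : ∀ v : ℂ, f v = v.re * f 1 + v.im * f Complex.I := by
    intro v
    conv_lhs => rw [← Complex.re_add_im v]
    rw [show (v.re : ℂ) + v.im * Complex.I = v.re • (1 : ℂ) + v.im • Complex.I by simp,
      map_add, map_smul, map_smul, smul_eq_mul, smul_eq_mul]
  have hw0 : w ≠ 0 := by
    intro h0
    have h1 : f 1 = 0 := by simpa [hw] using congrArg Complex.re h0
    have h2 : f Complex.I = 0 := by simpa [hw] using congrArg Complex.im h0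
    have h3 := hf _ ⟨0, mem_interior_iff_mem_nhds.2 hK.mem_nhds, rfl⟩
    rw [hfz, hfz z, h1, h2] at h3
    simp at h3
  refine hk.eq (HasIndex.of_slitPlane (b := w) ?_ (by simp [h01]) hw0 fun t ht => ?_)
  · exact (L.continuous.comp_continuousOn hc).sub continuousOn_const
  · have hne := hk.ne_zero ht
    have hquot : (L (c t) - z) / w ≠ 0 := div_ne_zero hne hw0
    by_contra hs
    rw [Complex.mem_slitPlane_iff, not_or, not_lt, not_not] at hs
    have hre : 0 ≤ ((L (c t) - z) / w).re := by
      have h1 := hle _ (hmem t ht)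
      have h2 : f (L (c t) - z) ≤ 0 := by rw [map_sub]; linarith
      rw [hfz] at h2
      rw [Complex.div_re, ← add_div]
      refine div_nonneg ?_ (Complex.normSq_nonneg _)
      simp only [hw, Complex.neg_re, Complex.neg_im, Complex.add_re, Complex.add_im,
        Complex.mul_re, Complex.mul_im, Complex.ofReal_re, Complex.ofReal_im, Complex.I_re,
        Complex.I_im] 
      linarith
    exact hquot (Complex.ext (le_antisymm hs.1 hre) hs.2)

end Enclosed

/-! ### Cones over boundary pieces and the area of their projections -/

section Volume

variable {e : Fin 3 → E3} {K : Set E3}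

/-- The volume of a right cylinder of height one. -/
theorem volume_cylinder (he : IsFrame e) (E : Set ℂ) :
    volume {x : E3 | planeProj e x ∈ E ∧ inner ℝ (e 2) x ∈ Ioc (0 : ℝ) 1} = volume E := by
  let Φ : E3 ≃ᵐ ℝ × (Fin 2 → ℝ) := (he.basis.measurableEquiv.trans
    (MeasurableEquiv.toLp 2 (Fin 3 → ℝ)).symm).trans
      (MeasurableEquiv.piFinSuccAbove (fun _ : Fin 3 => ℝ) 2)
  have hΦ : MeasurePreserving Φ volume (volume.prod volume) :=
    ((volume_preserving_piFinSuccAbove (fun _ : Fin 3 => ℝ) 2).comp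
      (EuclideanSpace.volume_preserving_symm_measurableEquiv_toLp (Fin 3))).comp
      he.basis.measurePreserving_measurableEquiv
  have hset : {x : E3 | planeProj e x ∈ E ∧ inner ℝ (e 2) x ∈ Ioc (0 : ℝ) 1} =
      Φ ⁻¹' (Ioc (0 : ℝ) 1 ×ˢ (Complex.measurableEquivPi.symm ⁻¹' E)) := by
    ext x
    have h2 : (Φ x).1 = inner ℝ (e 2) x := by
      rw [← he.basis_apply, ← he.basis.repr_apply_apply]
      rfl
    have h01 : Complex.measurableEquivPi.symm (Φ x).2 = planeProj e x := by
      rw [Complex.measurableEquivPi_symm_apply]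
      have h0 : (Φ x).2 0 = inner ℝ (e 0) x := by
        rw [← he.basis_apply, ← he.basis.repr_apply_apply]
        rfl
      have h1 : (Φ x).2 1 = inner ℝ (e 1) x := by
        rw [← he.basis_apply, ← he.basis.repr_apply_apply]
        rfl
      rw [h0, h1]
      apply Complex.ext
      · simp [planeProj_re]
      · simp [planeProj_im]
    rw [mem_preimage, mem_prod, mem_preimage, h2, h01, mem_ofPred_eq, and_comm]
  rw [hset, hΦ.measure_preimage_equiv, Measure.prod_prod,
    Complex.volume_preserving_equiv_pi.symm.measure_preimage_equiv, Real.volume_Ioc]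
  simp

/-- The map that turns cones over pieces of the boundary of `K` into right cylinders. -/
noncomputable def coneToCylinder (K : Set E3) (e : Fin 3 → E3) (x : E3) : E3 :=
  (gauge K x)⁻¹ • (x - inner ℝ (e 2) x • e 2) + gauge K x ^ 3 • e 2

/-- The derivative of `coneToCylinder`. -/
noncomputable def coneToCylinderDeriv (K : Set E3) (e : Fin 3 → E3) (x : E3) : E3 →L[ℝ] E3 :=
  (gauge K x)⁻¹ • (ContinuousLinearMap.id ℝ E3 - (innerSL ℝ (e 2)).smulRight (e 2)) +
    (-(gauge K x ^ 2)⁻¹ • fderiv ℝ (gauge K) x).smulRight (x - inner ℝ (e 2) x • e 2) +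
    ((3 * gauge K x ^ 2) • fderiv ℝ (gauge K) x).smulRight (e 2)

theorem hasFDerivAt_coneToCylinder (hK : IsRegularBody K) {x : E3} (hx : x ≠ 0) :
    HasFDerivAt (coneToCylinder K e) (coneToCylinderDeriv K e x) x := by
  have h1 := (hK.differentiableAt x hx).hasFDerivAt
  have h2 : HasFDerivAt (fun y : E3 => (gauge K y)⁻¹)
      (-(gauge K x ^ 2)⁻¹ • fderiv ℝ (gauge K) x) x :=
    (hasDerivAt_inv (hK.gauge_pos hx).ne').comp_hasFDerivAt x h1
  have h3 : HasFDerivAt (fun y : E3 => gauge K y ^ 3)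
      ((3 * gauge K x ^ 2) • fderiv ℝ (gauge K) x) x := by
    have := (hasDerivAt_pow 3 (gauge K x)).comp_hasFDerivAt x h1
    norm_num at this
    exact this
  have h4 : HasFDerivAt (fun y : E3 => y - inner ℝ (e 2) y • e 2)
      (ContinuousLinearMap.id ℝ E3 - (innerSL ℝ (e 2)).smulRight (e 2)) x :=
    (hasFDerivAt_id x).sub ((innerSL ℝ (e 2)).smulRight (e 2)).hasFDerivAt
  exact (h2.smul h4).add (h3.smul_const (e 2))

/-- In the frame, adding multiples of the last row to the horizontal rows removes the derivatives of
`μ⁻¹` and leaves `μ⁻¹` times the identity block. The determinant is thus `μ⁻² · 3μ²` times the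
derivative of `μ` along `e 2`. -/
theorem det_coneToCylinderDeriv (hK : IsRegularBody K) (he : IsFrame e) {x : E3} (hx : x ≠ 0) :
    (coneToCylinderDeriv K e x).det = 3 * fderiv ℝ (gauge K) x (e 2) := by
  have hm := (hK.gauge_pos hx).ne'
  rw [ContinuousLinearMap.det, ← LinearMap.det_toMatrix he.basis.toBasis, Matrix.det_fin_three]
  simp only [LinearMap.toMatrix_apply, OrthonormalBasis.coe_toBasis,
    OrthonormalBasis.coe_toBasis_repr_apply, OrthonormalBasis.repr_apply_apply, he.basis_apply]
  simp only [coneToCylinderDeriv, ContinuousLinearMap.coe_coe, add_apply,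
    smul_apply, sub_apply,
    ContinuousLinearMap.smulRight_apply, ContinuousLinearMap.id_apply, innerSL_apply_apply,
    inner_add_right, inner_sub_right, inner_smul_right, he.inner_self, smul_eq_mul,
    he.inner_ne (show (0 : Fin 3) ≠ 1 by decide), he.inner_ne (show (0 : Fin 3) ≠ 2 by decide),
    he.inner_ne (show (1 : Fin 3) ≠ 0 by decide), he.inner_ne (show (1 : Fin 3) ≠ 2 by decide),
    he.inner_ne (show (2 : Fin 3) ≠ 0 by decide), he.inner_ne (show (2 : Fin 3) ≠ 1 by decide)]
  field_simp
  ring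

theorem coneToCylinder_smul (hK : IsRegularBody K) {u : E3} (hu : u ∈ frontier K) {r : ℝ}
    (hr : 0 < r) :
    coneToCylinder K e (r • u) = (u - inner ℝ (e 2) u • e 2) + r ^ 3 • e 2 := by
  have h1 : gauge K (r • u) = r := by
    rw [gauge_smul_of_nonneg hr.le, hK.gauge_eq_one_iff.2 hu, smul_eq_mul, mul_one]
  rw [coneToCylinder, h1, inner_smul_right, mul_smul, ← smul_sub, smul_smul,
    inv_mul_cancel₀ hr.ne', one_smul]

/-- The cone over a piece `S` of the boundary of `K` has at least the volume of the cone with base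
the projection of `S` along a vector of `K` and with the length of this vector as its height. -/
theorem volume_planeProj_image_le (hK : IsRegularBody K) (he : IsFrame e) {p : ℝ} (hp : 0 < p)
    (hpK : p • e 2 ∈ K) {S : Set E3} (hS : S ⊆ frontier K) :
    volume (planeProj e '' S) ≤ ENNReal.ofReal (3 / p) * volume (cone S) := by
  -- A measurable hull makes it unnecessary to know that the cone is measurable; the origin is
  -- removed because the gauge is not differentiable there.
  set A : Set E3 := toMeasurable volume (cone S) ∩ {0}ᶜ with hA
  have hAm : MeasurableSet A := (measurableSet_toMeasurable _ _).inter (by simp)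
  have hsub : {x : E3 | planeProj e x ∈ planeProj e '' S ∧ inner ℝ (e 2) x ∈ Ioc (0 : ℝ) 1} ⊆
      coneToCylinder K e '' A := by
    rintro x ⟨⟨u, huS, hux⟩, hx0, hx1⟩
    have hu := hS huS
    -- The point `r • u` is sent to height `r³`, so the cube root of the height gives the preimage.
    set r : ℝ := inner ℝ (e 2) x ^ (1 / 3 : ℝ) with hr
    have hr0 : 0 < r := Real.rpow_pos_of_pos hx0 _
    have hr1 : r ≤ 1 := Real.rpow_le_one hx0.le hx1 (by norm_num)
    have hr3 : r ^ 3 = inner ℝ (e 2) x := by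
      rw [hr, ← Real.rpow_natCast, ← Real.rpow_mul hx0.le]
      norm_num
    refine ⟨r • u, ⟨subset_toMeasurable _ _ ⟨u, huS, r, ⟨hr0.le, hr1⟩, rfl⟩,
      smul_ne_zero hr0.ne' (hK.ne_zero hu)⟩, ?_⟩
    rw [coneToCylinder_smul hK hu hr0, hr3]
    have h0 : inner ℝ (e 0) u = inner ℝ (e 0) x := by rw [← planeProj_re, hux, planeProj_re]
    have h1 : inner ℝ (e 1) u = inner ℝ (e 1) x := by rw [← planeProj_im, hux, planeProj_im]
    conv_rhs => rw [← he.eq_sum x]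
    rw [← h0, ← h1]
    congr 1
    rw [sub_eq_iff_eq_add]
    exact (he.eq_sum u).symm
  have hdet : ∀ x ∈ A, ENNReal.ofReal |(coneToCylinderDeriv K e x).det| ≤
      ENNReal.ofReal (3 / p) := by
    intro x hx
    have hx0 : x ≠ 0 := hx.2
    refine ENNReal.ofReal_le_ofReal ?_
    rw [det_coneToCylinderDeriv hK he hx0, abs_mul, abs_of_pos (show (0 : ℝ) < 3 by norm_num),
      div_eq_mul_inv]
    -- The derivative of the gauge along `e 2` is bounded by the gauge of `e 2`, which is at most `1
    -- / p` since `p • e 2 ∈ K`.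
    refine mul_le_mul_of_nonneg_left ((hK.abs_fderiv_gauge_le hx0 _).trans ?_) (by norm_num)
    have := hK.gauge_le_one_iff.2 hpK
    rw [gauge_smul_of_nonneg hp.le, smul_eq_mul] at this
    rwa [le_inv_comm₀ (hK.gauge_pos (he.orthonormal.ne_zero 2)) hp, ← one_div,
      le_div_iff₀ (hK.gauge_pos (he.orthonormal.ne_zero 2))]
  calc volume (planeProj e '' S) = _ := (volume_cylinder he _).symm
    _ ≤ volume (coneToCylinder K e '' A) := measure_mono hsub
    _ ≤ ∫⁻ x in A, ENNReal.ofReal |(coneToCylinderDeriv K e x).det| :=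
        addHaar_image_le_lintegral_abs_det_fderiv volume hAm fun x hx =>
          (hasFDerivAt_coneToCylinder hK hx.2).hasFDerivWithinAt
    _ ≤ ∫⁻ _ in A, ENNReal.ofReal (3 / p) := setLIntegral_mono' hAm hdet
    _ = ENNReal.ofReal (3 / p) * volume A := setLIntegral_const _ _
    _ ≤ ENNReal.ofReal (3 / p) * volume (cone S) := by
        refine mul_le_mul' le_rfl ?_
        exact (measure_mono inter_subset_left).trans
          (measure_toMeasurable (μ := volume) (cone S)).le

theorem cone_subset (hK : IsRegularBody K) {S : Set E3} (hS : S ⊆ K) : cone S ⊆ K := by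
  rintro _ ⟨u, hu, l, hl, rfl⟩
  exact hK.convex.smul_mem_of_zero_mem (mem_of_mem_nhds hK.mem_nhds) (hS hu) hl

theorem frontier_subset (hK : IsRegularBody K) : frontier K ⊆ K :=
  hK.isCompact.isClosed.frontier_subset

theorem enclosedPiece_subset {c : ℝ → E3} (hmem : ∀ t ∈ Icc (0 : ℝ) 1, c t ∈ frontier K) :
    enclosedPiece K c ⊆ frontier K := by
  rintro x (⟨t, ht, rfl⟩ | hx)
  · exact hmem t ht
  · exact hx.1

end Volume

/-! ### The inequality for a single closed curve -/

section Inequality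

variable {K : Set E3} {c : ℝ → E3}

theorem IsPC1.clm_comp {E F : Type*} [NormedAddCommGroup E] [NormedSpace ℝ E]
    [NormedAddCommGroup F] [NormedSpace ℝ F] {c : ℝ → E} (hc : IsPC1 c) (L : E →L[ℝ] F) :
    IsPC1 fun t => L (c t) := by
  refine ⟨L.continuous.comp_continuousOn hc.continuousOn, ?_⟩
  obtain ⟨s, hs, M, hM⟩ := hc.exists_finite
  refine ⟨s, hs, ‖L‖ * M, fun t ht => ?_⟩
  have h := (L.hasFDerivAt (x := c t)).comp_hasDerivAt t (hM t ht).1.hasDerivAt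
  refine ⟨h.differentiableAt, ?_⟩
  change ‖deriv (L ∘ c) t‖ ≤ _
  rw [h.deriv]
  exact (L.le_opNorm _).trans (by gcongr; exact (hM t ht).2)

/-- Otherwise the derivative would vanish off a finite set and the curve would take the same value
at `0` and `1 / 2`. -/
theorem exists_regular_point (hc : IsPC1 c) (hi : InjOn c (Ico 0 1)) :
    ∃ t ∈ Ioo (0 : ℝ) 1, DifferentiableAt ℝ c t ∧ deriv c t ≠ 0 := by
  by_contra! hcon
  obtain ⟨s, hs, M, hM⟩ := hc.exists_finite
  have h := integral_eq_of_hasDerivAt_off_countable_of_le c (fun _ => (0 : E3))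
    (a := 0) (b := 1 / 2) (by norm_num) hs.countable
    (hc.continuousOn.mono (Icc_subset_Icc le_rfl (by norm_num))) (fun t ht => by
      have ht' : t ∈ Ioo (0 : ℝ) 1 := ⟨ht.1.1, ht.1.2.trans (by norm_num)⟩
      have h1 := (hM t ⟨ht', ht.2⟩).1
      rw [← hcon t ht' h1]
      exact h1.hasDerivAt) (by simp)
  simp only [intervalIntegral.integral_zero] at h
  have := hi (by norm_num) (by norm_num) (sub_eq_zero.1 h.symm)
  norm_num at this

/-- The signed integral over a simple closed curve is at most six times the volume of the cone
over the piece of the boundary that it encloses. -/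
theorem signedIntegral_le_six_mul_coneVol (hK : IsRegularBody K) (hc : IsPC1 c)
    (hmem : ∀ t ∈ Icc (0 : ℝ) 1, c t ∈ frontier K) (h01 : c 0 = c 1) (hi : InjOn c (Ico 0 1))
    {P : E3} (hP : P ∈ K) : signedIntegral P c ≤ 6 * coneVol K c := by
  have hnonneg : 0 ≤ coneVol K c := measureReal_nonneg
  rcases eq_or_ne P 0 with rfl | hP0
  · have : signedIntegral 0 c = 0 := by
      have h : ∀ x : E3, cross 0 x = 0 := fun x => by
        have := cross_smul_left 0 0 x
        rwa [zero_smul, zero_smul] at this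
      simp [signedIntegral, h]
    linarith
  set p : ℝ := ‖P‖ with hp
  have hp0 : 0 < p := norm_pos_iff.2 hP0
  obtain ⟨e, he, he2⟩ := exists_isFrame (P := p⁻¹ • P)
    (by rw [norm_smul, norm_inv, norm_norm, inv_mul_cancel₀ hp0.ne'])
  have hPe : P = p • e 2 := by rw [he2, smul_inv_smul₀ hp0.ne']
  have hγ : IsPC1 fun t => planeProj e (c t) := hc.clm_comp _
  obtain ⟨R, hR⟩ := (isCompact_curve hγ.continuousOn).isBounded.exists_norm_le
  obtain ⟨w, hwi, hw, hwint⟩ := hγ.integral_im_conj_mul_deriv (R := R + 1)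
    fun t ht => (hR _ ⟨t, ht, rfl⟩).trans_lt (lt_add_one R)
  obtain ⟨t₀, ht₀, hd, hd0⟩ := exists_regular_point hc hi
  have hsurj : Function.Surjective (planeProj e) := fun z => by
    refine ⟨z.re • e 0 + z.im • e 1, Complex.ext ?_ ?_⟩
    · rw [planeProj_re]
      simp [inner_add_right, inner_smul_right, he.orthonormal.1, he.inner_ne]
    · rw [planeProj_im]
      simp [inner_add_right, inner_smul_right, he.orthonormal.1, he.inner_ne]
  set E : Set ℂ := planeProj e '' enclosedPiece K c with hE
  have hS := enclosedPiece_subset hmem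
  have hcone : volume (cone (enclosedPiece K c)) ≠ ⊤ :=
    ((measure_mono (cone_subset hK (hS.trans (frontier_subset hK)))).trans_lt
      hK.isCompact.measure_lt_top).ne
  have hvol := volume_planeProj_image_le hK he hp0 (hPe ▸ hP) hS
  have hEfin : volume E ≠ ⊤ :=
    (hvol.trans_lt (ENNReal.mul_lt_top ENNReal.ofReal_lt_top hcone.lt_top)).ne
  have hreal : volume.real E ≤ 3 / p * coneVol K c := by
    have := ENNReal.toReal_mono (ENNReal.mul_ne_top ENNReal.ofReal_ne_top hcone) hvol
    rwa [ENNReal.toReal_mul, ENNReal.toReal_ofReal (by positivity)] at this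
  -- Only an upper bound is needed, so points of nonpositive index cost nothing. A measurable hull
  -- of the projection is used because `E` is not known to be measurable.
  have hle : ∀ᵐ z ∂volume.restrict (Metric.ball (0 : ℂ) (R + 1)),
      w z ≤ (toMeasurable volume E).indicator 1 z := by
    refine ae_restrict_of_ae ?_
    filter_upwards [measure_eq_zero_iff_ae_notMem.1 hγ.volume_image_eq_zero] with z hz
    obtain ⟨n, hn⟩ := exists_index hγ.continuousOn (by simp only [h01]) hz
    rw [hw z n hn]
    have hind : 0 ≤ (toMeasurable volume E).indicator (1 : ℂ → ℝ) z :=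
      indicator_nonneg (fun _ _ => zero_le_one) _
    rcases le_or_gt n 0 with h | h
    · exact le_trans (by exact_mod_cast h) hind
    · obtain ⟨q, hq, rfl⟩ : z ∈ planeProj e '' interior K := by
        by_contra hz'
        exact h.ne' (index_eq_zero_of_notMem_interior hK
          (fun t ht => frontier_subset hK (hmem t ht)) hc.continuousOn h01 hsurj hn hz')
      obtain ⟨h1, u, hu, hu'⟩ := index_eq_one_and_exists_mem_enclosedPiece hK he hmem
        hc.continuousOn h01 hi ht₀ hd hd0 hq hn h
      rw [h1, indicator_of_mem (subset_toMeasurable volume E (show _ ∈ E from ⟨u, hu, hu'⟩))]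
      simp
  have hwle : ∫ z in Metric.ball (0 : ℂ) (R + 1), w z ≤ volume.real E := by
    have hm := measurableSet_toMeasurable volume E
    have hmfin : volume (toMeasurable volume E) ≠ ⊤ := by rwa [measure_toMeasurable]
    have hint : Integrable ((toMeasurable volume E).indicator (1 : ℂ → ℝ)) :=
      (integrable_indicator_iff hm).2 (integrableOn_const hmfin)
    calc ∫ z in Metric.ball (0 : ℂ) (R + 1), w z
        ≤ ∫ z in Metric.ball (0 : ℂ) (R + 1), (toMeasurable volume E).indicator 1 z :=
          integral_mono_ae hwi hint.integrableOn hle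
      _ ≤ ∫ z, (toMeasurable volume E).indicator 1 z :=
          setIntegral_le_integral hint (ae_of_all _ fun z =>
            indicator_nonneg (fun _ _ => zero_le_one) _)
      _ = volume.real E := by
          rw [integral_indicator_one hm, measureReal_def, measure_toMeasurable, measureReal_def]
  have hsigned : signedIntegral P c =
      p * ∫ t in (0 : ℝ)..1, ((starRingEnd ℂ) (planeProj e (c t)) *
        deriv (fun t => planeProj e (c t)) t).im := by
    rw [signedIntegral, ← intervalIntegral.integral_const_mul]
    obtain ⟨M, hM⟩ := hc.exists_ae_bound
    refine intervalIntegral.integral_congr_ae_restrict ?_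
    rw [uIoc_of_le zero_le_one]
    filter_upwards [hM] with t ht
    have h1 : deriv (fun t => planeProj e (c t)) t = planeProj e (deriv c t) :=
      ((planeProj e).hasFDerivAt.comp_hasDerivAt t ht.1.hasDerivAt).deriv
    rw [h1, hPe, cross_smul_left, real_inner_smul_left, inner_cross_cyclic, real_inner_comm,
      he.inner_two_cross]
    simp only [Complex.mul_im, Complex.conj_re, Complex.conj_im, planeProj_re, planeProj_im]
    ring
  rw [hsigned, hwint]
  calc p * (2 * ∫ z in Metric.ball (0 : ℂ) (R + 1), w z)
      ≤ p * (2 * (3 / p * coneVol K c)) := by gcongr; exact hwle.trans hreal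
    _ = 6 * coneVol K c := by field_simp; ring

end Inequality

/-! ### Positivity of the cone volume -/

section Positivity

variable {K : Set E3} {c : ℝ → E3}

/-- A curve leaving a point of a simple closed curve in an orthogonal direction does not
immediately return to the closed curve. -/
theorem eventually_notMem_image (hc : ContinuousOn c (Icc 0 1)) (h01 : c 0 = c 1)
    (hi : InjOn c (Ico 0 1)) {t₀ : ℝ} (ht₀ : t₀ ∈ Ioo (0 : ℝ) 1) {a b : E3}
    (ha : HasDerivAt c a t₀) (ha0 : a ≠ 0) {X : ℝ → E3} (hX : HasDerivAt X b 0)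
    (hX0 : X 0 = c t₀) (hb0 : b ≠ 0) (hab : inner ℝ a b = 0) :
    ∀ᶠ ε in 𝓝[>] (0 : ℝ), X ε ∉ c '' Icc 0 1 := by
  -- The Gram determinant is positive at `(a, b)`, hence near it. A return `X ε = c t` close to `t₀`
  -- would make the two difference quotients parallel and their Gram determinant zero.
  have hcont : ContinuousAt (fun w : E3 × E3 => ‖w.1‖ ^ 2 * ‖w.2‖ ^ 2 - inner ℝ w.1 w.2 ^ 2)
      (a, b) := by fun_prop
  have hev := hcont.eventually (lt_mem_nhds (a := 0) (by
    have := norm_pos_iff.2 ha0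
    have := norm_pos_iff.2 hb0
    have h : 0 < ‖a‖ ^ 2 * ‖b‖ ^ 2 := by positivity
    simpa [hab] using h))
  rw [nhds_prod_eq] at hev
  obtain ⟨pa, hpa, pb, hpb, hpab⟩ := Filter.eventually_prod_iff.1 hev
  have hslope := (hasDerivAt_iff_tendsto_slope.1 ha).eventually hpa
  rw [eventually_nhdsWithin_iff, Metric.eventually_nhds_iff] at hslope
  obtain ⟨δ, hδ, hsl⟩ := hslope
  obtain ⟨η, hη, hfar⟩ := exists_norm_lower_bound hc h01 hi ht₀ hδ
  have hXs := hX.tendsto_slope_zero_right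
  simp only [zero_add, hX0] at hXs
  have hXc : ∀ᶠ ε in 𝓝[>] (0 : ℝ), ‖X ε - c t₀‖ < η := by
    have : ContinuousAt (fun ε => ‖X ε - c t₀‖) 0 := (hX.continuousAt.sub continuousAt_const).norm
    exact (this.eventually (gt_mem_nhds (by
      change ‖X 0 - c t₀‖ < η
      rwa [hX0, sub_self, norm_zero]))).filter_mono nhdsWithin_le_nhds
  filter_upwards [hXs.eventually hpb, hXs.eventually_ne hb0, hXc, self_mem_nhdsWithin]
    with ε h1 h2 h3 hε
  have hε : (ε : ℝ) ≠ 0 := ne_of_gt hε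
  rintro ⟨t, ht, htX⟩
  rw [← htX] at h1 h2 h3
  by_cases hfar' : t ≤ t₀ - δ ∨ t₀ + δ ≤ t
  · exact lt_asymm h3 (hfar t ht hfar')
  rw [not_or, not_le, not_le] at hfar'
  have htne : t ≠ t₀ := by
    rintro rfl
    simp at h2
  have h4 := hpab (hsl (y := t) (by rw [Real.dist_eq, abs_lt]; constructor <;> linarith) htne) h1
  have h5 : slope c t₀ t = ((t - t₀)⁻¹ * ε) • (ε⁻¹ • (c t - c t₀)) := by
    rw [slope_def_module, smul_smul, mul_assoc, mul_inv_cancel₀ hε, mul_one]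
  rw [h5] at h4
  generalize ε⁻¹ • (c t - c t₀) = β at h4
  simp only [norm_smul, real_inner_smul_left, real_inner_self_eq_norm_sq] at h4
  rw [mul_pow, Real.norm_eq_abs, sq_abs] at h4
  exact h4.ne (by ring)

/-- The points displaced to the left of a regular point trace a connected arc off the curve, hence
lie in a single component of its complement in `∂K`. A neighbourhood of one of them in `∂K`
therefore belongs to the enclosed piece, and the cone over it contains a nonempty open set. -/
theorem coneVol_pos (hK : IsRegularBody K) (hc : IsPC1 c)
    (hmem : ∀ t ∈ Icc (0 : ℝ) 1, c t ∈ frontier K) (h01 : c 0 = c 1) (hi : InjOn c (Ico 0 1)) :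
    0 < coneVol K c := by
  obtain ⟨t₀, ht₀, hd, hd0⟩ := exists_regular_point hc hi
  have hu := hmem t₀ (Ioo_subset_Icc_self ht₀)
  set a := deriv c t₀ with ha
  set N := normalMap K (c t₀) with hN
  set b := cross N a with hb
  have hNa : inner ℝ N a = 0 := hK.inner_normalMap_deriv hd.hasDerivAt (by
    filter_upwards [Icc_mem_nhds ht₀.1 ht₀.2] with s hs using hmem s hs)
  have hNb : inner ℝ N b = 0 := by rw [real_inner_comm]; exact inner_cross_self_left N a
  have hab : inner ℝ a b = 0 := by rw [real_inner_comm]; exact inner_cross_self_right N a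
  have hb0 : b ≠ 0 := by
    have hN0 : N ≠ 0 := by
      intro h
      have := hK.inner_normalMap_self hu
      rw [← hN, h, inner_zero_left] at this
      exact zero_ne_one this
    have h1 : ‖b‖ ^ 2 = ‖N‖ ^ 2 * ‖a‖ ^ 2 := by
      rw [← real_inner_self_eq_norm_sq, hb, inner_cross_cross, hNa, real_inner_self_eq_norm_sq,
        real_inner_self_eq_norm_sq, zero_mul, sub_zero]
    intro h
    rw [h, norm_zero] at h1
    have := norm_pos_iff.2 hN0
    have := norm_pos_iff.2 hd0
    have : 0 < ‖N‖ ^ 2 * ‖a‖ ^ 2 := by positivity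
    linarith
  set X : ℝ → E3 := fun s => radialProj K (c t₀ + s • b) with hX
  have hXd : HasDerivAt X b 0 := hK.hasDerivAt_radialProj hu hNb
  have hX0 : X 0 = c t₀ := by simp only [hX, zero_smul, add_zero]; exact hK.radialProj_eq_self hu
  have hline : ContinuousAt (fun s : ℝ => c t₀ + s • b) 0 := by fun_prop
  have hne := (hline.eventually_ne (y := 0) (by simpa using hK.ne_zero hu)).filter_mono
    (nhdsWithin_le_nhds (s := Ioi (0 : ℝ)))
  obtain ⟨ε₀, hε₀, hsub⟩ := (mem_nhdsGT_iff_exists_Ioo_subset (a := (0 : ℝ))).1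
    ((eventually_notMem_image hc.continuousOn h01 hi ht₀ hd.hasDerivAt hd0 hXd hX0 hb0 hab).and hne)
  have hε₀ : 0 < ε₀ := hε₀
  set Γ := c '' Icc 0 1
  have hΓ : IsClosed Γ := (isCompact_curve hc.continuousOn).isClosed
  have hXmem : ∀ ε ∈ Ioo 0 ε₀, X ε ∈ frontier K \ Γ := fun ε hε =>
    ⟨hK.radialProj_mem (hsub hε).2, (hsub hε).1⟩
  have hXcont : ContinuousOn X (Ioo 0 ε₀) := fun ε hε =>
    ((hK.continuousAt_radialProj (hsub hε).2).comp (f := fun s : ℝ => c t₀ + s • b)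
      (by fun_prop)).continuousWithinAt
  have hmid : ε₀ / 2 ∈ Ioo 0 ε₀ := ⟨by positivity, by linarith⟩
  set x₀ := X (ε₀ / 2)
  have hx₀ := hXmem _ hmid
  have hXU : ∀ ε ∈ Ioo 0 ε₀, X ε ∈ connectedComponentIn (frontier K \ Γ) x₀ := fun ε hε =>
    (isPreconnected_Ioo.image X hXcont).subset_connectedComponentIn ⟨_, hmid, rfl⟩
      (by rintro _ ⟨s, hs, rfl⟩; exact hXmem s hs) ⟨ε, hε, rfl⟩
  have hx₀0 := hK.ne_zero hx₀.1
  -- A small ball projects centrally into `∂K` off the curve; being connected, its projection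
  -- remains in the component of `x₀`.
  obtain ⟨r, hr, hball⟩ : ∃ r > 0, ∀ y ∈ Metric.ball x₀ r, y ≠ 0 ∧ radialProj K y ∉ Γ := by
    have h1 := (hK.continuousAt_radialProj hx₀0).eventually (hΓ.isOpen_compl.mem_nhds
      (by rw [hK.radialProj_eq_self hx₀.1]; exact hx₀.2))
    obtain ⟨r, hr, h⟩ := Metric.eventually_nhds_iff_ball.1 ((eventually_ne_nhds hx₀0).and h1)
    exact ⟨r, hr, h⟩
  have hballU : ∀ y ∈ Metric.ball x₀ r,
      radialProj K y ∈ connectedComponentIn (frontier K \ Γ) x₀ := fun y hy =>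
    ((convex_ball x₀ r).isPreconnected.image (radialProj K) fun z hz =>
      (hK.continuousAt_radialProj (hball z hz).1).continuousWithinAt).subset_connectedComponentIn
      ⟨x₀, Metric.mem_ball_self hr, hK.radialProj_eq_self hx₀.1⟩
      (by rintro _ ⟨z, hz, rfl⟩; exact ⟨hK.radialProj_mem (hball z hz).1, (hball z hz).2⟩)
      ⟨y, hy, rfl⟩
  have hpiece : ∀ y ∈ Metric.ball x₀ r, radialProj K y ∈ enclosedPiece K c := fun y hy => by
    refine Or.inr ⟨hK.radialProj_mem (hball y hy).1, t₀, ht₀, hd0, ?_⟩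
    rw [← connectedComponentIn_eq (hballU y hy)]
    filter_upwards [Ioo_mem_nhdsGT hε₀] with ε hε using hXU ε hε
  have hcone : Metric.ball x₀ r ∩ interior K ⊆ cone (enclosedPiece K c) := by
    rintro y ⟨hy, hyK⟩
    have hg := hK.gauge_pos (hball y hy).1
    refine ⟨radialProj K y, hpiece y hy, gauge K y,
      ⟨hg.le, hK.gauge_le_one_iff.2 (interior_subset hyK)⟩, ?_⟩
    rw [radialProj, radial, smul_inv_smul₀ hg.ne']
  have hnonempty : (Metric.ball x₀ r ∩ interior K).Nonempty := by
    have : x₀ ∈ closure (interior K) := by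
      rw [hK.convex.closure_interior_eq_closure_of_nonempty_interior
        ⟨0, mem_interior_iff_mem_nhds.2 hK.mem_nhds⟩]
      exact frontier_subset_closure hx₀.1
    exact mem_closure_iff.1 this _ Metric.isOpen_ball (Metric.mem_ball_self hr)
  have hpos := ((Metric.isOpen_ball.inter isOpen_interior).measure_pos volume hnonempty).trans_le
    (measure_mono hcone)
  have hfin := (measure_mono (μ := volume) (cone_subset hK ((enclosedPiece_subset hmem).trans
    (frontier_subset hK)))).trans_lt hK.isCompact.measure_lt_top
  exact ENNReal.toReal_pos hpos.ne' hfin.ne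

end Positivity

/-! ### Smoothness of the gauge -/

section GaugeSmooth

variable {K : Set E3}

/-- A symmetric convex set with nonempty interior is a neighbourhood of the origin. -/
theorem mem_nhds_zero_of_symm (hc : Convex ℝ K) (hs : ∀ x ∈ K, -x ∈ K)
    (hi : (interior K).Nonempty) : K ∈ 𝓝 (0 : E3) := by
  obtain ⟨x, hx⟩ := hi
  have h1 : -K = K := by
    ext y
    exact ⟨fun h => by simpa using hs _ h, fun h => hs _ h⟩
  have h2 : -x ∈ interior K := by
    have : -x ∈ Neg.neg '' interior K := ⟨x, hx, rfl⟩
    rw [← h1]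
    have h3 : IsOpen (-interior K) := isOpen_interior.neg
    exact interior_maximal (Set.neg_subset_neg.2 interior_subset) h3 (by simpa using hx)
  have h3 := hc.interior hx h2 (a := 1 / 2) (b := 1 / 2) (by norm_num) (by norm_num) (by norm_num)
  rw [smul_neg, add_neg_cancel] at h3
  exact mem_interior_iff_mem_nhds.1 h3

/-- The differential of a function cutting out the boundary of a convex body around `O` does not
vanish in the radial direction. -/
theorem fderiv_apply_self_ne_zero (hc : Convex ℝ K) (h0 : K ∈ 𝓝 (0 : E3))
    (hs : ∀ x ∈ K, -x ∈ K) {u : E3} (hu : u ∈ frontier K) {U : Set E3} (hU : IsOpen U) (huU : u ∈ U)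
    {f : E3 → ℝ} (hf : ContDiffOn ℝ ∞ f U) (hfU : ∀ y ∈ U, y ∈ frontier K ↔ f y = 0)
    (hdf : fderiv ℝ f u ≠ 0) : fderiv ℝ f u u ≠ 0 := by
  intro hL
  obtain ⟨w, hw⟩ : ∃ w, fderiv ℝ f u w = 1 := by
    obtain ⟨v, hv⟩ : ∃ v, fderiv ℝ f u v ≠ 0 := by
      by_contra! h
      exact hdf (ContinuousLinearMap.ext h)
    exact ⟨(fderiv ℝ f u v)⁻¹ • v, by rw [map_smul, smul_eq_mul, inv_mul_cancel₀ hv]⟩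
  have hfu : HasFDerivAt f (fderiv ℝ f u) u :=
    ((hf.contDiffAt (hU.mem_nhds huU)).differentiableAt (by simp)).hasFDerivAt
  have hf0 : f u = 0 := (hfU u huU).1 hu
  have hgu : gauge K u = 1 := (gauge_eq_one_iff_mem_frontier hc h0).2 hu
  set G := gauge K w with hG
  have hG0 : 0 ≤ G := gauge_nonneg w
  -- The constant is chosen so that `κ · gauge K w < 1`, which is what the final contradiction
  -- needs.
  set κ : ℝ := 1 / (2 * (G + 1)) with hκ
  have hκ0 : 0 < κ := by positivity
  have hκG : κ * G < 1 := by
    rw [hκ, div_mul_eq_mul_div, one_mul, div_lt_one (by positivity)]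
    linarith
  have hray : ∀ τ : ℝ, HasDerivAt (fun s : ℝ => f (u + s • (u + τ • w))) τ 0 := fun τ => by
    have h1 : HasDerivAt (fun s : ℝ => u + s • (u + τ • w)) (u + τ • w) 0 := by
      simpa using ((hasDerivAt_id (0 : ℝ)).smul_const (u + τ • w)).const_add u
    have h2 : HasFDerivAt f (fderiv ℝ f u) (u + (0 : ℝ) • (u + τ • w)) := by simpa using hfu
    have h3 := h2.comp_hasDerivAt 0 h1
    rwa [map_add, map_smul, hL, hw, zero_add, smul_eq_mul, mul_one] at h3
  have hslope : ∀ τ : ℝ, Tendsto (fun s : ℝ => s⁻¹ * f (u + s • (u + τ • w))) (𝓝[>] 0) (𝓝 τ) :=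
    fun τ => by simpa [hf0] using (hray τ).tendsto_slope_zero_right
  -- Compactness of the range of `τ` gives one `s` that works for all of them.
  have hin : ∀ᶠ s in 𝓝[>] (0 : ℝ), ∀ τ ∈ Icc (-κ) κ, u + s • (u + τ • w) ∈ U := by
    have h1 : IsCompact (Icc (-κ) κ) := isCompact_Icc
    have h2 : ∀ τ ∈ Icc (-κ) κ, ∀ᶠ z : ℝ × ℝ in 𝓝 0 ×ˢ 𝓝 τ, u + z.1 • (u + z.2 • w) ∈ U := by
      intro τ _
      rw [← nhds_prod_eq]
      have : ContinuousAt (fun z : ℝ × ℝ => u + z.1 • (u + z.2 • w)) (0, τ) := by fun_prop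
      exact this.eventually (hU.mem_nhds (by simpa using huU))
    exact (h1.eventually_forall_of_forall_eventually (fun τ hτ => by
      have := h2 τ hτ
      rwa [← nhds_prod_eq] at this)).filter_mono nhdsWithin_le_nhds
  obtain ⟨s, hs1, hs2, hs3, hs4⟩ := ((hslope κ).eventually (lt_mem_nhds hκ0) |>.and
    ((hslope (-κ)).eventually (gt_mem_nhds (neg_lt_zero.2 hκ0)) |>.and
    (hin.and self_mem_nhdsWithin))).exists
  have hs4 : 0 < s := hs4
  have hcont : ContinuousOn (fun τ : ℝ => f (u + s • (u + τ • w))) (Icc (-κ) κ) :=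
    hf.continuousOn.comp (by fun_prop) hs3
  -- To first order `f` is `sτ` at `u + s (u + τ w)`, so it changes sign between `τ = -κ` and `τ =
  -- κ`; a zero in between is a boundary point.
  obtain ⟨τ, hτ, hτ0⟩ := intermediate_value_Icc (by linarith) hcont
    (show (0 : ℝ) ∈ Icc _ _ from ⟨(neg_of_mul_neg_right hs2 (by positivity)).le,
      (pos_of_mul_pos_right hs1 (by positivity)).le⟩)
  have hfr := (hfU _ (hs3 τ hτ)).2 hτ0
  rw [← gauge_eq_one_iff_mem_frontier hc h0] at hfr
  -- Subadditivity now gives `1 + s ≤ 1 + sκ · gauge K w < 1 + s`.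
  have h1 : (1 + s) • u = (u + s • (u + τ • w)) + (-(s * τ)) • w := by module
  have h2 := gauge_add_le hc (absorbent_nhds_zero h0) (u + s • (u + τ • w)) ((-(s * τ)) • w)
  have h3 : gauge K ((-(s * τ)) • w) ≤ s * κ * G := by
    have h4 : ∀ r : ℝ, gauge K (r • w) = |r| * G := fun r => by
      rcases le_total 0 r with hr | hr
      · rw [gauge_smul_of_nonneg hr, abs_of_nonneg hr, smul_eq_mul]
      · rw [← gauge_neg hs, ← neg_smul, gauge_smul_of_nonneg (neg_nonneg.2 hr), abs_of_nonpos hr,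
          smul_eq_mul]
    rw [h4, abs_neg, abs_mul, abs_of_pos hs4]
    have := abs_le.2 hτ
    gcongr
  rw [← h1, gauge_smul_of_nonneg (by linarith), hgu, hfr, smul_eq_mul] at h2
  nlinarith

/-- The gauge of a symmetric convex body with smooth boundary is smooth away from the origin. -/
theorem contDiffAt_gauge (hc : Convex ℝ K) (h0 : K ∈ 𝓝 (0 : E3)) (hcpt : IsCompact K)
    (hs : ∀ x ∈ K, -x ∈ K) (hsm : IsSmoothHypersurface (frontier K)) {x : E3} (hx : x ≠ 0) :
    ContDiffAt ℝ ∞ (gauge K) x := by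
  have hg : 0 < gauge K x := (_root_.gauge_pos (absorbent_nhds_zero h0)
    (NormedSpace.isVonNBounded_of_isBounded ℝ hcpt.isBounded)).2 hx
  set g := gauge K x
  set u := g⁻¹ • x with hu_def
  have hxu : x = g • u := by rw [hu_def, smul_inv_smul₀ hg.ne']
  have hu : u ∈ frontier K := by
    rw [← gauge_eq_one_iff_mem_frontier hc h0, gauge_smul_of_nonneg (inv_nonneg.2 hg.le),
      smul_eq_mul, inv_mul_cancel₀ hg.ne']
  obtain ⟨U, hU, huU, f, hf, hfU, hdf⟩ := hsm u hu
  have hL := fderiv_apply_self_ne_zero hc h0 hs hu hU huU hf hfU hdf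
  have hfu := hf.contDiffAt (hU.mem_nhds huU)
  -- The implicit function theorem is applied to `f (t x) = 0`, solved for `t = 1 / gauge K x`; the
  -- radial derivative is invertible by `fderiv_apply_self_ne_zero`.
  have hF : ContDiffAt ℝ ∞ (fun z : E3 × ℝ => f (z.2 • z.1)) (x, g⁻¹) :=
    ContDiffAt.comp (x, g⁻¹) (g := f) (f := fun z : E3 × ℝ => z.2 • z.1) hfu
      (contDiffAt_snd.smul contDiffAt_fst)
  have hFd : HasFDerivAt (fun t : ℝ => f (t • x))
      (fderiv ℝ (fun z : E3 × ℝ => f (z.2 • z.1)) (x, g⁻¹) ∘L .inr ℝ E3 ℝ) g⁻¹ := by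
    have h1 : HasFDerivAt (fun t : ℝ => (x, t)) (ContinuousLinearMap.inr ℝ E3 ℝ) g⁻¹ :=
      hasFDerivAt_prodMk_right x g⁻¹
    exact (hF.differentiableAt (by simp)).hasFDerivAt.comp g⁻¹ h1
  have hFd' : HasDerivAt (fun t : ℝ => f (t • x)) (fderiv ℝ f u x) g⁻¹ := by
    have h1 : HasDerivAt (fun t : ℝ => t • x) x g⁻¹ := by
      simpa using (hasDerivAt_id g⁻¹).smul_const x
    exact (hfu.differentiableAt (by simp)).hasFDerivAt.comp_hasDerivAt g⁻¹ h1
  have hne : fderiv ℝ f u x ≠ 0 := by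
    rw [hxu, map_smul, smul_eq_mul]
    exact mul_ne_zero hg.ne' hL
  have hinv :
      (fderiv ℝ (fun z : E3 × ℝ => f (z.2 • z.1)) (x, g⁻¹) ∘L .inr ℝ E3 ℝ).IsInvertible := by
    refine ⟨ContinuousLinearEquiv.unitsEquivAut ℝ (Units.mk0 _ hne), ?_⟩
    ext
    rw [hFd.unique hFd'.hasFDerivAt]
    simp
  have h1 := hF.eventually_apply_implicitFunction (by simp) hinv
  have h2 := hF.implicitFunction_apply_self (by simp) hinv
  have h3 := hF.contDiffAt_implicitFunction (by simp) hinv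
  set ψ := hF.implicitFunction (by simp) hinv
  have hfu0 : f (g⁻¹ • x) = 0 := (hfU u huU).1 hu
  have h4 : ∀ᶠ y in 𝓝 x, ψ y • y ∈ U := by
    have : ContinuousAt (fun y => ψ y • y) x := h3.continuousAt.smul continuousAt_id
    exact this.eventually (hU.mem_nhds (by
      change ψ x • x ∈ U
      rwa [show ψ x = g⁻¹ from h2]))
  have h5 : ∀ᶠ y in 𝓝 x, 0 < ψ y :=
    h3.continuousAt.eventually (lt_mem_nhds (by rw [show ψ x = g⁻¹ from h2]; positivity))
  refine (h3.inv (by rw [h2]; positivity)).congr_of_eventuallyEq ?_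
  filter_upwards [h1, h4, h5] with y hy1 hy2 hy3
  have h6 := (hfU _ hy2).2 (hy1.trans hfu0)
  rw [← gauge_eq_one_iff_mem_frontier hc h0, gauge_smul_of_nonneg hy3.le, smul_eq_mul] at h6
  exact eq_inv_of_mul_eq_one_right h6

end GaugeSmooth

/-! ### The normal map and strict convexity -/

namespace IsSmoothStronglyConvexBody

variable {K : Set E3}

theorem contDiffAt_gauge (hK : IsSmoothStronglyConvexBody K) {x : E3} (hx : x ≠ 0) :
    ContDiffAt ℝ ∞ (gauge K) x :=
  SymMahler.contDiffAt_gauge hK.convex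
    (mem_nhds_zero_of_symm hK.convex hK.symm hK.interior_nonempty) hK.isCompact hK.symm
    hK.smooth_boundary hx

theorem isRegularBody (hK : IsSmoothStronglyConvexBody K) : IsRegularBody K where
  isCompact := hK.isCompact
  convex := hK.convex
  mem_nhds := mem_nhds_zero_of_symm hK.convex hK.symm hK.interior_nonempty
  symm := hK.symm
  differentiableAt _ hx := (hK.contDiffAt_gauge hx).differentiableAt (by simp)

theorem contDiffAt_halfSqGauge (hK : IsSmoothStronglyConvexBody K) {x : E3} (hx : x ≠ 0) :
    ContDiffAt ℝ ∞ (halfSqGauge K) x :=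
  contDiffAt_const.mul ((hK.contDiffAt_gauge hx).pow 2)

theorem contDiffAt_fderiv_halfSqGauge (hK : IsSmoothStronglyConvexBody K) {x : E3} (hx : x ≠ 0) :
    ContDiffAt ℝ ∞ (fderiv ℝ (halfSqGauge K)) x :=
  (hK.contDiffAt_halfSqGauge hx).fderiv_right (by simp)

theorem contDiffAt_normalMap (hK : IsSmoothStronglyConvexBody K) {x : E3} (hx : x ≠ 0) :
    ContDiffAt ℝ ∞ (normalMap K) x :=
  (InnerProductSpace.toDual ℝ E3).symm.contDiff.contDiffAt.comp x
    (hK.contDiffAt_fderiv_halfSqGauge hx)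

theorem contDiffAt_radialProj (hK : IsSmoothStronglyConvexBody K) {x : E3} (hx : x ≠ 0) :
    ContDiffAt ℝ ∞ (radialProj K) x :=
  ((hK.contDiffAt_gauge hx).inv (hK.isRegularBody.gauge_pos hx).ne').smul contDiffAt_id

end IsSmoothStronglyConvexBody

namespace IsRegularBody

variable {K : Set E3}

theorem halfSqGauge_smul {r : ℝ} (hr : 0 < r) (x : E3) :
    halfSqGauge K (r • x) = r ^ 2 * halfSqGauge K x := by
  rw [halfSqGauge, halfSqGauge, gauge_smul_of_nonneg hr.le, smul_eq_mul]
  ring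

theorem fderiv_halfSqGauge_smul {r : ℝ} (hr : 0 < r) (x : E3) :
    fderiv ℝ (halfSqGauge K) (r • x) = r • fderiv ℝ (halfSqGauge K) x := by
  have h1 : (fun y => halfSqGauge K (r • y)) = r ^ 2 • halfSqGauge K :=
    funext fun y => halfSqGauge_smul hr y
  have h2 := congrFun (congrArg (fderiv ℝ) h1) x
  rw [fderiv_comp_smul, fderiv_const_smul_field, pow_two, mul_smul] at h2
  exact smul_right_injective _ hr.ne' h2

/-- `halfSqGauge K` is homogeneous of degree two. This extends positivity of the Hessian from the
unit sphere to all nonzero points. -/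
theorem fderiv_fderiv_halfSqGauge_smul {r : ℝ} (hr : 0 < r) (x : E3) :
    fderiv ℝ (fderiv ℝ (halfSqGauge K)) (r • x) = fderiv ℝ (fderiv ℝ (halfSqGauge K)) x := by
  have h1 : (fun y => fderiv ℝ (halfSqGauge K) (r • y)) =
    r • fderiv ℝ (halfSqGauge K) := funext fun y => fderiv_halfSqGauge_smul hr y
  have h2 := congrFun (congrArg (fderiv ℝ) h1) x
  rw [fderiv_comp_smul] at h2
  refine smul_right_injective _ hr.ne' (h2.trans ?_)
  have h3 := fderiv_const_smul_field (𝕜 := ℝ) (F := E3 →L[ℝ] ℝ) (f := fderiv ℝ (halfSqGauge K)) r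
  exact congrFun h3 x

theorem normalMap_neg (hK : IsRegularBody K) (x : E3) : normalMap K (-x) = -normalMap K x := by
  have h1 : (fun y => halfSqGauge K ((-1 : ℝ) • y)) = halfSqGauge K :=
    funext fun y => by rw [neg_one_smul, halfSqGauge, hK.gauge_neg, halfSqGauge]
  have h2 := congrFun (congrArg (fderiv ℝ) h1) x
  rw [fderiv_comp_smul, neg_one_smul, neg_one_smul] at h2
  rw [normalMap, normalMap, gradient, gradient, ← h2, map_neg, neg_neg]

/-- A linear functional attaining its maximum over `K` at a boundary point is a multiple of the
normal. -/
theorem eq_smul_normalMap (hK : IsRegularBody K) {u y : E3} (hu : u ∈ frontier K)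
    (hmax : ∀ x ∈ K, inner ℝ y x ≤ inner ℝ y u) : y = (inner ℝ y u : ℝ) • normalMap K u := by
  have hu0 := hK.ne_zero hu
  have hu1 := hK.gauge_eq_one_iff.2 hu
  set M : ℝ := inner ℝ y u with hM
  have hle : ∀ x : E3, inner ℝ y x ≤ M * gauge K x := fun x => by
    by_cases hx : x = 0
    · simp [hx]
    have hg := hK.gauge_pos hx
    have h1 := hmax (radialProj K x) (frontier_subset_closure (hK.radialProj_mem hx) |>
      fun h => by rwa [hK.isCompact.isClosed.closure_eq] at h)
    rw [radialProj, radial, inner_smul_right, inv_mul_le_iff₀ hg] at h1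
    linarith
  have hd : HasFDerivAt (fun x => M * gauge K x - inner ℝ y x)
      (M • fderiv ℝ (gauge K) u - innerSL ℝ y) u :=
    ((hK.differentiableAt u hu0).hasFDerivAt.const_mul M).sub (innerSL ℝ y).hasFDerivAt
  -- By homogeneity `y · x ≤ M μ(x)` everywhere, with equality at `u`; comparing differentials at
  -- this minimum identifies `y`.
  have hmin : IsLocalMin (fun x => M * gauge K x - inner ℝ y x) u := by
    refine Eventually.of_forall fun x => ?_
    have := hle x
    simp only [hu1, mul_one, ← hM, sub_self]
    linarith
  have h0 := hmin.hasFDerivAt_eq_zero hd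
  refine ext_inner_right ℝ fun v => ?_
  have h1 := congrArg (fun L : E3 →L[ℝ] ℝ => L v) h0
  simp only [_root_.sub_apply, _root_.smul_apply, innerSL_apply_apply,
    _root_.zero_apply, smul_eq_mul] at h1
  rw [real_inner_smul_left, hK.inner_normalMap hu0, hu1]
  linarith

theorem frontier_subset_self (hK : IsRegularBody K) : frontier K ⊆ K :=
  hK.isCompact.isClosed.frontier_subset

end IsRegularBody

namespace IsSmoothStronglyConvexBody

variable {K : Set E3}

theorem hessian_pos_of_ne_zero (hK : IsSmoothStronglyConvexBody K) {x v : E3} (hx : x ≠ 0)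
    (hv : v ≠ 0) : 0 < fderiv ℝ (fderiv ℝ (halfSqGauge K)) x v v := by
  have hn : 0 < ‖x‖ := norm_pos_iff.2 hx
  have := hK.hessian_pos (‖x‖⁻¹ • x) (by
    rw [norm_smul, norm_inv, norm_norm, inv_mul_cancel₀ hn.ne']) v hv
  rwa [IsRegularBody.fderiv_fderiv_halfSqGauge_smul (inv_pos.2 hn)] at this

/-- Each tangent plane touches the body in a single point. -/
theorem eq_of_inner_normalMap_eq_one (hK : IsSmoothStronglyConvexBody K) {x y : E3}
    (hx : x ∈ frontier K) (hy : y ∈ K) (h : inner ℝ (normalMap K x) y = 1) : y = x := by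
  have hR := hK.isRegularBody
  by_contra hne
  set v := y - x with hv
  have hv0 : v ≠ 0 := sub_ne_zero.2 hne
  have hNv : inner ℝ (normalMap K x) v = 0 := by
    rw [hv, inner_sub_right, h, hR.inner_normalMap_self hx, sub_self]
  -- The segment from `x` to `y` lies both in `K` and in the supporting plane at `x`, hence in `∂K`.
  -- So the squared gauge is constant along it, against positivity of the Hessian at the midpoint.
  have hg : ∀ s ∈ Icc (0 : ℝ) 1, gauge K (x + s • v) = 1 := fun s hs => by
    refine le_antisymm (hR.gauge_le_one_iff.2 ?_) ?_
    · exact hK.convex.add_smul_sub_mem (hR.frontier_subset_self hx) hy hs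
    · have := hR.inner_normalMap_le hx (x + s • v)
      rwa [inner_add_right, inner_smul_right, hNv, hR.inner_normalMap_self hx, mul_zero,
        add_zero] at this
  have hne0 : ∀ s ∈ Icc (0 : ℝ) 1, x + s • v ≠ 0 := fun s hs h0 => by
    have := hg s hs
    rw [h0, gauge_zero] at this
    exact zero_ne_one this
  have hline : ∀ s : ℝ, HasDerivAt (fun s : ℝ => x + s • v) v s := fun s => by
    simpa using ((hasDerivAt_id s).smul_const v).const_add x
  have hd1 : ∀ s ∈ Ioo (0 : ℝ) 1, fderiv ℝ (halfSqGauge K) (x + s • v) v = 0 := fun s hs => by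
    have h1 := ((hK.contDiffAt_halfSqGauge (hne0 s (Ioo_subset_Icc_self hs))).differentiableAt
      (by simp)).hasFDerivAt.comp_hasDerivAt s (hline s)
    refine h1.unique ((hasDerivAt_const s (1 / 2 : ℝ)).congr_of_eventuallyEq ?_)
    filter_upwards [Icc_mem_nhds hs.1 hs.2] with r hr
    simp [halfSqGauge, hg r hr]
  have hm : (1 / 2 : ℝ) ∈ Ioo (0 : ℝ) 1 := by norm_num
  have hm0 := hne0 _ (Ioo_subset_Icc_self hm)
  have h2 := ((hK.contDiffAt_fderiv_halfSqGauge hm0).differentiableAt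
    (by simp)).hasFDerivAt.comp_hasDerivAt (1 / 2 : ℝ) (hline _)
  have h3 := h2.clm_apply (hasDerivAt_const (1 / 2 : ℝ) v)
  have h4 := h3.unique ((hasDerivAt_const (1 / 2 : ℝ) (0 : ℝ)).congr_of_eventuallyEq (by
    filter_upwards [isOpen_Ioo.mem_nhds hm] with s hs using hd1 s hs))
  simp only [map_zero, add_zero] at h4
  exact (hK.hessian_pos_of_ne_zero hm0 hv0).ne' h4

/-- Points with the same normal lie in each other's supporting planes. -/
theorem injOn_normalMap (hK : IsSmoothStronglyConvexBody K) : InjOn (normalMap K) (frontier K) :=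
  fun x hx y hy h => hK.eq_of_inner_normalMap_eq_one hy (hK.isRegularBody.frontier_subset_self hx)
    (by rw [← h]; exact hK.isRegularBody.inner_normalMap_self hx)

end IsSmoothStronglyConvexBody

/-! ### The polar body -/

section Polar

variable {K : Set E3}

/-- Bipolar theorem: a functional separating `v` from `K`, scaled to be at most `1` on `K`, is an
element of the polar body that violates the hypothesis. -/
theorem mem_of_forall_inner_le_one (hc : Convex ℝ K) (hcl : IsClosed K) (h0 : 0 ∈ K) {v : E3}
    (hv : ∀ P ∈ polarBody K, inner ℝ v P ≤ 1) : v ∈ K := by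
  by_contra hvK
  obtain ⟨f, r, hf, hr⟩ := geometric_hahn_banach_closed_point hc hcl hvK
  have hr0 : 0 < r := by simpa using hf 0 h0
  set y := (InnerProductSpace.toDual ℝ E3).symm f with hy
  have hyx : ∀ x, inner ℝ y x = f x := fun x => by
    rw [hy, InnerProductSpace.toDual_symm_apply]
  have h1 := hv (r⁻¹ • y) fun x hx => by
    rw [real_inner_smul_left, hyx, inv_mul_le_iff₀ hr0, mul_one]
    exact (hf x hx).le
  rw [inner_smul_right, real_inner_comm, hyx, inv_mul_le_iff₀ hr0, mul_one] at h1
  exact hr.not_ge h1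

/-- The gauge of the polar body is the support function. -/
theorem gauge_polarBody_eq (hsymm : ∀ x ∈ K, -x ∈ K) {u y : E3} (hu : u ∈ K)
    (hmax : ∀ x ∈ K, inner ℝ y x ≤ inner ℝ y u) : gauge (polarBody K) y = inner ℝ y u := by
  have hM : 0 ≤ (inner ℝ y u : ℝ) := by
    have := hmax _ (hsymm u hu)
    rw [inner_neg_right] at this
    linarith
  have hmem : ∀ r : ℝ, 0 < r → (r⁻¹ • y ∈ polarBody K ↔ inner ℝ y u ≤ r) := fun r hr => by
    have h1 : ∀ x, inner ℝ (r⁻¹ • y) x ≤ 1 ↔ inner ℝ y x ≤ r := fun x => by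
      rw [real_inner_smul_left, inv_mul_le_iff₀ hr, mul_one]
    exact ⟨fun h => (h1 u).1 (h u hu), fun h x hx => (h1 x).2 ((hmax x hx).trans h)⟩
  rw [gauge_def']
  refine le_antisymm ?_ (le_csInf ?_ fun r hr => (hmem r hr.1).1 hr.2)
  · refine le_of_forall_pos_le_add fun ε hε => ?_
    have h1 : 0 < inner ℝ y u + ε := by linarith
    exact csInf_le ⟨0, fun r hr => le_of_lt hr.1⟩ ⟨h1, (hmem _ h1).2 (by linarith)⟩
  · have h1 : 0 < (inner ℝ y u + 1 : ℝ) := by linarith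
    exact ⟨_, h1, (hmem _ h1).2 (by linarith)⟩

theorem convex_polarBody : Convex ℝ (polarBody K) := fun y hy z hz a b ha hb hab x hx => by
  rw [inner_add_left, real_inner_smul_left, real_inner_smul_left]
  nlinarith [hy x hx, hz x hx]

theorem isClosed_polarBody : IsClosed (polarBody K) := by
  have : polarBody K = ⋂ x ∈ K, {y | inner ℝ y x ≤ 1} := by ext; simp [polarBody]
  rw [this]
  exact isClosed_biInter fun x _ => isClosed_le (by fun_prop) continuous_const

namespace IsSmoothStronglyConvexBody

theorem isCompact_polarBody (hK : IsSmoothStronglyConvexBody K) : IsCompact (polarBody K) := by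
  obtain ⟨r, hr, hball⟩ := Metric.nhds_basis_closedBall.mem_iff.1 hK.isRegularBody.mem_nhds
  refine Metric.isCompact_of_isClosed_isBounded isClosed_polarBody
    (Metric.isBounded_closedBall (x := (0 : E3)) (r := r⁻¹) |>.subset fun y hy => ?_)
  rw [mem_closedBall_zero_iff]
  by_cases h0 : y = 0
  · rw [h0, norm_zero]
    positivity
  have hn : 0 < ‖y‖ := norm_pos_iff.2 h0
  have h1 := hy ((r * ‖y‖⁻¹) • y) (hball (by
    rw [mem_closedBall_zero_iff, norm_smul, norm_mul, norm_inv, norm_norm, mul_assoc,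
      inv_mul_cancel₀ hn.ne', mul_one, Real.norm_of_nonneg hr.le]))
  rw [inner_smul_right, real_inner_self_eq_norm_sq, pow_two, mul_assoc, inv_mul_cancel_left₀ hn.ne']
    at h1
  rwa [← mul_one r⁻¹, le_inv_mul_iff₀ hr]

theorem polarBody_mem_nhds (hK : IsSmoothStronglyConvexBody K) : polarBody K ∈ 𝓝 (0 : E3) := by
  obtain ⟨R, hR, hball⟩ := hK.isCompact.isBounded.subset_closedBall_lt 0 0
  refine mem_of_superset (Metric.closedBall_mem_nhds 0 (inv_pos.2 hR)) fun y hy x hx => ?_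
  have h1 := mem_closedBall_zero_iff.1 (hball hx)
  have h2 := mem_closedBall_zero_iff.1 hy
  calc (inner ℝ y x : ℝ) ≤ ‖y‖ * ‖x‖ := real_inner_le_norm y x
    _ ≤ R⁻¹ * R := by gcongr
    _ = 1 := inv_mul_cancel₀ hR.ne'

/-- A nonzero functional attains its maximum at a boundary point `u` and is a positive multiple of
the normal there. Its other maximisers lie in the supporting plane at `u`, which meets `K` only in
`u`. -/
theorem eq_of_isMaxOn (hK : IsSmoothStronglyConvexBody K) {y u x : E3} (hy : y ≠ 0) (hu : u ∈ K)
    (hmax : ∀ z ∈ K, inner ℝ y z ≤ inner ℝ y u) (hx : x ∈ K) (hxu : inner ℝ y u ≤ inner ℝ y x) :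
    x = u := by
  have hR := hK.isRegularBody
  have hM : 0 < (inner ℝ y u : ℝ) := by
    have hyg := hR.gauge_pos hy
    have h1 := hmax _ (hR.frontier_subset_self (hR.radialProj_mem hy))
    rw [radialProj, radial, inner_smul_right, real_inner_self_eq_norm_sq] at h1
    refine lt_of_lt_of_le ?_ h1
    have := norm_pos_iff.2 hy
    positivity
  have hfr : u ∈ frontier K := by
    have hu0 : u ≠ 0 := by
      rintro rfl
      simp at hM
    have hg := hR.gauge_pos hu0
    refine hR.gauge_eq_one_iff.1 (le_antisymm (hR.gauge_le_one_iff.2 hu) ?_)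
    have h1 := hmax _ (hR.frontier_subset_self (hR.radialProj_mem hu0))
    rw [radialProj, radial, inner_smul_right, inv_mul_le_iff₀ hg] at h1
    exact (le_mul_iff_one_le_left hM).1 h1
  refine hK.eq_of_inner_normalMap_eq_one hfr hx ?_
  have h1 := hR.eq_smul_normalMap hfr hmax
  have h2 : (inner ℝ y x : ℝ) = inner ℝ y u := le_antisymm (hmax x hx) hxu
  rw [h1, real_inner_smul_left] at h2
  exact mul_left_cancel₀ hM.ne' (h2.trans (by rw [← h1, mul_one]))

theorem isRegularBody_polarBody (hK : IsSmoothStronglyConvexBody K) :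
    IsRegularBody (polarBody K) where
  isCompact := hK.isCompact_polarBody
  convex := convex_polarBody
  mem_nhds := hK.polarBody_mem_nhds
  symm y hy x hx := by
    rw [inner_neg_left, ← inner_neg_right]
    exact hy _ (hK.symm x hx)
  differentiableAt y₀ hy₀ := by
    have hne : K.Nonempty := hK.interior_nonempty.mono interior_subset
    have hex : ∀ y : E3, ∃ u ∈ K, ∀ x ∈ K, inner ℝ y x ≤ inner ℝ y u := fun y =>
      hK.isCompact.exists_isMaxOn hne (f := fun x => inner ℝ y x) (by fun_prop)
    choose X hXK hX using hex
    have hφ : ∀ y, gauge (polarBody K) y = inner ℝ y (X y) := fun y =>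
      gauge_polarBody_eq hK.symm (hXK y) (hX y)
    -- By compactness every cluster point of the maximisers lies in `K`; passing to the limit shows
    -- that it maximises `y₀`, so uniqueness forces it to be `X y₀`.
    have hlim : Tendsto X (𝓝 y₀) (𝓝 (X y₀)) := by
      refine hK.isCompact.tendsto_nhds_of_unique_mapClusterPt (Eventually.of_forall hXK)
        fun z hz hcl => ?_
      obtain ⟨U, hU, hUz⟩ := mapClusterPt_iff_ultrafilter.1 hcl
      refine hK.eq_of_isMaxOn hy₀ (hXK y₀) (hX y₀) hz ?_
      have hUy : Tendsto (fun y : E3 => y) U (𝓝 y₀) := hU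
      exact le_of_tendsto_of_tendsto (hUy.inner tendsto_const_nhds) (hUy.inner hUz)
        (Eventually.of_forall fun y => hX y (X y₀) (hXK y₀))
    -- Envelope argument: the two maximality inequalities bound the error of linearization by `(y -
    -- y₀) · (X y - X y₀)`, which is `o(‖y - y₀‖)`.
    have hd : HasFDerivAt (gauge (polarBody K)) (innerSL ℝ (X y₀)) y₀ := by
      refine HasFDerivAt.of_isLittleO (Asymptotics.isLittleO_iff.2 fun ε hε => ?_)
      filter_upwards [Metric.tendsto_nhds.1 hlim ε hε] with y hy
      rw [dist_eq_norm] at hy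
      rw [hφ, hφ, innerSL_apply_apply]
      have h1 := hX y (X y₀) (hXK y₀)
      have h2 := hX y₀ (X y) (hXK y)
      have h3 : (inner ℝ (X y₀) (y - y₀) : ℝ) = inner ℝ y (X y₀) - inner ℝ y₀ (X y₀) := by
        rw [inner_sub_right, real_inner_comm, real_inner_comm y₀]
      have h4 : (inner ℝ (y - y₀) (X y - X y₀) : ℝ) ≤ ‖y - y₀‖ * ‖X y - X y₀‖ :=
        real_inner_le_norm _ _
      rw [inner_sub_right, inner_sub_left, inner_sub_left] at h4
      rw [h3, Real.norm_eq_abs, abs_le]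
      constructor
      · have : 0 ≤ ε * ‖y - y₀‖ := by positivity
        linarith
      · have : ‖y - y₀‖ * ‖X y - X y₀‖ ≤ ‖y - y₀‖ * ε := by gcongr
        linarith
    exact hd.differentiableAt

theorem normalMap_mem_frontier_polarBody (hK : IsSmoothStronglyConvexBody K) {u : E3}
    (hu : u ∈ frontier K) : normalMap K u ∈ frontier (polarBody K) := by
  have hR := hK.isRegularBody
  rw [← hK.isRegularBody_polarBody.gauge_eq_one_iff,
    gauge_polarBody_eq hK.symm (hR.frontier_subset_self hu) fun x hx => ?_,
    hR.inner_normalMap_self hu]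
  rw [hR.inner_normalMap_self hu]
  exact (hR.inner_normalMap_le hu x).trans (hR.gauge_le_one_iff.2 hx)

end IsSmoothStronglyConvexBody

end Polar

/-! ### Derivative bounds for piecewise smooth curves -/

section PiecewiseSmooth

theorem exists_mem_Ioo_of_strictMono {n : ℕ} {s : Fin (n + 1) → ℝ} {t : ℝ} (h0 : s 0 < t)
    (h1 : t < s (Fin.last n)) (ht : t ∉ range s) :
    ∃ k : Fin n, t ∈ Ioo (s k.castSucc) (s k.succ) := by
  by_contra! h
  have key : ∀ i, s i < t := fun i => by
    induction i using Fin.induction with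
    | zero => exact h0
    | succ k ih =>
      refine lt_of_not_ge fun hle => h k ⟨ih, hle.lt_of_ne fun he => ht ⟨_, he.symm⟩⟩
  exact lt_asymm h1 (key _)

theorem exists_deriv_bound_of_contDiffOn {E : Type*} [NormedAddCommGroup E] [NormedSpace ℝ E]
    {c : ℝ → E} {a b : ℝ} (hab : a < b) (hc : ContDiffOn ℝ ∞ c (Icc a b)) :
    ∃ M, 0 ≤ M ∧ ∀ t ∈ Ioo a b, DifferentiableAt ℝ c t ∧ ‖deriv c t‖ ≤ M := by
  have h1 : ContinuousOn (derivWithin c (Icc a b)) (Icc a b) :=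
    hc.continuousOn_derivWithin (uniqueDiffOn_Icc hab) (by simp)
  obtain ⟨M, hM⟩ := isCompact_Icc.exists_bound_of_continuousOn h1
  refine ⟨M, (norm_nonneg _).trans (hM a ⟨le_rfl, hab.le⟩), fun t ht => ?_⟩
  have hn := Icc_mem_nhds ht.1 ht.2
  refine ⟨((hc.contDiffAt hn).differentiableAt (by simp)), ?_⟩
  rw [← derivWithin_of_mem_nhds hn]
  exact hM t (Ioo_subset_Icc_self ht)

theorem IsPiecewiseSmooth.isPC1 {c : ℝ → E3} (hc : IsPiecewiseSmooth c) : IsPC1 c := by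
  obtain ⟨hcont, n, s, hs, h0, h1, hsm⟩ := hc
  choose M hM0 hM using fun k : Fin n =>
    exists_deriv_bound_of_contDiffOn (hs (Fin.castSucc_lt_succ (i := k))) (hsm k)
  refine ⟨hcont, range s, finite_range s, ∑ k, M k, fun t ht => ?_⟩
  obtain ⟨k, hk⟩ := exists_mem_Ioo_of_strictMono (h0 ▸ ht.1.1) (h1 ▸ ht.1.2) ht.2
  exact ⟨(hM k t hk).1, (hM k t hk).2.trans
    (Finset.single_le_sum (fun i _ => hM0 i) (Finset.mem_univ k))⟩

theorem IsPC1.of_contDiff {c : ℝ → E3} (hc : ContDiff ℝ ∞ c) : IsPC1 c := by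
  obtain ⟨M, -, hM⟩ := exists_deriv_bound_of_contDiffOn zero_lt_one (hc.contDiffOn (s := Icc 0 1))
  exact ⟨hc.continuous.continuousOn, ∅, finite_empty, M, fun t ht => hM t ht.1⟩

end PiecewiseSmooth

/-! ### Vector area integrals of concatenated, reversed and reflected curves -/

section Concat

variable {a b c : ℝ → E3}

theorem concat_eventuallyEq_left {t : ℝ} (ht : t < 1 / 2) :
    concat a b =ᶠ[𝓝 t] fun t => a (2 * t) := by
  filter_upwards [Iio_mem_nhds ht] with s hs
  exact if_pos (le_of_lt hs)

theorem concat_eventuallyEq_right {t : ℝ} (ht : 1 / 2 < t) :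
    concat a b =ᶠ[𝓝 t] fun t => b (2 * t - 1) := by
  filter_upwards [Ioi_mem_nhds ht] with s hs
  exact if_neg (not_le.2 hs)

theorem deriv_concat_left {t : ℝ} (ht : t < 1 / 2) :
    deriv (concat a b) t = (2 : ℝ) • deriv a (2 * t) := by
  rw [(concat_eventuallyEq_left ht).deriv_eq, deriv_comp_mul_left]

theorem deriv_concat_right {t : ℝ} (ht : 1 / 2 < t) :
    deriv (concat a b) t = (2 : ℝ) • deriv b (2 * t - 1) := by
  rw [(concat_eventuallyEq_right ht).deriv_eq]
  have h := deriv_comp_mul_left (c := (2 : ℝ)) (f := fun s => b (s - 1)) (x := t)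
  rwa [deriv_comp_sub_const] at h

theorem concat_zero : concat a b 0 = a 0 := by simp [concat]

theorem concat_one : concat a b 1 = b 1 := by norm_num [concat]

theorem IsPC1.concat (ha : IsPC1 a) (hb : IsPC1 b) (hab : a 1 = b 0) : IsPC1 (concat a b) := by
  constructor
  · have h1 : ContinuousOn (SymMahler.concat a b) (Icc 0 (1 / 2)) :=
      (ha.continuousOn.comp (f := fun t => 2 * t) (by fun_prop)
        (fun t ht => ⟨by linarith [ht.1], by linarith [ht.2]⟩)).congr fun t ht => if_pos ht.2
    have h2 : ContinuousOn (SymMahler.concat a b) (Icc (1 / 2) 1) :=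
      (hb.continuousOn.comp (f := fun t => 2 * t - 1) (by fun_prop)
        (fun t ht => ⟨by linarith [ht.1], by linarith [ht.2]⟩)).congr fun t ht => by
          rcases ht.1.eq_or_lt with rfl | h
          · simp [SymMahler.concat, hab]
          · exact if_neg (not_le.2 h)
    have h3 := h1.union_of_isClosed h2 isClosed_Icc isClosed_Icc
    rwa [Icc_union_Icc_eq_Icc (by norm_num) (by norm_num)] at h3
  · obtain ⟨F, hF, M, hM⟩ := ha.exists_finite
    obtain ⟨G, hG, N, hN⟩ := hb.exists_finite
    refine ⟨{1 / 2} ∪ ((fun t => 2 * t) ⁻¹' F ∪ (fun t => 2 * t - 1) ⁻¹' G),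
      (finite_singleton _).union ((hF.preimage fun x _ y _ h => ?_).union
        (hG.preimage fun x _ y _ h => ?_)), 2 * max M N, fun t ht => ?_⟩
    · simpa using h
    · simpa using h
    simp only [Set.mem_sdiff, mem_union, mem_singleton_iff, mem_preimage, not_or] at ht
    obtain ⟨⟨ht0, ht1⟩, hne, htF, htG⟩ := ht
    rcases lt_or_gt_of_ne hne with h | h
    · obtain ⟨h1, h2⟩ := hM (2 * t) ⟨⟨by linarith, by linarith⟩, htF⟩
      rw [deriv_concat_left h, norm_smul, Real.norm_two]
      refine ⟨?_, by gcongr; exact h2.trans (le_max_left _ _)⟩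
      exact (h1.comp t (f := fun t => 2 * t) (by fun_prop)).congr_of_eventuallyEq
        (concat_eventuallyEq_left h)
    · obtain ⟨h1, h2⟩ := hN (2 * t - 1) ⟨⟨by linarith, by linarith⟩, htG⟩
      rw [deriv_concat_right h, norm_smul, Real.norm_two]
      refine ⟨?_, by gcongr; exact h2.trans (le_max_right _ _)⟩
      exact (h1.comp t (f := fun t => 2 * t - 1) (by fun_prop)).congr_of_eventuallyEq
        (concat_eventuallyEq_right h)

theorem IsPC1.intervalIntegrable_cross (hc : IsPC1 c) :
    IntervalIntegrable (fun t => cross (c t) (deriv c t)) volume 0 1 := by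
  rw [intervalIntegrable_iff_integrableOn_Ioc_of_le zero_le_one]
  obtain ⟨M, hM⟩ := hc.exists_ae_bound
  obtain ⟨C, hC⟩ := isCompact_Icc.exists_bound_of_continuousOn hc.continuousOn
  refine Integrable.of_bound (μ := volume.restrict (Ioc (0 : ℝ) 1)) ?_ (C * M) ?_
  · exact continuous_cross.comp_aestronglyMeasurable
      (((hc.continuousOn.mono Ioc_subset_Icc_self).aestronglyMeasurable measurableSet_Ioc).prodMk
        (stronglyMeasurable_deriv c).aestronglyMeasurable)
  · filter_upwards [hM, ae_restrict_mem measurableSet_Ioc] with t h1 ht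
    have h2 := hC t (Ioc_subset_Icc_self ht)
    have h3 := (norm_nonneg _).trans h2
    exact (norm_cross_le _ _).trans (by gcongr; exact h1.2)

theorem IsPC1.inner_vecInt (hc : IsPC1 c) (P : E3) :
    inner ℝ (vecInt c) P = signedIntegral P c := by
  rw [vecInt, signedIntegral, real_inner_comm, ← innerSL_apply_apply ℝ,
    ← (innerSL ℝ P).intervalIntegral_comp_comm hc.intervalIntegrable_cross]
  refine intervalIntegral.integral_congr fun t _ => ?_
  simp only [innerSL_apply_apply]
  rw [real_inner_comm, inner_cross_cyclic, inner_cross_cyclic, real_inner_comm, real_inner_comm]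

theorem IsPC1.vecInt_concat (ha : IsPC1 a) (hb : IsPC1 b) (hab : a 1 = b 0) :
    vecInt (SymMahler.concat a b) = vecInt a + vecInt b := by
  have hi := (ha.concat hb hab).intervalIntegrable_cross
  have h1 := hi.mono_set (c := 0) (d := 1 / 2) (by
    rw [uIcc_of_le (by norm_num), uIcc_of_le zero_le_one]
    exact Icc_subset_Icc_right (by norm_num))
  have h2 := hi.mono_set (c := 1 / 2) (d := 1) (by
    rw [uIcc_of_le (by norm_num), uIcc_of_le zero_le_one]
    exact Icc_subset_Icc_left (by norm_num))
  rw [vecInt, ← intervalIntegral.integral_add_adjacent_intervals h1 h2]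
  congr 1
  · have h3 := intervalIntegral.smul_integral_comp_mul_left (a := 0) (b := 1 / 2)
      (fun t => cross (a t) (deriv a t)) (2 : ℝ)
    norm_num at h3
    rw [vecInt, ← h3, ← intervalIntegral.integral_smul]
    -- Open intervals are compared because the concatenation need not be differentiable at the
    -- junction `1 / 2`.
    refine intervalIntegral.integral_congr_Ioo_of_le (by norm_num) fun t ht => ?_
    have h4 : SymMahler.concat a b t = a (2 * t) := if_pos ht.2.le
    simp only [h4, deriv_concat_left ht.2, cross_smul_right]
  · have h3 := intervalIntegral.smul_integral_comp_mul_sub (a := 1 / 2) (b := 1)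
      (fun t => cross (b t) (deriv b t)) (2 : ℝ) 1
    norm_num at h3
    rw [vecInt, ← h3, ← intervalIntegral.integral_smul]
    refine intervalIntegral.integral_congr_Ioo_of_le (by norm_num) fun t ht => ?_
    have h4 : SymMahler.concat a b t = b (2 * t - 1) := if_neg (not_le.2 ht.1)
    simp only [h4, deriv_concat_right ht.1, cross_smul_right]

theorem vecInt_rev : vecInt (rev c) = -vecInt c := by
  have h := intervalIntegral.integral_comp_sub_left (a := 0) (b := 1)
    (fun t => cross (c t) (deriv c t)) (1 : ℝ)
  rw [sub_zero, sub_self] at h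
  rw [vecInt, vecInt, ← h, ← intervalIntegral.integral_neg]
  refine intervalIntegral.integral_congr fun t _ => ?_
  have h1 : deriv (rev c) t = -deriv c (1 - t) := deriv_comp_const_sub c 1 t
  simp only [h1]
  rw [← neg_one_smul ℝ (deriv c (1 - t)), cross_smul_right, neg_one_smul]
  rfl

theorem vecInt_neg : vecInt (-c) = vecInt c := by
  rw [vecInt, vecInt]
  refine intervalIntegral.integral_congr fun t _ => ?_
  have h1 : deriv (-c) t = -deriv c t := deriv.neg
  simp only [h1, Pi.neg_apply, cross_neg_neg]

end Concat

/-! ### The boundary loops of the pieces -/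

section Loops

variable {K : Set E3}

/-- The closed curve on `∂K` over the boundary of the triangle `X Y Z`. -/
noncomputable def triLoop (K : Set E3) (X Y Z : E3) : ℝ → E3 :=
  concat (orientedSegment K X Y) (concat (orientedSegment K Y Z) (orientedSegment K Z X))

theorem segment_ne_zero {P Q : E3} (h : cross P Q ≠ 0) (t : ℝ) : (1 - t) • P + t • Q ≠ 0 := by
  intro h0
  have hPP : cross P P = 0 := by
    apply ext_three <;> simp [cross_zero_apply, cross_one_apply, cross_two_apply, mul_comm]
  have h00 : ∀ x : E3, cross x 0 = 0 := fun x => by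
    have := cross_smul_right 0 x 0
    rwa [zero_smul, zero_smul] at this
  have h1 : cross P ((1 - t) • P + t • Q) = t • cross P Q := by
    apply ext_three <;> simp [cross_zero_apply, cross_one_apply, cross_two_apply] <;> ring
  rw [h0, h00] at h1
  rcases smul_eq_zero.1 h1.symm with h2 | h2
  · rw [h2] at h0
    have hP : P = 0 := by simpa using h0
    rw [hP, cross_swap, h00, neg_zero] at h
    exact h rfl
  · exact h h2

theorem IsSmoothStronglyConvexBody.contDiff_orientedSegment (hK : IsSmoothStronglyConvexBody K)
    {P Q : E3} (h : cross P Q ≠ 0) : ContDiff ℝ ∞ (orientedSegment K P Q) :=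
  contDiff_iff_contDiffAt.2 fun t =>
    (hK.contDiffAt_radialProj (segment_ne_zero h t)).comp t (by fun_prop)

theorem IsSmoothStronglyConvexBody.contDiff_normalMap_orientedSegment
    (hK : IsSmoothStronglyConvexBody K) {P Q : E3} (h : cross P Q ≠ 0) :
    ContDiff ℝ ∞ (normalMap K ∘ orientedSegment K P Q) :=
  contDiff_iff_contDiffAt.2 fun t =>
    (hK.contDiffAt_normalMap (hK.isRegularBody.ne_zero
      (hK.isRegularBody.radialProj_mem (segment_ne_zero h t)))).comp t
      (hK.contDiff_orientedSegment h).contDiffAt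

theorem orientedSegment_zero {P Q : E3} : orientedSegment K P Q 0 = radialProj K P := by
  simp [orientedSegment]

theorem orientedSegment_one {P Q : E3} : orientedSegment K P Q 1 = radialProj K Q := by
  simp [orientedSegment]

theorem rev_orientedSegment {P Q : E3} :
    rev (orientedSegment K P Q) = orientedSegment K Q P := by
  funext t
  rw [rev, orientedSegment, orientedSegment, sub_sub_cancel, add_comm]

namespace IsRegularBody

theorem radialProj_neg (hK : IsRegularBody K) (x : E3) : radialProj K (-x) = -radialProj K x := by
  rw [radialProj, radialProj, radial, radial, hK.gauge_neg, smul_neg]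

theorem neg_orientedSegment (hK : IsRegularBody K) {P Q : E3} :
    -orientedSegment K P Q = orientedSegment K (-P) (-Q) := by
  funext t
  rw [Pi.neg_apply, orientedSegment, orientedSegment, ← hK.radialProj_neg]
  congr 1
  module

end IsRegularBody

/-- Barycentric coordinates of the point with parameter `t` of the boundary of a triangle. -/
noncomputable def triWeight (t : ℝ) : Fin 3 → ℝ :=
  if t ≤ 1 / 2 then ![1 - 2 * t, 2 * t, 0]
  else if t ≤ 3 / 4 then ![0, 3 - 4 * t, 4 * t - 2] else ![4 * t - 3, 0, 4 - 4 * t]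

theorem triLoop_eq (X Y Z : E3) (t : ℝ) : triLoop K X Y Z t =
    radialProj K (triWeight t 0 • X + triWeight t 1 • Y + triWeight t 2 • Z) := by
  unfold triLoop concat triWeight orientedSegment
  split_ifs with h1 h2 h3 h3
  · simp
  · simp only [Matrix.cons_val]
    congr 1
    module
  · exfalso; linarith
  · exfalso; linarith
  · simp only [Matrix.cons_val]
    congr 1
    module

theorem triWeight_sum (t : ℝ) : triWeight t 0 + triWeight t 1 + triWeight t 2 = 1 := by
  unfold triWeight
  split_ifs <;> simp only [Matrix.cons_val] <;> ring

theorem injOn_triWeight : InjOn triWeight (Ico 0 1) := by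
  intro s hs t ht h
  have h0 := congrFun h 0
  have h1 := congrFun h 1
  have h2 := congrFun h 2
  have := hs.1
  have := hs.2
  have := ht.1
  have := ht.2
  unfold triWeight at h0 h1 h2
  split_ifs at h0 h1 h2 <;> simp only [Matrix.cons_val] at h0 h1 h2 <;> linarith

theorem triLoop_closed (X Y Z : E3) : triLoop K X Y Z 0 = triLoop K X Y Z 1 := by
  rw [triLoop, concat_zero, concat_one, concat_one, orientedSegment_zero, orientedSegment_one]

/-- Cramer's rule: when the determinant is nonzero, barycentric coordinates can be read off from
scalar products. -/
theorem coord_eq {X Y Z : E3} (a b c : ℝ) :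
    inner ℝ (cross Y Z) (a • X + b • Y + c • Z) = a * inner ℝ (cross X Y) Z ∧
    inner ℝ (cross Z X) (a • X + b • Y + c • Z) = b * inner ℝ (cross X Y) Z ∧
    inner ℝ (cross X Y) (a • X + b • Y + c • Z) = c * inner ℝ (cross X Y) Z := by
  simp only [inner_eq_sum, cross_zero_apply, cross_one_apply, cross_two_apply, PiLp.add_apply,
    PiLp.smul_apply, smul_eq_mul]
  refine ⟨?_, ?_, ?_⟩ <;> ring

theorem triWeight_combination_ne_zero {X Y Z : E3} (hD : inner ℝ (cross X Y) Z ≠ 0) (t : ℝ) :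
    triWeight t 0 • X + triWeight t 1 • Y + triWeight t 2 • Z ≠ 0 := by
  intro h
  obtain ⟨h0, h1, h2⟩ := coord_eq (X := X) (Y := Y) (Z := Z) (triWeight t 0) (triWeight t 1)
    (triWeight t 2)
  rw [h, inner_zero_right, zero_eq_mul, or_iff_left hD] at h0 h1 h2
  have := triWeight_sum t
  rw [h0, h1, h2] at this
  norm_num at this

namespace IsRegularBody

theorem triLoop_mem (hK : IsRegularBody K) {X Y Z : E3} (hD : inner ℝ (cross X Y) Z ≠ 0) (t : ℝ) :
    triLoop K X Y Z t ∈ frontier K := by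
  rw [triLoop_eq]
  exact hK.radialProj_mem (triWeight_combination_ne_zero hD t)

theorem injOn_triLoop (hK : IsRegularBody K) {X Y Z : E3} (hD : inner ℝ (cross X Y) Z ≠ 0) :
    InjOn (triLoop K X Y Z) (Ico 0 1) := by
  intro s hs t ht h
  rw [triLoop_eq, triLoop_eq] at h
  have hp := triWeight_combination_ne_zero (X := X) (Y := Y) (Z := Z) hD s
  have hq := triWeight_combination_ne_zero (X := X) (Y := Y) (Z := Z) hD t
  obtain ⟨r, hr⟩ : ∃ r : ℝ, triWeight s 0 • X + triWeight s 1 • Y + triWeight s 2 • Z =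
      r • (triWeight t 0 • X + triWeight t 1 • Y + triWeight t 2 • Z) := by
    have h1 := hK.gauge_pos hp
    rw [radialProj, radial, inv_smul_eq_iff₀ h1.ne', radialProj, smul_smul] at h
    exact ⟨_, h⟩
  obtain ⟨h0, h1, h2⟩ := coord_eq (X := X) (Y := Y) (Z := Z) (triWeight s 0) (triWeight s 1)
    (triWeight s 2)
  obtain ⟨k0, k1, k2⟩ := coord_eq (X := X) (Y := Y) (Z := Z) (triWeight t 0) (triWeight t 1)
    (triWeight t 2)
  rw [hr, inner_smul_right, k0, ← mul_assoc] at h0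
  rw [hr, inner_smul_right, k1, ← mul_assoc] at h1
  rw [hr, inner_smul_right, k2, ← mul_assoc] at h2
  replace h0 := mul_right_cancel₀ hD h0
  replace h1 := mul_right_cancel₀ hD h1
  replace h2 := mul_right_cancel₀ hD h2
  have hs1 := triWeight_sum s
  have ht1 := triWeight_sum t
  -- Points with the same central projection are proportional; as both sets of weights have sum one,
  -- the factor is one.
  have hr1 : r = 1 := by
    rw [← h0, ← h1, ← h2, ← mul_add, ← mul_add, ht1, mul_one] at hs1
    exact hs1
  rw [hr1, one_mul] at h0 h1 h2
  refine injOn_triWeight hs ht (funext fun i => ?_)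
  fin_cases i
  exacts [h0.symm, h1.symm, h2.symm]

end IsRegularBody

theorem cross_ne_zero_of_inner_ne_zero {X Y Z : E3} (hD : inner ℝ (cross X Y) Z ≠ 0) :
    cross X Y ≠ 0 ∧ cross Y Z ≠ 0 ∧ cross Z X ≠ 0 := by
  refine ⟨fun h => hD ?_, fun h => hD ?_, fun h => hD ?_⟩
  · rw [h, inner_zero_left]
  · rw [inner_cross_cyclic, h, inner_zero_left]
  · rw [inner_cross_cyclic, inner_cross_cyclic, h, inner_zero_left]

theorem comp_concat {g : E3 → E3} {a b : ℝ → E3} : g ∘ concat a b = concat (g ∘ a) (g ∘ b) := by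
  funext t
  exact apply_ite g _ _ _

/-- Vertices of the triangle below the `j`-th piece. -/
noncomputable def vertex (K : Set E3) : Fin 4 → Fin 3 → E3 :=
  ![![axisPt K 1, axisPt K 2, axisPt K 0], ![axisPt K 2, axisPt K 1, -axisPt K 0],
    ![-axisPt K 1, axisPt K 2, -axisPt K 0], ![axisPt K 2, -axisPt K 1, axisPt K 0]]

theorem IsRegularBody.axisPt_eq (hK : IsRegularBody K) (j : Fin 3) :
    ∃ r : ℝ, r ≠ 0 ∧ axisPt K j = EuclideanSpace.single j r := by
  have h0 : EuclideanSpace.single j (1 : ℝ) ≠ 0 := by simp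
  refine ⟨radial K (EuclideanSpace.single j 1), inv_ne_zero (hK.gauge_pos h0).ne', ?_⟩
  ext i
  by_cases h : i = j <;> simp [axisPt, radialProj, h]

theorem IsRegularBody.det_vertex_ne_zero (hK : IsRegularBody K) (j : Fin 4) :
    inner ℝ (cross (vertex K j 0) (vertex K j 1)) (vertex K j 2) ≠ 0 := by
  obtain ⟨a, ha, hA⟩ := hK.axisPt_eq 0
  obtain ⟨b, hb, hB⟩ := hK.axisPt_eq 1
  obtain ⟨c, hc, hC⟩ := hK.axisPt_eq 2
  fin_cases j <;>
  simp [vertex, hA, hB, hC, inner_eq_sum, cross_zero_apply, cross_one_apply, cross_two_apply, ha,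
    hb, hc]

/-- Reversing an arc swaps its endpoints, and by symmetry of `K` negating it negates them. So every
loop runs around a triangle with one vertex on each coordinate axis. -/
theorem IsRegularBody.loop_arcs (hK : IsRegularBody K) (j : Fin 4) :
    (arcs K).loop j = triLoop K (vertex K j 0) (vertex K j 1) (vertex K j 2) := by
  fin_cases j <;>
  simp [Arcs.loop, arcs, vertex, triLoop, rev_orientedSegment, hK.neg_orientedSegment]

theorem IsRegularBody.loop_polarArcs (hK : IsRegularBody K) (j : Fin 4) :
    (polarArcs K).loop j = normalMap K ∘ (arcs K).loop j := by
  have h1 : ∀ c : ℝ → E3, -(normalMap K ∘ c) = normalMap K ∘ (-c) := fun c =>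
    funext fun t => (hK.normalMap_neg _).symm
  have h2 : ∀ c : ℝ → E3, rev (normalMap K ∘ c) = normalMap K ∘ rev c := fun c => rfl
  fin_cases j <;>
  simp [Arcs.loop, polarArcs, comp_concat, h1, h2]

/-- The vectors of the pieces are the vector area integrals over their boundary curves. -/
theorem isPC1_loop_and_vec_eq {a : Arcs} (hd : ContDiff ℝ ∞ a.d) (he : ContDiff ℝ ∞ a.e)
    (hf : ContDiff ℝ ∞ a.f) (hg : ContDiff ℝ ∞ a.g) (hh : ContDiff ℝ ∞ a.h)
    (hi : ContDiff ℝ ∞ a.i) (A B C : E3) (hd' : a.d 0 = B ∧ a.d 1 = C)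
    (he' : a.e 0 = C ∧ a.e 1 = -B)
    (hf' : a.f 0 = C ∧ a.f 1 = A) (hg' : a.g 0 = A ∧ a.g 1 = -C) (hh' : a.h 0 = A ∧ a.h 1 = B)
    (hi' : a.i 0 = B ∧ a.i 1 = -A) (j : Fin 4) :
    IsPC1 (a.loop j) ∧ a.vec j = vecInt (a.loop j) := by
  have hrev : ∀ {c : ℝ → E3}, ContDiff ℝ ∞ c → ContDiff ℝ ∞ (rev c) := fun h =>
    h.comp (contDiff_const.sub contDiff_id)
  have key : ∀ {x y z : ℝ → E3}, ContDiff ℝ ∞ x → ContDiff ℝ ∞ y → ContDiff ℝ ∞ z →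
      x 1 = y 0 → y 1 = z 0 → IsPC1 (concat x (concat y z)) ∧
      vecInt (concat x (concat y z)) = vecInt x + (vecInt y + vecInt z) := by
    intro x y z hx hy hz hxy hyz
    have hx := IsPC1.of_contDiff hx
    have hy := IsPC1.of_contDiff hy
    have hz := IsPC1.of_contDiff hz
    have hc := hy.concat hz hyz
    have hxc : x 1 = concat y z 0 := by rw [concat_zero, hxy]
    exact ⟨hx.concat hc hxc, by rw [hx.vecInt_concat hc hxc, hy.vecInt_concat hz hyz]⟩
  have k0 := key hd hf hh (by rw [hd'.2, hf'.1]) (by rw [hf'.2, hh'.1])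
  have k1 := key (hrev hd) hi hg.neg (by simp [rev, hd', hi']) (by simp [hg', hi'])
  have k2 := key (hrev he) (hrev hg.neg) hh.neg (by simp [rev, he', hg']) (by simp [rev, hg', hh'])
  have k3 := key he hi.neg (hrev hf) (by simp [he', hi']) (by simp [rev, hf', hi'])
  fin_cases j
  · exact ⟨k0.1, (add_assoc _ _ _).trans k0.2.symm⟩
  · refine ⟨k1.1, Eq.trans ?_ k1.2.symm⟩
    change -vecInt a.d + vecInt a.g + vecInt a.i = _ + (_ + vecInt (-a.g))
    rw [vecInt_rev, vecInt_neg]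
    abel
  · refine ⟨k2.1, Eq.trans ?_ k2.2.symm⟩
    change -vecInt a.e - vecInt a.g + vecInt a.h = _ + (vecInt (rev (-a.g)) + vecInt (-a.h))
    rw [vecInt_rev, vecInt_rev, vecInt_neg, vecInt_neg]
    abel
  · refine ⟨k3.1, Eq.trans ?_ k3.2.symm⟩
    change vecInt a.e - vecInt a.f + vecInt a.i = _ + (vecInt (-a.i) + _)
    rw [vecInt_rev, vecInt_neg]
    abel

namespace IsSmoothStronglyConvexBody

theorem cross_axisPt (hK : IsSmoothStronglyConvexBody K) :
    cross (axisPt K 1) (axisPt K 2) ≠ 0 ∧ cross (axisPt K 2) (-axisPt K 1) ≠ 0 ∧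
    cross (axisPt K 2) (axisPt K 0) ≠ 0 ∧ cross (axisPt K 0) (-axisPt K 2) ≠ 0 ∧
    cross (axisPt K 0) (axisPt K 1) ≠ 0 ∧ cross (axisPt K 1) (-axisPt K 0) ≠ 0 := by
  have h := cross_ne_zero_of_inner_ne_zero (hK.isRegularBody.det_vertex_ne_zero 0)
  have hneg : ∀ {x y : E3}, cross y x ≠ 0 → cross x (-y) ≠ 0 := fun {x y} h => by
    rwa [← neg_one_smul ℝ, cross_smul_right, neg_one_smul, ← cross_swap]
  exact ⟨h.1, hneg h.1, h.2.1, hneg h.2.1, h.2.2, hneg h.2.2⟩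

theorem radialProj_axisPt (hK : IsSmoothStronglyConvexBody K) (j : Fin 3) :
    radialProj K (axisPt K j) = axisPt K j :=
  hK.isRegularBody.radialProj_eq_self (hK.isRegularBody.radialProj_mem (by simp))

theorem isPC1_loop_arcs (hK : IsSmoothStronglyConvexBody K) (j : Fin 4) :
    IsPC1 ((arcs K).loop j) ∧ (arcs K).vec j = vecInt ((arcs K).loop j) := by
  obtain ⟨hd, he, hf, hg, hh, hi⟩ := hK.cross_axisPt
  refine isPC1_loop_and_vec_eq (hK.contDiff_orientedSegment hd) (hK.contDiff_orientedSegment he)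
    (hK.contDiff_orientedSegment hf) (hK.contDiff_orientedSegment hg)
    (hK.contDiff_orientedSegment hh) (hK.contDiff_orientedSegment hi)
    (axisPt K 0) (axisPt K 1) (axisPt K 2) ?_ ?_ ?_ ?_ ?_ ?_ j <;>
  simp [arcs, orientedSegment_zero, orientedSegment_one, hK.isRegularBody.radialProj_neg,
    hK.radialProj_axisPt]

theorem isPC1_loop_polarArcs (hK : IsSmoothStronglyConvexBody K) (j : Fin 4) :
    IsPC1 ((polarArcs K).loop j) ∧ (polarArcs K).vec j = vecInt ((polarArcs K).loop j) := by
  obtain ⟨hd, he, hf, hg, hh, hi⟩ := hK.cross_axisPt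
  refine isPC1_loop_and_vec_eq (hK.contDiff_normalMap_orientedSegment hd)
    (hK.contDiff_normalMap_orientedSegment he) (hK.contDiff_normalMap_orientedSegment hf)
    (hK.contDiff_normalMap_orientedSegment hg) (hK.contDiff_normalMap_orientedSegment hh)
    (hK.contDiff_normalMap_orientedSegment hi) (normalMap K (axisPt K 0))
    (normalMap K (axisPt K 1)) (normalMap K (axisPt K 2)) ?_ ?_ ?_ ?_ ?_ ?_ j <;>
  simp [polarArcs, arcs, orientedSegment_zero, orientedSegment_one,
    hK.isRegularBody.radialProj_neg, hK.isRegularBody.normalMap_neg, hK.radialProj_axisPt]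

end IsSmoothStronglyConvexBody

/-- The vector area integral over a simple closed curve on the boundary of a body, divided by six
times the volume of the cone over the enclosed piece, lies in the polar body. -/
theorem vecInt_bounds {L : Set E3} (hL : IsRegularBody L) {c : ℝ → E3} (hc : IsPC1 c)
    (hmem : ∀ t ∈ Icc (0 : ℝ) 1, c t ∈ frontier L) (h01 : c 0 = c 1) (hi : InjOn c (Ico 0 1)) :
    0 < coneVol L c ∧ (∀ P ∈ L, inner ℝ (vecInt c) P ≤ 6 * coneVol L c) ∧
    ∀ P ∈ L, inner ℝ ((1 / (6 * coneVol L c)) • vecInt c) P ≤ 1 := by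
  have h1 := coneVol_pos hL hc hmem h01 hi
  have h2 : ∀ P ∈ L, inner ℝ (vecInt c) P ≤ 6 * coneVol L c := fun P hP => by
    rw [hc.inner_vecInt]
    exact signedIntegral_le_six_mul_coneVol hL hc hmem h01 hi hP
  refine ⟨h1, h2, fun P hP => ?_⟩
  rw [real_inner_smul_left, one_div, inv_mul_le_iff₀ (by positivity), mul_one]
  exact h2 P hP

end Loops

end SymMahler

/-! ### The proposition -/

open SymMahler
theorem mainTheorem6 (K : Set E3) (hK : IsSmoothStronglyConvexBody K) :
    (∀ c : ℝ → E3, IsSimpleClosedCurveOn (frontier K) c → ∀ P ∈ K,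
      (1 / 6) * signedIntegral P c ≤ coneVol K c) ∧
    (∀ j : Fin 4, 0 < polarPieceVol K j ∧
      (∀ P ∈ polarBody K, inner ℝ ((polarArcs K).vec j) P ≤ 6 * polarPieceVol K j) ∧
      (1 / (6 * polarPieceVol K j)) • (polarArcs K).vec j ∈ K) ∧
    (∀ j : Fin 4, 0 < pieceVol K j ∧
      (∀ P ∈ K, inner ℝ ((arcs K).vec j) P ≤ 6 * pieceVol K j) ∧
      (1 / (6 * pieceVol K j)) • (arcs K).vec j ∈ polarBody K) := by
  have hR := hK.isRegularBody
  have hloop : ∀ j, (∀ t, (arcs K).loop j t ∈ frontier K) ∧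
      (arcs K).loop j 0 = (arcs K).loop j 1 ∧ InjOn ((arcs K).loop j) (Ico 0 1) := fun j => by
    rw [hR.loop_arcs]
    have hD := hR.det_vertex_ne_zero j
    exact ⟨hR.triLoop_mem hD, triLoop_closed _ _ _, hR.injOn_triLoop hD⟩
  refine ⟨fun c hc P hP => ?_, fun j => ?_, fun j => ?_⟩
  · have := signedIntegral_le_six_mul_coneVol hR hc.piecewiseSmooth.isPC1 hc.mem hc.closed
      hc.simple hP
    linarith
  · obtain ⟨hmem, h01, hi⟩ := hloop j
    obtain ⟨hc, hvec⟩ := hK.isPC1_loop_polarArcs j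
    have h := vecInt_bounds hK.isRegularBody_polarBody hc
      (by
        rw [hR.loop_polarArcs]
        exact fun t _ => hK.normalMap_mem_frontier_polarBody (hmem t))
      (by rw [hR.loop_polarArcs, Function.comp_apply, h01, Function.comp_apply])
      (by
        rw [hR.loop_polarArcs]
        exact hK.injOn_normalMap.comp hi fun t _ => hmem t)
    rw [hvec]
    -- The estimate on `K°` says that the scaled vector lies in `K°°`, which is `K` by the bipolar
    -- theorem.
    exact ⟨h.1, h.2.1, mem_of_forall_inner_le_one hK.convex hK.isCompact.isClosed
      (mem_of_mem_nhds hR.mem_nhds) h.2.2⟩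
  · obtain ⟨hmem, h01, hi⟩ := hloop j
    obtain ⟨hc, hvec⟩ := hK.isPC1_loop_arcs j
    rw [hvec]
    exact vecInt_bounds hR hc (fun t _ => hmem t) h01 hi
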